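/- Let $k$ be a field and $R=k[x_1,x_2,x_3,\dots]$ the polynomial ring in countably many variables. Write $\mathscr K^b(\mathrm{proj}\,R)$ for the bounded homotopy category of finitely generated projective $R$-modules, $\mathscr D^b(R\text{-mod})$ for the bounded derived category of finitely presented $R$-modules, $\mathscr D(R)$ for the unbounded derived category of $R$-modules, and $\mathrm{fd}(R)$ for the supremum of the projective dimensions of those $R$-modules which have a finite projective resolution by finitely generated projective modules. Two t-structures $(\mathscr T_i^{\leqslant 0},\mathscr T_i^{\geqslant 0})$, $i=1,2$, on a triangulated category are *equivalent* if $\mathscr T_1^{\leqslant -n}\subseteq\mathscr T_2^{\leqslant 0}\subseteq\mathscr T_1^{\leqslant n}$ for some $n\in\mathbb N$. For a class $\mathscr X$ of objects of $\mathscr D(R)$, $\mathrm{Coprod}(\mathscr X)$ is the smallest full subcategory containing $\mathscr X$ and closed under coproducts and extensions; a t-structure is *generated by* $\mathscr X$ if it equals $(\mathrm{Coprod}(\mathscr X),(\mathrm{Coprod}(\mathscr X)[1])^\perp)$. The *preferred equivalence class* on $\mathscr D(R)$ consists of the t-structures equivalent to the one generated by $\{G[j]\mid j\ge 0\}$ for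 a compact generator $G$. Then: (1) $R$ is coherent and regular (each finitely presented $R$-module has finite projective dimension), $\mathrm{fd}(R)=\infty$, and the canonical triangle functor $\mathscr K^b(\mathrm{proj}\,R)\to\mathscr D^b(R\text{-mod})$ is an equivalence. Thus the singularity category $\mathscr D^b(R\text{-mod})/\mathscr K^b(\mathrm{proj}\,R)$ is zero. (2) Let $\mathscr A$ and $\mathscr B$ be the full subcategories of $\mathscr K^b(\mathrm{proj}\,R)$ of the objects $X$ with $H^i(X)=0$ for all $i>0$, respectively for all $i<0$, let $(-)^\vee=\mathbb R\mathrm{Hom}_R(-,R)$, and let $\mathscr A^\vee,\mathscr B^\vee$ be the (isomorphism-closed) images of $\mathscr A,\mathscr B$ under $(-)^\vee$. Then $(\mathscr A,\mathscr B)$ and $(\mathscr B^\vee,\mathscr A^\vee)$ are bounded t-structures on $\mathscr K^b(\mathrm{proj}\,R)$ which are not equivalent. More precisely, for every $n\ge 0$ the Koszul complex $K_n$ of $x_1,\dots,x_n$ lies in $\mathscr B$, so that $K_n^\vee\in\mathscr B^\vee$, but $K_n^\vee\notin\mathscr A[-(n-1)]$. Moreover, there is a t-structure on $\mathscr D(R)$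 generated by $\mathscr B^\vee$, and it is not in the preferred equivalence class. -/

import Mathlib

open CategoryTheory Limits Pretriangulated Triangulated
open scoped ZeroObject

universe w u

namespace PerfTStr

/-! ### Notions for triangulated categories -/

section Triangulated

universe v₁ u₁ t₁

variable {C : Type u₁} [Category.{v₁} C] [Preadditive C] [HasZeroObject C] [HasShift C ℤ]
  [∀ n : ℤ, (shiftFunctor C n).Additive] [Pretriangulated C]

/-- Two t-structures are equivalent if `T₁^{≤ -n} ⊆ T₂^{≤ 0} ⊆ T₁^{≤ n}` for some natural
number `n`. -/
def TEquivalent (t₁ t₂ : TStructure C) : Prop :=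
  ∃ n : ℕ, t₁.le (-(n : ℤ)) ≤ t₂.le 0 ∧ t₂.le 0 ≤ t₁.le (n : ℤ)

/-- A t-structure is bounded if every object lies in `T^{≤ n} ∩ T^{≥ m}` for some `n`, `m`. -/
def TBounded (t : TStructure C) : Prop :=
  ∀ X : C, t.bounded X

/-- An object `X` is compact if `Hom(X, -)`, with values in abelian groups, commutes with
all coproducts indexed by types in the universe `t₁`. -/
def IsCompactObj (X : C) : Prop :=
  ∀ ι : Type t₁, PreservesColimitsOfShape (Discrete ι) (preadditiveCoyoneda.obj (Opposite.op X))

/-- `Coprod A`: the smallest full (isomorphism-closed) subcategory which contains `A` and is closed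
under coproducts (indexed by types in the universe `t₁`) and extensions. -/
inductive Coprod (A : ObjectProperty C) : C → Prop
  | of (X : C) (hX : A X) : Coprod A X
  | of_iso {X Y : C} (e : X ≅ Y) (hX : Coprod A X) : Coprod A Y
  | coproduct {ι : Type t₁} (X : ι → C) (c : Cofan X) (hc : IsColimit c)
      (hX : ∀ i, Coprod A (X i)) : Coprod A c.pt
  | extension (T : Triangle C) (hT : T ∈ distTriang C) (h₁ : Coprod A T.obj₁)
      (h₃ : Coprod A T.obj₃) : Coprod A T.obj₂

/-- `t` is the t-structure generated by `A`: its aisle is `Coprod A` and its coaisle is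
`(Coprod A [1])^⊥`. (Here `P.shift (-1)` consists of the `X` with `X[-1] ∈ P`, i.e. it is `P[1]`.) -/
def IsGeneratedBy (t : TStructure C) (A : ObjectProperty C) : Prop :=
  t.le 0 = (Coprod.{v₁, u₁, t₁} A : ObjectProperty C) ∧
    t.ge 0 = (ObjectProperty.shift (Coprod.{v₁, u₁, t₁} A : ObjectProperty C)
      (-1 : ℤ)).rightOrthogonal

/-- A compact generator: a compact object `G` such that the smallest full triangulated subcategory
which contains `G` and is closed under coproducts is the whole category. -/
def IsCompactGenerator (G : C) : Prop :=
  IsCompactObj.{v₁, u₁, t₁} G ∧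
    ∀ P : ObjectProperty C, P.IsTriangulated → P.IsClosedUnderIsomorphisms →
      (∀ ι : Type t₁, P.IsClosedUnderColimitsOfShape (Discrete ι)) → P G → ∀ X : C, P X

/-- The objects isomorphic to `G[j]` for some `j ≥ 0`. -/
def nonnegShifts (G : C) : ObjectProperty C :=
  fun X => ∃ j : ℕ, Nonempty (X ≅ G⟦(j : ℤ)⟧)

/-- The preferred equivalence class of t-structures on a triangulated category with a compact
generator `G`: those equivalent to the t-structure generated by the `G[j]`, `j ≥ 0`. -/
def IsInPreferredClass (t : TStructure C) : Prop :=
  ∃ G : C, IsCompactGenerator.{v₁, u₁, t₁} G ∧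
    ∃ tG : TStructure C, IsGeneratedBy.{v₁, u₁, t₁} tG (nonnegShifts G) ∧ TEquivalent tG t

end Triangulated

variable (R : Type u) [CommRing R]

/-! ### Ring-theoretic notions -/

/-- A commutative ring is coherent if its finitely generated ideals are finitely presented. -/
def IsCoherentRing : Prop :=
  ∀ I : Ideal R, I.FG → Module.FinitePresentation R I

/-- A (coherent) ring is regular if each finitely presented module has finite projective
dimension. -/
def IsHomologicallyRegular : Prop :=
  ∀ M : ModuleCat.{u} R, Module.FinitePresentation R M → projectiveDimension M ≠ ⊤

/-- The module `M` has a finite projective resolution by finitely generated projective modules. -/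
def HasFiniteFGProjectiveResolution (M : ModuleCat.{u} R) : Prop :=
  ∃ P : ProjectiveResolution M, (∀ n, Module.Finite R (P.complex.X n)) ∧
    ∃ N : ℕ, ∀ n, N ≤ n → IsZero (P.complex.X n)

/-- The (small) finitistic dimension: the supremum of the projective dimensions of the modules which
have a finite projective resolution by finitely generated projective modules. -/
noncomputable def finitisticDimension : WithBot ℕ∞ :=
  ⨆ (M : ModuleCat.{u} R) (_ : HasFiniteFGProjectiveResolution R M), projectiveDimension M

/-! ### Bounded homotopy categories -/

/-- The finitely generated projective modules. -/
def fgProj : ObjectProperty (ModuleCat.{u} R) :=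
  fun M => Module.Finite R M ∧ Module.Projective R M

/-- The finitely presented modules. -/
def finPres : ObjectProperty (ModuleCat.{u} R) :=
  fun M => Module.FinitePresentation R M

lemma fgProj_le_finPres : fgProj R ≤ finPres R := by
  rintro M ⟨_, _⟩
  exact Module.finitePresentation_of_projective R M

instance : (fgProj R).IsClosedUnderIsomorphisms where
  of_iso e := by
    rintro ⟨_, _⟩
    exact ⟨Module.Finite.equiv e.toLinearEquiv, Module.Projective.of_equiv e.toLinearEquiv⟩

instance : (finPres R).IsClosedUnderIsomorphisms where
  of_iso e h := by
    have : Module.FinitePresentation R _ := h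
    exact Module.FinitePresentation.of_equiv e.toLinearEquiv

lemma fgProj_of_isZero (M : ModuleCat.{u} R) (h : IsZero M) : fgProj R M := by
  have : Subsingleton M := ModuleCat.subsingleton_of_isZero h
  exact ⟨inferInstance, inferInstance⟩

lemma finPres_of_isZero (M : ModuleCat.{u} R) (h : IsZero M) : finPres R M :=
  fgProj_le_finPres R M (fgProj_of_isZero R M h)

lemma fgProj_biprod (M N : ModuleCat.{u} R) (hM : fgProj R M) (hN : fgProj R N) :
    fgProj R (M ⊞ N) := by
  obtain ⟨_, _⟩ := hM
  obtain ⟨_, _⟩ := hN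
  refine (fgProj R).prop_of_iso (ModuleCat.biprodIsoProd M N).symm ?_
  exact ⟨inferInstanceAs (Module.Finite R (M × N)), inferInstanceAs (Module.Projective R (M × N))⟩

lemma finPres_biprod (M N : ModuleCat.{u} R) (hM : finPres R M) (hN : finPres R N) :
    finPres R (M ⊞ N) := by
  have : Module.FinitePresentation R M := hM
  have : Module.FinitePresentation R N := hN
  refine (finPres R).prop_of_iso (ModuleCat.biprodIsoProd M N).symm ?_
  exact inferInstanceAs (Module.FinitePresentation R (M × N))

variable {R} in
/-- Bounded cochain complexes all of whose terms satisfy `P`. -/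
def bddComplexes (P : ObjectProperty (ModuleCat.{u} R)) :
    ObjectProperty (CochainComplex (ModuleCat.{u} R) ℤ) :=
  fun K => (∃ a b : ℤ, K.IsStrictlyGE a ∧ K.IsStrictlyLE b) ∧ ∀ i, P (K.X i)

variable {R} in
/-- The property of objects of `K(R-Mod)` which defines the full subcategory of bounded complexes
all of whose terms satisfy `P`. -/
def bddHomotopy (P : ObjectProperty (ModuleCat.{u} R)) :
    ObjectProperty (HomotopyCategory (ModuleCat.{u} R) (ComplexShape.up ℤ)) :=
  fun X => bddComplexes P X.as

variable {R} in
lemma bddComplexes_mappingCone (P : ObjectProperty (ModuleCat.{u} R))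
    [P.IsClosedUnderIsomorphisms] (hP : ∀ M N, P M → P N → P (M ⊞ N))
    {K L : CochainComplex (ModuleCat.{u} R) ℤ} (f : K ⟶ L)
    (hK : bddComplexes P K) (hL : bddComplexes P L) :
    bddComplexes P (CochainComplex.mappingCone f) := by
  obtain ⟨⟨a, b, _, _⟩, hK⟩ := hK
  obtain ⟨⟨a', b', _, _⟩, hL⟩ := hL
  refine ⟨⟨min (a - 1) a', max b b', ?_, ?_⟩, fun i => ?_⟩
  · rw [CochainComplex.isStrictlyGE_iff]
    intro i hi
    rw [CochainComplex.mappingCone.isZero_X_iff]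
    exact ⟨K.isZero_of_isStrictlyGE a _ (by grind), L.isZero_of_isStrictlyGE a' _ (by grind)⟩
  · rw [CochainComplex.isStrictlyLE_iff]
    intro i hi
    rw [CochainComplex.mappingCone.isZero_X_iff]
    exact ⟨K.isZero_of_isStrictlyLE b _ (by grind), L.isZero_of_isStrictlyLE b' _ (by grind)⟩
  · exact P.prop_of_iso (HomologicalComplex.homotopyCofiber.XIsoBiprod f i (i + 1) rfl).symm
      (hP _ _ (hK _) (hL _))

variable {R} in
lemma bddHomotopy_isTriangulated (P : ObjectProperty (ModuleCat.{u} R))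
    [P.IsClosedUnderIsomorphisms] (hP₀ : ∀ M, IsZero M → P M)
    (hP : ∀ M N, P M → P N → P (M ⊞ N)) : (bddHomotopy P).IsTriangulated := by
  have h0 : (bddHomotopy P).ContainsZero :=
    ⟨(HomotopyCategory.quotient _ _).obj ((CochainComplex.singleFunctor _ 0).obj 0),
      Functor.map_isZero _ (Functor.map_isZero _ (isZero_zero _)),
      ⟨0, 0, inferInstanceAs (CochainComplex.IsStrictlyGE
          ((CochainComplex.singleFunctor (ModuleCat.{u} R) 0).obj 0) 0),
        inferInstanceAs (CochainComplex.IsStrictlyLE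
          ((CochainComplex.singleFunctor (ModuleCat.{u} R) 0).obj 0) 0)⟩,
      fun i => hP₀ _ ((HomologicalComplex.eval (ModuleCat.{u} R) (ComplexShape.up ℤ) i).map_isZero
        ((CochainComplex.singleFunctor (ModuleCat.{u} R) 0).map_isZero (isZero_zero _)))⟩
  have h1 : (bddHomotopy P).IsStableUnderShift ℤ :=
    { isStableUnderShiftBy := fun n =>
        { le_shift := by
            intro X hX
            obtain ⟨K : CochainComplex _ _, rfl⟩ := X.quotient_obj_surjective
            obtain ⟨⟨a, b, ha, hb⟩, h⟩ := hX
            have ha' : K.IsStrictlyGE a := ha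
            have hb' : K.IsStrictlyLE b := hb
            rw [ObjectProperty.prop_shift_iff, HomotopyCategory.shift_quotient_obj]
            exact ⟨⟨a - n, b - n, K.isStrictlyGE_shift a n (a - n) (by lia),
              K.isStrictlyLE_shift b n (b - n) (by lia)⟩, fun i => h (i + n)⟩ } }
  have h3 : (bddHomotopy P).IsTriangulatedClosed₃ :=
    { ext₃' := fun T hT h₁ h₂ => by
        obtain ⟨f : T.obj₁.as ⟶ T.obj₂.as, hf⟩ :=
          (HomotopyCategory.quotient _ _).map_surjective T.mor₁
        refine ⟨(HomotopyCategory.quotient _ _).obj (CochainComplex.mappingCone f),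
          bddComplexes_mappingCone P hP f h₁ h₂,
          ⟨Triangle.π₃.mapIso (isoTriangleOfIso₁₂ T _ hT
            (HomotopyCategory.mappingCone_triangleh_distinguished f)
            (Iso.refl _) (Iso.refl _) ?_)⟩⟩
        exact (Category.comp_id _).trans (hf.symm.trans (Category.id_comp _).symm) }
  exact { toIsTriangulatedClosed₂ := .of_isTriangulatedClosed₃ }

instance : (bddHomotopy (fgProj R)).IsTriangulated :=
  bddHomotopy_isTriangulated _ (fgProj_of_isZero R) (fgProj_biprod R)

instance : (bddHomotopy (finPres R)).IsTriangulated :=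
  bddHomotopy_isTriangulated _ (finPres_of_isZero R) (finPres_biprod R)

/-- `K^b(proj R)`: the homotopy category of bounded complexes of finitely generated projective
modules, as a full triangulated subcategory of `K(R-Mod)`. -/
abbrev KbProj : Type _ := (bddHomotopy (fgProj R)).FullSubcategory

/-- `K^b(R-mod)`: the homotopy category of bounded complexes of finitely presented modules. -/
abbrev KbMod : Type _ := (bddHomotopy (finPres R)).FullSubcategory

/-- The acyclic objects of `K^b(R-mod)`. -/
def acyclicKbMod : ObjectProperty (KbMod R) :=
  (HomotopyCategory.subcategoryAcyclic (ModuleCat.{u} R)).inverseImage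
    (bddHomotopy (finPres R)).ι

instance : (acyclicKbMod R).IsTriangulated := by
  dsimp only [acyclicKbMod]
  infer_instance

/-- `D^b(R-mod)`, the bounded derived category of the category of finitely presented modules over a
coherent ring `R` (an abelian category whose inclusion in `R-Mod` is exact), as the Verdier quotient
of `K^b(R-mod)` by the acyclic complexes. -/
abbrev DbMod : Type _ := (acyclicKbMod R).trW.Localization

lemma bddHomotopy_finPres_of_kbProj (X : KbProj R) :
    bddHomotopy (finPres R) ((bddHomotopy (fgProj R)).ι.obj X) :=
  ⟨X.property.1, fun i => fgProj_le_finPres R _ (X.property.2 i)⟩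

/-- The inclusion `K^b(proj R) → K^b(R-mod)`. -/
abbrev kbProjToKbMod : KbProj R ⥤ KbMod R :=
  (bddHomotopy (finPres R)).lift (bddHomotopy (fgProj R)).ι (bddHomotopy_finPres_of_kbProj R)

noncomputable instance : (kbProjToKbMod R).CommShift ℤ :=
  Functor.CommShift.ofComp ((bddHomotopy (finPres R)).liftCompιIso (bddHomotopy (fgProj R)).ι
    (bddHomotopy_finPres_of_kbProj R)) ℤ

instance : (kbProjToKbMod R).IsTriangulated :=
  ObjectProperty.isTriangulated_lift _ _ _

/-- The canonical functor `K^b(proj R) → D^b(R-mod)`. It is a triangle functor (see below). -/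
noncomputable abbrev kbProjToDbMod : KbProj R ⥤ DbMod R :=
  kbProjToKbMod R ⋙ (acyclicKbMod R).trW.Q

noncomputable instance : (kbProjToDbMod R).CommShift ℤ := inferInstance

instance : (kbProjToDbMod R).IsTriangulated := inferInstance

/-- The singularity category `D^b(R-mod) / K^b(proj R)` of a coherent ring `R`. -/
abbrev SingularityCategory : Type _ := (kbProjToDbMod R).essImage.trW.Localization

/-- The canonical functor from `K^b(proj R)` to the derived category of all modules. -/
noncomputable abbrev kbProjToDerived [HasDerivedCategory.{w} (ModuleCat.{u} R)] :
    KbProj R ⥤ DerivedCategory (ModuleCat.{u} R) :=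
  (bddHomotopy (fgProj R)).ι ⋙ DerivedCategory.Qh

/-! ### Cohomological truncation and duality on `K^b(proj R)` -/

/-- The objects of `K^b(proj R)` with `H^i = 0` for all `i > 0`. -/
def cohLE : ObjectProperty (KbProj R) := fun X =>
  ∀ i : ℤ, 0 < i → IsZero ((HomotopyCategory.homologyFunctor (ModuleCat.{u} R)
    (ComplexShape.up ℤ) i).obj X.obj)

/-- The objects of `K^b(proj R)` with `H^i = 0` for all `i < 0`. -/
def cohGE : ObjectProperty (KbProj R) := fun X =>
  ∀ i : ℤ, i < 0 → IsZero ((HomotopyCategory.homologyFunctor (ModuleCat.{u} R)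
    (ComplexShape.up ℤ) i).obj X.obj)

variable {R} in
/-- The transpose `Hom_R(N, R) → Hom_R(M, R)` of a linear map `M → N`. -/
def transpose {M N : ModuleCat.{u} R} (f : M ⟶ N) :
    ModuleCat.of R (Module.Dual R N) ⟶ ModuleCat.of R (Module.Dual R M) :=
  ModuleCat.ofHom f.hom.dualMap

variable {R} in
lemma transpose_id (M : ModuleCat.{u} R) : transpose (𝟙 M) = 𝟙 _ := rfl

variable {R} in
lemma transpose_comp {M N P : ModuleCat.{u} R} (f : M ⟶ N) (g : N ⟶ P) :
    transpose (f ≫ g) = transpose g ≫ transpose f := rfl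

variable {R} in
lemma transpose_zero (M N : ModuleCat.{u} R) : transpose (0 : M ⟶ N) = 0 := by
  apply ModuleCat.hom_ext
  refine LinearMap.ext fun (φ : Module.Dual R N) => LinearMap.ext fun x => ?_
  exact map_zero φ

variable {R} in
lemma transpose_add {M N : ModuleCat.{u} R} (f g : M ⟶ N) :
    transpose (f + g) = transpose f + transpose g := by
  apply ModuleCat.hom_ext
  refine LinearMap.ext fun (φ : Module.Dual R N) => LinearMap.ext fun x => ?_
  exact map_add φ _ _

variable {R} in
/-- The complex `Hom_R(K, R)`, with `Hom_R(K^{-i}, R)` in degree `i` and the transposed differentials.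
(The signs which some authors put in front of the differentials give an isomorphic complex.) -/
def dualComplex (K : CochainComplex (ModuleCat.{u} R) ℤ) :
    CochainComplex (ModuleCat.{u} R) ℤ where
  X i := ModuleCat.of R (Module.Dual R (K.X (-i)))
  d i j := transpose (K.d (-j) (-i))
  shape i j hij := by
    rw [K.shape _ _ (by simp only [ComplexShape.up_Rel] at hij ⊢; lia), transpose_zero]
  d_comp_d' i j l _ _ := by
    rw [← transpose_comp, K.d_comp_d, transpose_zero]

variable {R} in
/-- The transpose of a morphism of complexes. -/
def dualComplexMap {K L : CochainComplex (ModuleCat.{u} R) ℤ} (f : K ⟶ L) :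
    dualComplex L ⟶ dualComplex K where
  f i := transpose (f.f (-i))
  comm' i j _ := by
    change transpose _ ≫ transpose _ = transpose _ ≫ transpose _
    rw [← transpose_comp, ← transpose_comp, f.comm]

variable {R} in
/-- The transpose of a homotopy. -/
def dualHomotopy {K L : CochainComplex (ModuleCat.{u} R) ℤ} {f g : K ⟶ L} (h : Homotopy f g) :
    Homotopy (dualComplexMap f) (dualComplexMap g) where
  hom i j := (show (dualComplex L).X i ⟶ (dualComplex K).X j from transpose (h.hom (-j) (-i)))
  zero i j hij := by
    rw [h.zero _ _ (by simp only [ComplexShape.up_Rel] at hij ⊢; lia), transpose_zero]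
    rfl
  comm i := by
    rw [dNext_eq _ (show (ComplexShape.up ℤ).Rel i (i + 1) from rfl),
      prevD_eq _ (show (ComplexShape.up ℤ).Rel (i - 1) i by simp)]
    have key := congrArg transpose (h.comm (-i))
    rw [dNext_eq _ (show (ComplexShape.up ℤ).Rel (-i) (-(i - 1)) by simp; lia),
      prevD_eq _ (show (ComplexShape.up ℤ).Rel (-(i + 1)) (-i) by simp),
      transpose_add, transpose_add, transpose_comp, transpose_comp,
      add_comm (transpose _ ≫ transpose _)] at key
    exact key

/-- The contravariant functor `Hom_R(-, R)` on the homotopy category. -/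
def dualHomotopyCategory :
    (HomotopyCategory (ModuleCat.{u} R) (ComplexShape.up ℤ))ᵒᵖ ⥤
      HomotopyCategory (ModuleCat.{u} R) (ComplexShape.up ℤ) :=
  Functor.leftOp (CategoryTheory.Quotient.lift _
    { obj := fun K => Opposite.op ((HomotopyCategory.quotient _ _).obj (dualComplex K))
      map := fun f => ((HomotopyCategory.quotient _ _).map (dualComplexMap f)).op
      map_id := fun K => congrArg Quiver.Hom.op
        ((HomotopyCategory.quotient _ _).map_id (dualComplex K))
      map_comp := fun f g => congrArg Quiver.Hom.op
        ((HomotopyCategory.quotient _ _).map_comp (dualComplexMap g) (dualComplexMap f)) }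
    (fun _ _ _ _ ⟨h⟩ => congrArg Quiver.Hom.op
      (HomotopyCategory.eq_of_homotopy _ _ (dualHomotopy h))))

variable {R} in
lemma bddComplexes_dualComplex (K : CochainComplex (ModuleCat.{u} R) ℤ)
    (hK : bddComplexes (fgProj R) K) : bddComplexes (fgProj R) (dualComplex K) := by
  obtain ⟨⟨a, b, _, _⟩, h⟩ := hK
  have hz : ∀ i, IsZero (K.X (-i)) → IsZero ((dualComplex K).X i) := fun i hi => by
    have : Subsingleton (K.X (-i)) := ModuleCat.subsingleton_of_isZero hi
    have : Subsingleton (Module.Dual R (K.X (-i))) :=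
      ⟨fun φ ψ => LinearMap.ext fun x => by rw [Subsingleton.elim x 0, map_zero, map_zero]⟩
    exact ModuleCat.isZero_of_subsingleton (ModuleCat.of R (Module.Dual R (K.X (-i))))
  refine ⟨⟨-b, -a, ?_, ?_⟩, fun i => ?_⟩
  · rw [CochainComplex.isStrictlyGE_iff]
    exact fun i hi => hz i (K.isZero_of_isStrictlyLE b _ (by lia))
  · rw [CochainComplex.isStrictlyLE_iff]
    exact fun i hi => hz i (K.isZero_of_isStrictlyGE a _ (by lia))
  · obtain ⟨_, _⟩ := h (-i)
    exact ⟨inferInstanceAs (Module.Finite R (Module.Dual R (K.X (-i)))),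
      inferInstanceAs (Module.Projective R (Module.Dual R (K.X (-i))))⟩

/-- The contravariant functor `RHom_R(-, R)` on `K^b(proj R)`. It is computed by the complexes
`Hom_R(K, R)` since bounded complexes of projective modules are K-projective. -/
def dual : (KbProj R)ᵒᵖ ⥤ KbProj R :=
  (bddHomotopy (fgProj R)).lift ((bddHomotopy (fgProj R)).ι.op ⋙ dualHomotopyCategory R)
    (fun X => bddComplexes_dualComplex X.unop.obj.as X.unop.property)

variable {R} in
/-- The image (closed under isomorphisms) of a full subcategory under `RHom_R(-, R)`. -/
def dualImage (A : ObjectProperty (KbProj R)) : ObjectProperty (KbProj R) :=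
  fun X => ∃ Y : KbProj R, A Y ∧ Nonempty (X ≅ (dual R).obj (Opposite.op Y))

/-! ### Koszul complexes -/

variable {R}

/-- The Koszul complex of `x 0, …, x (n - 1)`, concentrated in degrees `-n, …, 0`. Tensoring with the
two-term complex `K(y) = (R → R)` given by multiplication by `y` amounts to taking the mapping cone of
the multiplication by `y`. -/
noncomputable def koszulComplex (x : ℕ → R) : ℕ → CochainComplex (ModuleCat.{u} R) ℤ
  | 0 => (CochainComplex.singleFunctor (ModuleCat.{u} R) 0).obj (ModuleCat.of R R)
  | n + 1 => CochainComplex.mappingCone (x n • 𝟙 (koszulComplex x n))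

lemma bddComplexes_koszulComplex (x : ℕ → R) (n : ℕ) :
    bddComplexes (fgProj R) (koszulComplex x n) := by
  induction n with
  | zero =>
    refine ⟨⟨0, 0, ?_, ?_⟩, fun i => ?_⟩
    · exact inferInstanceAs (CochainComplex.IsStrictlyGE
        ((CochainComplex.singleFunctor (ModuleCat.{u} R) 0).obj (ModuleCat.of R R)) 0)
    · exact inferInstanceAs (CochainComplex.IsStrictlyLE
        ((CochainComplex.singleFunctor (ModuleCat.{u} R) 0).obj (ModuleCat.of R R)) 0)
    · by_cases hi : i = 0
      · subst hi
        refine (fgProj R).prop_of_iso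
          (HomologicalComplex.singleObjXSelf (ComplexShape.up ℤ) 0 (ModuleCat.of R R)).symm ?_
        exact ⟨inferInstanceAs (Module.Finite R R), inferInstanceAs (Module.Projective R R)⟩
      · exact fgProj_of_isZero R _
          (HomologicalComplex.isZero_single_obj_X (ComplexShape.up ℤ) 0 (ModuleCat.of R R) i hi)
  | succ n ih => exact bddComplexes_mappingCone _ (fgProj_biprod R) _ ih ih

/-- The Koszul complex as an object of `K^b(proj R)`. -/
noncomputable def koszul (x : ℕ → R) (n : ℕ) : KbProj R :=
  ⟨(HomotopyCategory.quotient _ _).obj (koszulComplex x n), bddComplexes_koszulComplex x n⟩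

end PerfTStr

open PerfTStr

/-!
Write `R` for the polynomial ring `k[x₀, x₁, …]` over a field.

*Finiteness properties.* `R` is the union of the polynomial rings in finitely many variables, over
each of which it is free (`flat_finInclusion`). A finitely generated ideal, or a finitely
presented module, is therefore a flat base change from a noetherian ring of finite global
dimension (Hilbert's syzygy theorem, `globalDimensionLE_mvPolynomial`); this gives coherence and
regularity. The modules `R/(x₀, …, xₙ₋₁)` satisfy `Extⁿ(-, k) ≠ 0`
(`exists_ext_varsQuotient_ne_zero`), so the finitistic dimension is infinite.

*The bounded derived category.* Over a regular coherent ring, a bounded object of the derived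
category with finitely presented cohomology is an iterated extension of shifts of its cohomology
modules, hence perfect (`perfect_of_homologyFinPres`). As bounded complexes of finitely generated
projective modules are K-projective, they have the same morphisms in the homotopy category and in
the derived categories. So `K^b(proj R) → D^b(R-mod)` is an equivalence, and the canonical
t-structure of the derived category restricts to `K^b(proj R)` (`canonicalTStructure`). Duality is
an anti-equivalence of `K^b(proj R)` which preserves distinguished triangles, so it transports
this t-structure to a second one (`dualTStructure`).

*Koszul complexes.* The Koszul complex of the first `n` variables is a resolution of `R/(x₀, …,
xₙ₋₁)` (`homology_koszulComplex_X`), whereas its dual has nonzero cohomology in degree `n`: the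
differentials of the Koszul complex vanish modulo the ideal of all variables
(`not_isZero_homology_dualComplex_koszulComplex`). So the aisle of the second t-structure has
objects with cohomology in arbitrarily high degrees and is not contained in any shift of the
canonical aisle.

*The derived category of all modules.* Coproducts in the derived category are direct sums of
complexes (`isColimitSumCofan`), and perfect complexes are compact. A class of perfect objects
which is closed under `[1]` is essentially small, and by attaching cells and passing to the
homotopy colimit one obtains approximation triangles (`exists_approximation_triangle`), so it
generates a t-structure. A compact object is bounded above
(`exists_isLE_of_factorsThroughFiniteSums`); hence the aisle of a t-structure in the preferred
equivalence class is bounded above (`IsInPreferredClass.exists_le`), which the aisle generated by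
the dual Koszul complexes is not.
-/

namespace PerfTStr

/-! ### Hilbert's syzygy theorem -/

open TensorProduct in
/-- Projective dimension does not grow under flat base change. -/
lemma hasProjectiveDimensionLE_baseChange {A B : Type u} [CommRing A] [CommRing B] [Algebra A B]
    [Module.Flat A B] (n : ℕ) (M : ModuleCat.{u} A) (hM : HasProjectiveDimensionLE M n) :
    HasProjectiveDimensionLE (ModuleCat.of B (B ⊗[A] M)) n := by
  induction n generalizing M with
  | zero =>
    have : HasProjectiveDimensionLT M 1 := hM
    rw [← projective_iff_hasProjectiveDimensionLT_one] at this
    have : Module.Projective A M := (IsProjective.iff_projective.{u} (R := A) M).2 this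
    change HasProjectiveDimensionLT _ 1
    rw [← projective_iff_hasProjectiveDimensionLT_one]
    exact (IsProjective.iff_projective.{u} (R := B) _).1
      (inferInstanceAs (Module.Projective B (B ⊗[A] M)))
  | succ n ih =>
    obtain ⟨F, _, _, _, f, hf⟩ : ∃ (F : Type u) (_ : AddCommGroup F) (_ : Module A F)
        (_ : Module.Projective A F) (f : F →ₗ[A] M), Function.Surjective f :=
      ⟨M →₀ A, inferInstance, inferInstance, inferInstance, Finsupp.linearCombination A id,
        fun m => ⟨Finsupp.single m 1, by simp⟩⟩
    have hS := LinearMap.shortExact_shortComplexKer hf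
    have hP : Projective f.shortComplexKer.X₂ :=
      (IsProjective.iff_projective.{u} (R := A) F).1 inferInstance
    have hK := ih _ ((hS.hasProjectiveDimensionLT_X₃_iff n hP).1 hM)
    have hex : Function.Exact (LinearMap.ker f).subtype f := fun x => by simp
    let S : ShortComplex (ModuleCat.{u} B) := ModuleCat.shortComplexOfCompEqZero
      ((LinearMap.ker f).subtype.baseChange B) (f.baseChange B) (by
        rw [← LinearMap.baseChange_comp, hex.linearMap_comp_eq_zero, LinearMap.baseChange_zero])
    have hex' := Module.Flat.lTensor_exact B hex
    have hS' : S.ShortExact := ModuleCat.shortComplex_shortExact S hex'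
      (Module.Flat.lTensor_preserves_injective_linearMap _ (Submodule.injective_subtype _))
      (LinearMap.lTensor_surjective B hf)
    have hP' : Projective S.X₂ := (IsProjective.iff_projective.{u} (R := B) _).1
      (inferInstanceAs (Module.Projective B (B ⊗[A] F)))
    exact (hS'.hasProjectiveDimensionLT_X₃_iff n hP').2 hK

lemma exists_forall_coeff_eq_zero {A M : Type*} [CommRing A] [AddCommGroup M] [Module A M]
    (p : PolynomialModule A M) :
    ∃ N, ∀ n, N ≤ n → p.coeff n = 0 := by
  obtain ⟨N, hN⟩ := p.coeff.support.bddAbove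
  refine ⟨N + 1, fun n hn => ?_⟩
  by_contra h
  have := hN (Finsupp.mem_support_iff.2 h)
  omega

section Polynomial

open Polynomial

variable {A : Type u} [CommRing A] (M : Type u) [AddCommGroup M] [Module A M] [Module A[X] M]
  [IsScalarTower A A[X] M]

/-- The evaluation map `M[X] → M`, `∑ Xⁱ mᵢ ↦ ∑ Xⁱ • mᵢ`, for an `A[X]`-module `M`. -/
noncomputable def polynomialModuleEval : PolynomialModule A M →ₗ[A[X]] M where
  toFun p := p.coeff.sum fun i m => (X : A[X]) ^ i • m
  map_add' p q := by
    rw [PolynomialModule.coeff_add]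
    exact Finsupp.sum_add_index' (by simp) (by simp)
  map_smul' f p := by
    have hadd (p q : PolynomialModule A M) : ((p + q).coeff.sum fun i m => (X : A[X]) ^ i • m) =
        (p.coeff.sum fun i m => (X : A[X]) ^ i • m) +
          q.coeff.sum fun i m => (X : A[X]) ^ i • m := by
      rw [PolynomialModule.coeff_add]
      exact Finsupp.sum_add_index' (by simp) (by simp)
    simp only [RingHom.id_apply]
    induction p using PolynomialModule.induction_linear with
    | zero => simp
    | add p q hp hq => rw [smul_add, hadd, hadd, hp, hq, smul_add]
    | single n m =>
      induction f using Polynomial.induction_on' with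
      | add p q hp hq => rw [add_smul, hadd, hp, hq, add_smul]
      | monomial i a =>
        rw [PolynomialModule.monomial_smul_single, PolynomialModule.coeff_single,
          PolynomialModule.coeff_single, Finsupp.sum_single_index (by simp),
          Finsupp.sum_single_index (by simp), ← C_mul_X_pow_eq_monomial, mul_smul, pow_add,
          mul_smul, smul_comm (X ^ n : A[X]) a m,
          smul_comm (X ^ i : A[X]) a]
        exact (algebraMap_smul A[X] a _).symm

lemma polynomialModuleEval_single (n : ℕ) (m : M) :
    polynomialModuleEval M (PolynomialModule.single A n m) = (X : A[X]) ^ n • m := by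
  change (PolynomialModule.single A n m).coeff.sum _ = _
  rw [PolynomialModule.coeff_single, Finsupp.sum_single_index (by simp)]

/-- Multiplication by `X` on an `A[X]`-module, as an `A`-linear map. -/
noncomputable def mulX : M →ₗ[A] M := (LinearMap.lsmul A[X] M (X : A[X])).restrictScalars A

/-- The endomorphism of `M[X]` with cokernel `M`, for an `A[X]`-module `M`: the difference between
multiplication by the variable of `M[X]` and the action of `X` on the coefficients. -/
noncomputable def polynomialModuleDiff : PolynomialModule A M →ₗ[A[X]] PolynomialModule A M where
  toFun p := (X : A[X]) • p - PolynomialModule.map A (mulX (A := A) M) p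
  map_add' p q := by rw [smul_add, map_add]; abel
  map_smul' f p := by
    rw [PolynomialModule.map_smul, RingHom.id_apply, smul_sub, smul_comm, Algebra.algebraMap_self,
      Polynomial.map_id]

lemma map_mulX_coeff (p : PolynomialModule A M) (n : ℕ) :
    (PolynomialModule.map A (mulX (A := A) M) p).coeff n = (X : A[X]) • p.coeff n := by
  induction p using PolynomialModule.induction_linear with
  | zero => simp
  | add p q hp hq => rw [map_add, PolynomialModule.coeff_add, Finsupp.add_apply, hp, hq,
      PolynomialModule.coeff_add, Finsupp.add_apply, smul_add]
  | single i m =>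
    rw [PolynomialModule.map_single, PolynomialModule.coeff_single, PolynomialModule.coeff_single]
    by_cases h : i = n
    · subst h
      simp [mulX]
    · simp [h]

lemma polynomialModuleDiff_coeff_zero (p : PolynomialModule A M) :
    (polynomialModuleDiff M p).coeff 0 = - ((X : A[X]) • p.coeff 0) := by
  change ((X : A[X]) • p - PolynomialModule.map A (mulX (A := A) M) p).coeff 0 = _
  rw [show ∀ p q : PolynomialModule A M, (p - q).coeff = p.coeff - q.coeff from fun _ _ => rfl,
    Finsupp.sub_apply, map_mulX_coeff, ← monomial_one_one_eq_X,
    PolynomialModule.monomial_smul_apply]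
  simp

lemma polynomialModuleDiff_coeff_succ (p : PolynomialModule A M) (n : ℕ) :
    (polynomialModuleDiff M p).coeff (n + 1) = p.coeff n - (X : A[X]) • p.coeff (n + 1) := by
  change ((X : A[X]) • p - PolynomialModule.map A (mulX (A := A) M) p).coeff (n + 1) = _
  rw [show ∀ p q : PolynomialModule A M, (p - q).coeff = p.coeff - q.coeff from fun _ _ => rfl,
    Finsupp.sub_apply, map_mulX_coeff, ← monomial_one_one_eq_X,
    PolynomialModule.monomial_smul_apply]
  simp

lemma polynomialModuleEval_eq_sum (p : PolynomialModule A M) (N : ℕ)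
    (hN : ∀ n, N ≤ n → p.coeff n = 0) :
    polynomialModuleEval M p = ∑ i ∈ Finset.range N, (X : A[X]) ^ i • p.coeff i := by
  refine Finset.sum_subset (fun i hi => ?_) (fun i _ hi => ?_)
  · by_contra h
    exact Finsupp.mem_support_iff.1 hi (hN i (by simpa using h))
  · change (X : A[X]) ^ i • p.coeff i = 0
    rw [Finsupp.notMem_support_iff.1 hi, smul_zero]

lemma polynomialModuleDiff_injective : Function.Injective (polynomialModuleDiff (A := A) M) := by
  refine (injective_iff_map_eq_zero _).2 fun p hp => ?_
  obtain ⟨N, hN⟩ := exists_forall_coeff_eq_zero p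
  have h (n : ℕ) : p.coeff n = (X : A[X]) • p.coeff (n + 1) := by
    rw [← sub_eq_zero, ← polynomialModuleDiff_coeff_succ, hp]
    simp
  -- downward induction, starting from the degree `N` above which `p` vanishes
  have h' (k : ℕ) : ∀ n, N ≤ n + k → p.coeff n = 0 := by
    induction k with
    | zero => exact fun n hn => hN n hn
    | succ k ih => exact fun n hn => by rw [h, ih (n + 1) (by omega), smul_zero]
  refine PolynomialModule.coeff_injective (Finsupp.ext fun n => ?_)
  simpa using h' N n (by omega)

lemma polynomialModule_exact :
    Function.Exact (polynomialModuleDiff (A := A) M) (polynomialModuleEval (A := A) M) := by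
  refine fun p => ⟨fun hp => ?_, ?_⟩
  · obtain ⟨N, hN⟩ := exists_forall_coeff_eq_zero p
    -- the preimage has coefficients `qₙ = ∑_{i > n} X^{i-n-1} pᵢ`
    let q : ℕ → M := fun n => ∑ i ∈ Finset.range N, (X : A[X]) ^ i • p.coeff (n + 1 + i)
    have hq (n : ℕ) (hn : N ≤ n) : q n = 0 :=
      Finset.sum_eq_zero fun i _ => by rw [hN _ (by omega), smul_zero]
    have hq' (n : ℕ) : q n = p.coeff (n + 1) + (X : A[X]) • q (n + 1) := by
      have h1 : q n = ∑ i ∈ Finset.range (N + 1), (X : A[X]) ^ i • p.coeff (n + 1 + i) := by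
        rw [Finset.sum_range_succ, hN (n + 1 + N) (by omega), smul_zero, add_zero]
      rw [h1, Finset.sum_range_succ', Finset.smul_sum, add_comm]
      congr 1
      · simp
      · refine Finset.sum_congr rfl fun i _ => ?_
        rw [smul_smul, ← pow_succ', show n + 1 + (i + 1) = n + 1 + 1 + i by ring]
    refine ⟨PolynomialModule.ofCoeff A (Finsupp.onFinset (Finset.range N) q fun n hn => ?_), ?_⟩
    · by_contra h
      exact hn (hq n (by simpa using h))
    · refine PolynomialModule.coeff_injective (Finsupp.ext fun n => ?_)
      cases n with
      | zero =>
        rw [polynomialModuleDiff_coeff_zero]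
        change - ((X : A[X]) • q 0) = _
        rw [neg_eq_iff_add_eq_zero, ← hp, polynomialModuleEval_eq_sum M p (N + 1)
          (fun n hn => hN n (by omega)), Finset.sum_range_succ', Finset.smul_sum]
        congr 1
        · refine Finset.sum_congr rfl fun i _ => ?_
          rw [smul_smul, ← pow_succ', show 0 + 1 + i = i + 1 by ring]
        · simp
      | succ n =>
        rw [polynomialModuleDiff_coeff_succ]
        change q n - (X : A[X]) • q (n + 1) = _
        rw [hq', add_sub_cancel_right]
  · rintro ⟨p, rfl⟩
    induction p using PolynomialModule.induction_linear with
    | zero => simp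
    | add p q hp hq => rw [map_add, map_add, hp, hq, add_zero]
    | single n m =>
      change polynomialModuleEval M ((X : A[X]) • PolynomialModule.single A n m -
        PolynomialModule.map A (mulX (A := A) M) (PolynomialModule.single A n m)) = 0
      rw [PolynomialModule.map_single, map_sub, map_smul, polynomialModuleEval_single,
        polynomialModuleEval_single]
      change (X : A[X]) • (X : A[X]) ^ n • m - (X : A[X]) ^ n • (X : A[X]) • m = 0
      rw [smul_comm, sub_self]

end Polynomial

/-- Every module over `A` has projective dimension at most `n`. -/
def GlobalDimensionLE (A : Type u) [CommRing A] (n : ℕ) : Prop :=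
  ∀ M : ModuleCat.{u} A, HasProjectiveDimensionLE M n

open Polynomial in
/-- Every `A[X]`-module `M` has a resolution `0 → M[X] → M[X] → M → 0`, where `M[X]` is the base
change of the underlying `A`-module, so its projective dimension is at most one more than that of
`M` over `A`. -/
lemma GlobalDimensionLE.polynomial {A : Type u} [CommRing A] {n : ℕ} (h : GlobalDimensionLE A n) :
    GlobalDimensionLE A[X] (n + 1) := by
  intro M
  let _ : Module A M := Module.compHom M (C : A →+* A[X])
  have : IsScalarTower A A[X] M := ⟨fun a f m => by
    rw [Polynomial.smul_eq_C_mul, mul_smul]; rfl⟩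
  have hP : HasProjectiveDimensionLE (ModuleCat.of A[X] (PolynomialModule A M)) n := by
    have := hasProjectiveDimensionLE_baseChange (B := A[X]) n (ModuleCat.of A M) (h _)
    exact ModuleCat.hasProjectiveDimensionLE_of_linearEquiv.{u, u}
      (M := ModuleCat.of A[X] (TensorProduct A A[X] M))
      (PolynomialModule.polynomialTensorProductLEquivPolynomialModule A M) n
  let S : ShortComplex (ModuleCat.{u} A[X]) := ModuleCat.shortComplexOfCompEqZero
    (polynomialModuleDiff (A := A) M) (polynomialModuleEval (A := A) M)
    (polynomialModule_exact (A := A) M).linearMap_comp_eq_zero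
  have hS : S.ShortExact := ModuleCat.shortComplex_shortExact S (polynomialModule_exact (A := A) M)
    (polynomialModuleDiff_injective (A := A) M) fun m =>
      ⟨PolynomialModule.single A 0 m, (polynomialModuleEval_single (A := A) M 0 m).trans
        (by rw [pow_zero, one_smul])⟩
  exact hS.hasProjectiveDimensionLT_X₃ (n + 1) hP
    (hasProjectiveDimensionLT_of_ge (ModuleCat.of A[X] (PolynomialModule A M)) (n + 1) _ (by omega))

lemma GlobalDimensionLE.of_ringEquiv {A B : Type u} [CommRing A] [CommRing B] (e : A ≃+* B) {n : ℕ}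
    (h : GlobalDimensionLE A n) : GlobalDimensionLE B n := by
  intro M
  let _ : Module A M := Module.compHom M (e : A →+* B)
  have := h (ModuleCat.of A M)
  have : RingHomInvPair (e : A →+* B) (e.symm : B →+* A) := RingHomInvPair.of_ringEquiv e
  have : RingHomInvPair (e.symm : B →+* A) (e : A →+* B) := RingHomInvPair.of_ringEquiv e.symm
  exact ModuleCat.hasProjectiveDimensionLE_of_semiLinearEquiv.{u, u} (M := ModuleCat.of A M) e
    { AddEquiv.refl M with map_smul' := fun _ _ => rfl } n

/-- Hilbert's syzygy theorem. -/
lemma globalDimensionLE_mvPolynomial (k : Type u) [Field k] (n : ℕ) :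
    GlobalDimensionLE (MvPolynomial (Fin n) k) n := by
  induction n with
  | zero =>
    refine GlobalDimensionLE.of_ringEquiv (MvPolynomial.isEmptyAlgEquiv k (Fin 0)).symm.toRingEquiv
      fun M => ?_
    change HasProjectiveDimensionLT _ 1
    rw [← projective_iff_hasProjectiveDimensionLT_one]
    exact (IsProjective.iff_projective.{u} (R := k) M).1 inferInstance
  | succ n ih => exact ih.polynomial.of_ringEquiv (MvPolynomial.finSuccEquiv k n).symm.toRingEquiv

/-! ### Coherence and regularity of the infinite polynomial ring -/

section Descent

variable (k : Type u) [Field k]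

/-- The inclusion of the polynomials in the first `N` variables. -/
noncomputable abbrev finInclusion (N : ℕ) :
    MvPolynomial (Fin N) k →+* MvPolynomial ℕ k :=
  (MvPolynomial.rename (Fin.val : Fin N → ℕ) : _ →ₐ[k] _).toRingHom

/-- The infinite polynomial ring is a polynomial ring, hence free, over any of the polynomial rings
in its first `N` variables. -/
lemma flat_finInclusion (N : ℕ) : (finInclusion k N).Flat := by
  let e₀ : ℕ ≃ ℕ ⊕ Fin N :=
    { toFun := fun i => if h : i < N then Sum.inr ⟨i, h⟩ else Sum.inl (i - N)
      invFun := Sum.elim (· + N) Fin.val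
      left_inv := fun i => by
        by_cases h : i < N
        · simp [h]
        · simp [h]; omega
      right_inv := by rintro (i | i) <;> simp }
  let e : MvPolynomial ℕ k ≃ₐ[k] MvPolynomial ℕ (MvPolynomial (Fin N) k) :=
    (MvPolynomial.renameEquiv k e₀).trans (MvPolynomial.sumAlgEquiv k ℕ (Fin N))
  have he (p : MvPolynomial (Fin N) k) : e (finInclusion k N p) = MvPolynomial.C p := by
    let φ : MvPolynomial (Fin N) k →ₐ[k] MvPolynomial ℕ (MvPolynomial (Fin N) k) :=
      IsScalarTower.toAlgHom k _ _
    have : (e : _ →ₐ[k] _).comp (MvPolynomial.rename (Fin.val : Fin N → ℕ)) = φ := by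
      ext i : 1
      simp [e, e₀, φ, MvPolynomial.algebraMap_eq]
    exact DFunLike.congr_fun this p
  let _ := (finInclusion k N).toAlgebra
  have he' (p : MvPolynomial (Fin N) k) (q : MvPolynomial ℕ k) : e (p • q) = p • e q := by
    rw [Algebra.smul_def, map_mul, MvPolynomial.smul_eq_C_mul]
    congr 1
    exact he p
  let e' : MvPolynomial ℕ k ≃ₗ[MvPolynomial (Fin N) k] MvPolynomial ℕ (MvPolynomial (Fin N) k) :=
    { e.toAddEquiv with map_smul' := he' }
  exact Module.Flat.of_linearEquiv e'

/-- Finitely many polynomials involve only finitely many variables. -/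
lemma exists_finInclusion_eq (T : Finset (MvPolynomial ℕ k)) :
    ∃ N, ∀ p ∈ T, ∃ q, finInclusion k N q = p := by
  classical
  obtain ⟨N, hN⟩ := (T.biUnion MvPolynomial.vars).bddAbove
  refine ⟨N + 1, fun p hp => ?_⟩
  refine MvPolynomial.exists_rename_eq_of_vars_subset_range p
    (Fin.val : Fin (N + 1) → ℕ) Fin.val_injective fun i hi => ?_
  have : i ≤ N := hN (Finset.mem_biUnion.2 ⟨p, hp, hi⟩)
  exact ⟨⟨i, by omega⟩, rfl⟩

open TensorProduct

/-- A finitely generated ideal is extended from a polynomial ring in finitely many variables,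
which is noetherian; finite presentation is preserved by the flat base change to the infinite
polynomial ring. -/
lemma isCoherentRing_mvPolynomial : IsCoherentRing (MvPolynomial ℕ k) := by
  rintro I ⟨T, rfl⟩
  obtain ⟨N, hN⟩ := exists_finInclusion_eq k T
  let _ := (finInclusion k N).toAlgebra
  have : Module.Flat (MvPolynomial (Fin N) k) (MvPolynomial ℕ k) := flat_finInclusion k N
  choose! q hq using hN
  let J : Ideal (MvPolynomial (Fin N) k) := Ideal.span (q '' T)
  have : Module.FinitePresentation (MvPolynomial (Fin N) k) J :=
    Module.finitePresentation_of_finite _ _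
  -- the multiplication map identifies the base change of `J` with the ideal spanned by `T`
  let φ : MvPolynomial ℕ k ⊗[MvPolynomial (Fin N) k] J →ₗ[MvPolynomial ℕ k] MvPolynomial ℕ k :=
    (AlgebraTensorModule.rid (MvPolynomial (Fin N) k) (MvPolynomial ℕ k)
      (MvPolynomial ℕ k)).toLinearMap ∘ₗ (J.subtype.baseChange (MvPolynomial ℕ k))
  have hφ : Function.Injective φ := by
    have h := Module.Flat.lTensor_preserves_injective_linearMap (M := MvPolynomial ℕ k) J.subtype
      (Submodule.injective_subtype _)
    rw [LinearMap.coe_comp]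
    exact (LinearEquiv.injective _).comp h
  have hφ' (r : MvPolynomial ℕ k) (s : J) : φ (r ⊗ₜ s) = finInclusion k N s * r := by
    simp only [φ, LinearMap.comp_apply, LinearMap.baseChange_tmul, LinearEquiv.coe_coe,
      AlgebraTensorModule.rid_tmul, Submodule.subtype_apply]
    rfl
  have hr : LinearMap.range φ = Ideal.span (T : Set (MvPolynomial ℕ k)) := by
    apply le_antisymm
    · rintro _ ⟨x, rfl⟩
      induction x using TensorProduct.induction_on with
      | zero => simp
      | add x y hx hy => rw [map_add]; exact Ideal.add_mem _ hx hy
      | tmul r s =>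
        rw [hφ']
        refine Ideal.mul_mem_right _ _ ?_
        have : (s : MvPolynomial (Fin N) k) ∈
            Ideal.comap (finInclusion k N) (Ideal.span (T : Set (MvPolynomial ℕ k))) := by
          refine (Ideal.span_le (s := q '' T)).2 ?_ s.2
          rintro _ ⟨p, hp, rfl⟩
          rw [SetLike.mem_coe, Ideal.mem_comap, hq p hp]
          exact Ideal.subset_span hp
        exact this
    · refine Ideal.span_le.2 fun p hp => ⟨1 ⊗ₜ ⟨q p, Ideal.subset_span ⟨p, hp, rfl⟩⟩, ?_⟩
      rw [hφ', mul_one]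
      exact hq p hp
  exact Module.FinitePresentation.of_equiv
    ((LinearEquiv.ofInjective φ hφ).trans (LinearEquiv.ofEq _ _ hr))

/-- A finitely presented module over the infinite polynomial ring is defined over a polynomial ring
in finitely many variables. -/
lemma exists_baseChange_equiv (M : ModuleCat.{u} (MvPolynomial ℕ k))
    [Module.FinitePresentation (MvPolynomial ℕ k) M] :
    ∃ (N : ℕ) (M₀ : ModuleCat.{u} (MvPolynomial (Fin N) k)),
      letI := (finInclusion k N).toAlgebra
      Nonempty ((MvPolynomial ℕ k ⊗[MvPolynomial (Fin N) k] M₀) ≃ₗ[MvPolynomial ℕ k] M) := by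
  classical
  obtain ⟨n, m, f, g, hf, hfg⟩ :=
    Module.FinitePresentation.exists_fin' (MvPolynomial ℕ k) M
  obtain ⟨N, hN⟩ := exists_finInclusion_eq k
    (Finset.univ.image fun p : Fin m × Fin n => g (Pi.single p.1 1) p.2)
  let _ := (finInclusion k N).toAlgebra
  choose q hq using fun i j => hN (g (Pi.single i 1) j)
    (Finset.mem_image.2 ⟨(i, j), Finset.mem_univ _, rfl⟩)
  -- the matrix of relations has coefficients in the smaller polynomial ring
  let g₀ : (Fin m → MvPolynomial (Fin N) k) →ₗ[MvPolynomial (Fin N) k]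
      (Fin n → MvPolynomial (Fin N) k) := Fintype.linearCombination _ q
  let em := piScalarRight (MvPolynomial (Fin N) k) (MvPolynomial ℕ k) (MvPolynomial ℕ k) (Fin m)
  let en := piScalarRight (MvPolynomial (Fin N) k) (MvPolynomial ℕ k) (MvPolynomial ℕ k) (Fin n)
  have hc : en.toLinearMap ∘ₗ g₀.baseChange (MvPolynomial ℕ k) = g ∘ₗ em.toLinearMap := by
    ext i j
    have h1 : em (1 ⊗ₜ Pi.single i 1) = Pi.single i 1 := by
      ext l
      by_cases h : l = i
      · subst h; simp [em]
      · simp [em, h]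
    have h2 : en (1 ⊗ₜ q i) j = g (Pi.single i 1) j := by
      rw [← hq]
      simp only [en, piScalarRight_apply, piScalarRightHom_tmul, Algebra.smul_def, mul_one]
      rfl
    simp [h1, g₀, h2]
  have hex : Function.Exact (g₀.baseChange (MvPolynomial ℕ k))
      ((LinearMap.range g₀).mkQ.baseChange (MvPolynomial ℕ k)) :=
    lTensor_exact _ (LinearMap.exact_map_mkQ_range g₀) (Submodule.mkQ_surjective _)
  have hs : Function.Surjective ((LinearMap.range g₀).mkQ.baseChange (MvPolynomial ℕ k)) :=
    LinearMap.lTensor_surjective _ (Submodule.mkQ_surjective _)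
  refine ⟨N, ModuleCat.of _ ((Fin n → MvPolynomial (Fin N) k) ⧸ LinearMap.range g₀),
    ⟨(hex.linearEquivOfSurjective hs).symm.trans
      ((Submodule.Quotient.equiv _ (LinearMap.range g) en ?_).trans
        (hfg.linearEquivOfSurjective hf))⟩⟩
  change Submodule.map en.toLinearMap _ = _
  rw [← LinearMap.range_comp, hc, LinearMap.range_comp_of_range_eq_top]
  exact em.range

/-- A finitely presented module is a flat base change from a polynomial ring in finitely many
variables, where Hilbert's syzygy theorem bounds its projective dimension. -/
lemma isHomologicallyRegular_mvPolynomial : IsHomologicallyRegular (MvPolynomial ℕ k) := by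
  intro M hM
  obtain ⟨N, M₀, ⟨e⟩⟩ := exists_baseChange_equiv k M
  let _ := (finInclusion k N).toAlgebra
  have : Module.Flat (MvPolynomial (Fin N) k) (MvPolynomial ℕ k) := flat_finInclusion k N
  rw [projectiveDimension_ne_top_iff]
  have := hasProjectiveDimensionLE_baseChange (B := MvPolynomial ℕ k) N M₀
    (globalDimensionLE_mvPolynomial k N M₀)
  exact ⟨N, ModuleCat.hasProjectiveDimensionLE_of_linearEquiv.{u, u}
    (M := ModuleCat.of (MvPolynomial ℕ k) (MvPolynomial ℕ k ⊗[MvPolynomial (Fin N) k] M₀)) e N⟩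

end Descent

/-! ### Submodules over coherent rings -/

section Coherent

variable {R : Type u} [CommRing R]

/-- Over a coherent ring, finitely generated submodules of `Rⁿ` are finitely presented. -/
lemma finitePresentation_of_fg_pi (hR : IsCoherentRing R) (n : ℕ) (N : Submodule R (Fin n → R))
    (hN : N.FG) : Module.FinitePresentation R N := by
  induction n with
  | zero => infer_instance
  | succ n ih =>
    have : Module.Finite R N := Module.Finite.iff_fg.2 hN
    -- project to the first coordinate; the kernel embeds in `Rⁿ`
    let l : N →ₗ[R] R := LinearMap.proj 0 ∘ₗ N.subtype
    have : Module.FinitePresentation R (LinearMap.range l) :=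
      hR _ (Module.Finite.iff_fg.1 inferInstance)
    have hker : (LinearMap.ker l.rangeRestrict).FG :=
      Module.FinitePresentation.fg_ker _ l.surjective_rangeRestrict
    let t : LinearMap.ker l.rangeRestrict →ₗ[R] (Fin n → R) :=
      LinearMap.funLeft R R Fin.succ ∘ₗ N.subtype ∘ₗ Submodule.subtype _
    have ht : Function.Injective t := by
      intro x y hxy
      have h0 (z : LinearMap.ker l.rangeRestrict) : (z : N).1 0 = 0 :=
        congrArg Subtype.val (LinearMap.mem_ker.1 z.2)
      refine Subtype.ext (Subtype.ext (funext fun i => ?_))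
      refine Fin.cases ?_ (fun i => ?_) i
      · rw [h0, h0]
      · exact congrFun hxy i
    have : Module.FinitePresentation R (LinearMap.range t) := by
      have : Module.Finite R (LinearMap.ker l.rangeRestrict) := Module.Finite.iff_fg.2 hker
      exact ih _ (Module.Finite.iff_fg.1 inferInstance)
    have : Module.FinitePresentation R (LinearMap.ker l.rangeRestrict) := by
      let e := (LinearEquiv.ofInjective t ht).symm
      exact Module.FinitePresentation.of_equiv (R := R) (M := LinearMap.range t)
        (N := LinearMap.ker l.rangeRestrict) e
    exact Module.finitePresentation_of_ker l.rangeRestrict l.surjective_rangeRestrict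

lemma finitePresentation_of_fg_submodule (hR : IsCoherentRing R) {P : Type u} [AddCommGroup P]
    [Module R P] [Module.Finite R P] [Module.Projective R P] (N : Submodule R P) (hN : N.FG) :
    Module.FinitePresentation R N := by
  obtain ⟨n, f, g, -, hg, -⟩ := Module.Finite.exists_comp_eq_id_of_projective R P
  have := finitePresentation_of_fg_pi hR n (N.map g) (hN.map g)
  exact Module.FinitePresentation.of_equiv (N.equivMapOfInjective g hg).symm

lemma finitePresentation_ker_of_surjective (hR : IsCoherentRing R) {P M : Type u} [AddCommGroup P]
    [Module R P] [Module.Finite R P] [Module.Projective R P] [AddCommGroup M] [Module R M]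
    [Module.FinitePresentation R M] (f : P →ₗ[R] M) (hf : Function.Surjective f) :
    Module.FinitePresentation R (LinearMap.ker f) :=
  finitePresentation_of_fg_submodule hR _ (Module.FinitePresentation.fg_ker f hf)

end Coherent

/-! ### Quotients by the first variables -/

section KoszulModule

variable (k : Type u) [Field k]

/-- The ideal generated by the first `n` variables. -/
noncomputable def varsIdeal (n : ℕ) : Ideal (MvPolynomial ℕ k) :=
  Ideal.span (MvPolynomial.X '' Set.Iio n)

/-- The ideal generated by all variables. -/
noncomputable def allVarsIdeal : Ideal (MvPolynomial ℕ k) := Ideal.span (Set.range MvPolynomial.X)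

/-- The quotient of the polynomial ring by the first `n` variables. -/
noncomputable abbrev varsQuotient (n : ℕ) : ModuleCat.{u} (MvPolynomial ℕ k) :=
  ModuleCat.of _ (MvPolynomial ℕ k ⧸ varsIdeal k n)

lemma varsIdeal_succ (n : ℕ) :
    varsIdeal k (n + 1) = varsIdeal k n ⊔ Ideal.span {MvPolynomial.X n} := by
  rw [varsIdeal, varsIdeal, ← Ideal.span_union, ← Set.image_singleton, ← Set.image_union]
  congr 2
  ext i
  simp

lemma varsIdeal_le_succ (n : ℕ) : varsIdeal k n ≤ varsIdeal k (n + 1) := by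
  rw [varsIdeal_succ]
  exact le_sup_left

lemma varsIdeal_le (n : ℕ) : varsIdeal k n ≤ allVarsIdeal k :=
  Ideal.span_mono (Set.image_subset_range _ _)

lemma one_notMem_allVarsIdeal : (1 : MvPolynomial ℕ k) ∉ allVarsIdeal k := by
  intro h
  have : allVarsIdeal k ≤ RingHom.ker (MvPolynomial.constantCoeff (R := k) (σ := ℕ)) := by
    refine Ideal.span_le.2 ?_
    rintro _ ⟨i, rfl⟩
    exact MvPolynomial.constantCoeff_X _ i
  simpa using RingHom.mem_ker.1 (this h)

/-- The variable `xₙ` is a nonzerodivisor modulo the preceding ones. -/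
lemma mem_varsIdeal_of_X_mul_mem (n : ℕ) (f : MvPolynomial ℕ k)
    (h : MvPolynomial.X n * f ∈ varsIdeal k n) : f ∈ varsIdeal k n := by
  -- the substitution `xᵢ ↦ 0` for `i < n` has kernel `varsIdeal k n`
  let φ : MvPolynomial ℕ k →ₐ[k] MvPolynomial ℕ k :=
    MvPolynomial.aeval fun i => if i < n then 0 else MvPolynomial.X i
  have h1 : varsIdeal k n ≤ RingHom.ker φ := by
    refine Ideal.span_le.2 ?_
    rintro _ ⟨i, hi, rfl⟩
    have : i < n := hi
    simp [φ, this]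
  have h2 : (Ideal.Quotient.mkₐ k (varsIdeal k n)).comp φ = Ideal.Quotient.mkₐ k _ := by
    ext i
    by_cases hi : i < n
    · have : (Ideal.Quotient.mk (varsIdeal k n)) (MvPolynomial.X i) = 0 :=
        Ideal.Quotient.eq_zero_iff_mem.2 (Ideal.subset_span ⟨i, hi, rfl⟩)
      simp [φ, hi, this]
    · simp [φ, hi]
  have h3 : φ f = 0 := by
    have := RingHom.mem_ker.1 (h1 h)
    simpa [φ] using this
  have h4 := DFunLike.congr_fun h2 f
  rw [AlgHom.comp_apply, h3, map_zero] at h4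
  exact Ideal.Quotient.eq_zero_iff_mem.1 h4.symm

lemma varsIdeal_zero : varsIdeal k 0 = ⊥ := by
  rw [varsIdeal, show (Set.Iio 0 : Set ℕ) = ∅ from Set.Iio_bot, Set.image_empty, Ideal.span_empty]

lemma finitePresentation_varsQuotient (n : ℕ) :
    Module.FinitePresentation (MvPolynomial ℕ k) (varsQuotient k n) := by
  refine Module.finitePresentation_of_surjective (varsIdeal k n).mkQ
    (Submodule.mkQ_surjective _) ?_
  rw [Submodule.ker_mkQ]
  classical
  exact ⟨(Finset.range n).image MvPolynomial.X, by
    rw [Finset.coe_image, Finset.coe_range]; rfl⟩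

/-- The short exact sequence `0 → R/(x₀, …, xₙ₋₁) → R/(x₀, …, xₙ₋₁) → R/(x₀, …, xₙ) → 0`, in which
the first map is the multiplication by `xₙ`. -/
noncomputable def varsShortComplex (n : ℕ) :
    ShortComplex (ModuleCat.{u} (MvPolynomial ℕ k)) where
  X₁ := varsQuotient k n
  X₂ := varsQuotient k n
  X₃ := varsQuotient k (n + 1)
  f := (MvPolynomial.X n : MvPolynomial ℕ k) • 𝟙 _
  g := ModuleCat.ofHom (Submodule.factor (varsIdeal_le_succ k n))
  zero := by
    refine ModuleCat.hom_ext (LinearMap.ext fun x => ?_)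
    obtain ⟨f, rfl⟩ := Submodule.mkQ_surjective _ x
    refine (Submodule.Quotient.mk_eq_zero (varsIdeal k (n + 1)) (x := MvPolynomial.X n * f)).2 ?_
    rw [varsIdeal_succ]
    exact Ideal.mem_sup_right (Ideal.mul_mem_right _ _ (Ideal.mem_span_singleton_self _))

lemma varsShortComplex_shortExact (n : ℕ) : (varsShortComplex k n).ShortExact := by
  refine ModuleCat.shortComplex_shortExact _ (fun x => ⟨fun hx => ?_, ?_⟩) ?_ ?_
  · obtain ⟨f, rfl⟩ := Submodule.mkQ_surjective _ x
    change Submodule.factor (varsIdeal_le_succ k n) (Submodule.mkQ _ f) = 0 at hx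
    replace hx := (Submodule.Quotient.mk_eq_zero _).1 hx
    rw [varsIdeal_succ, Submodule.mem_sup] at hx
    obtain ⟨a, ha, b, hb, rfl⟩ := hx
    obtain ⟨c, rfl⟩ := Ideal.mem_span_singleton.1 hb
    refine ⟨Submodule.mkQ _ c, ?_⟩
    change Submodule.mkQ (varsIdeal k n) (MvPolynomial.X n • c) = Submodule.mkQ (varsIdeal k n) _
    rw [map_add, (Submodule.Quotient.mk_eq_zero _).2 ha |> (Submodule.mkQ_apply _ a).trans,
      zero_add]
    rfl
  · rintro ⟨y, rfl⟩
    exact congrArg (fun φ => φ.hom y) (varsShortComplex k n).zero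
  · refine (injective_iff_map_eq_zero (varsShortComplex k n).f.hom).2 fun x hx => ?_
    obtain ⟨f, rfl⟩ := Submodule.mkQ_surjective _ x
    exact (Submodule.Quotient.mk_eq_zero _).2
      (mem_varsIdeal_of_X_mul_mem k n f ((Submodule.Quotient.mk_eq_zero _).1 hx))
  · exact Submodule.factor_surjective (varsIdeal_le_succ k n)

open Abelian in
lemma mk₀_smul_id_comp_eq_zero {R : Type u} [CommRing R] {M N : ModuleCat.{u} R} (r : R)
    (hr : r • 𝟙 N = 0) {n : ℕ} (e : Ext.{u} M N n) :
    (Ext.mk₀ (r • 𝟙 M)).comp e (zero_add n) = 0 := by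
  rw [Ext.mk₀_smul, Ext.smul_comp, Ext.mk₀_id_comp, Ext.smul_eq_comp_mk₀, hr, Ext.mk₀_zero,
    Ext.comp_zero]

open Abelian in
/-- The group `Extⁿ(R/(x₀, …, xₙ₋₁), k)` is nonzero: as `xₙ` acts by zero on `k`, the connecting
maps for the short exact sequences `varsShortComplex` are injective. -/
lemma exists_ext_varsQuotient_ne_zero (n : ℕ) :
    ∃ e : Ext.{u} (varsQuotient k n) (ModuleCat.of _ (MvPolynomial ℕ k ⧸ allVarsIdeal k)) n,
      e ≠ 0 := by
  induction n with
  | zero =>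
    refine ⟨Ext.mk₀ (ModuleCat.ofHom (Submodule.factor (varsIdeal_le k 0))), fun h => ?_⟩
    have h0 := (Ext.mk₀_eq_zero_iff _).1 h
    have h1 := congrArg (fun φ => φ.hom (Submodule.mkQ _ (1 : MvPolynomial ℕ k))) h0
    exact one_notMem_allVarsIdeal k ((Submodule.Quotient.mk_eq_zero _).1 h1)
  | succ n ih =>
    obtain ⟨e, he⟩ := ih
    have hS := varsShortComplex_shortExact k n
    refine ⟨hS.extClass.comp e (add_comm 1 n), fun h => he ?_⟩
    obtain ⟨e', he'⟩ := Ext.contravariant_sequence_exact₁ hS _ e (add_comm 1 n) h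
    have hX : (MvPolynomial.X n : MvPolynomial ℕ k) •
        𝟙 (ModuleCat.of (MvPolynomial ℕ k) (MvPolynomial ℕ k ⧸ allVarsIdeal k)) = 0 := by
      refine ModuleCat.hom_ext (LinearMap.ext fun x => ?_)
      obtain ⟨f, rfl⟩ := Submodule.mkQ_surjective _ x
      exact (Submodule.Quotient.mk_eq_zero _).2
        (Ideal.mul_mem_right _ _ (Ideal.subset_span ⟨n, rfl⟩))
    rw [← he']
    exact mk₀_smul_id_comp_eq_zero _ hX e'

lemma le_projectiveDimension_varsQuotient (n : ℕ) :
    (n : WithBot ℕ∞) ≤ projectiveDimension (varsQuotient k n) := by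
  obtain ⟨e, he⟩ := exists_ext_varsQuotient_ne_zero k n
  rw [projectiveDimension_ge_iff]
  exact fun h => he (e.eq_zero_of_hasProjectiveDimensionLT n le_rfl)

end KoszulModule

/-! ### Finite projective resolutions and the finitistic dimension -/

section

variable {R : Type u} [CommRing R]

/-- Constructor for finite projective resolutions from exactness statements. -/
lemma HasFiniteFGProjectiveResolution.mk' (M : ModuleCat.{u} R)
    (C : ChainComplex (ModuleCat.{u} R) ℕ)
    (hC : ∀ n, fgProj R (C.X n)) (N : ℕ) (hN : ∀ n, N ≤ n → IsZero (C.X n))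
    (f : C.X 0 ⟶ M) (hf : Epi f) (w : C.d 1 0 ≫ f = 0) (h₀ : (ShortComplex.mk _ _ w).Exact)
    (h : ∀ n, (ShortComplex.mk _ _ (C.d_comp_d (n + 2) (n + 1) n)).Exact) :
    HasFiniteFGProjectiveResolution R M := by
  have hproj (n : ℕ) : Projective (C.X n) :=
    (IsProjective.iff_projective.{u} (R := R) (C.X n)).1 (hC n).2
  have hq : QuasiIso ((ChainComplex.toSingle₀Equiv C M).symm ⟨f, w⟩) := ⟨fun n => by
    cases n with
    | zero =>
      rw [ChainComplex.quasiIsoAt₀_iff, ShortComplex.quasiIso_iff_of_zeros']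
      · refine (ShortComplex.exact_and_epi_g_iff_of_iso ?_).2 ⟨h₀, hf⟩
        exact ShortComplex.isoMk (Iso.refl _) (Iso.refl _) (Iso.refl _)
          ((Category.id_comp _).trans (Category.comp_id _).symm) (by
            refine (Category.id_comp _).trans (Eq.trans ?_ (Category.comp_id _).symm)
            exact (ChainComplex.toSingle₀Equiv_symm_apply_f_zero f w).symm)
      · exact C.shape _ _ (by simp)
      all_goals rfl
    | succ n =>
      rw [quasiIsoAt_iff_exactAt' _ _ (ChainComplex.exactAt_succ_single_obj _ _),
        HomologicalComplex.exactAt_iff' _ (n + 2) (n + 1) n (by simp) (by simp)]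
      exact h n⟩
  exact ⟨{ complex := C, π := (ChainComplex.toSingle₀Equiv C M).symm ⟨f, w⟩ },
    fun n => (hC n).1, N, hN⟩

/-- Splicing a finite resolution of the kernel of an epimorphism from a finitely generated
projective module. -/
lemma HasFiniteFGProjectiveResolution.of_shortExact {S : ShortComplex (ModuleCat.{u} R)}
    (hS : S.ShortExact) (h₂ : fgProj R S.X₂) (h₁ : HasFiniteFGProjectiveResolution R S.X₁) :
    HasFiniteFGProjectiveResolution R S.X₃ := by
  obtain ⟨P, hP, N, hN⟩ := h₁
  have hP' (n : ℕ) : Module.Projective R (P.complex.X n) :=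
    (IsProjective.iff_projective.{u} (R := R) _).2 (P.projective n)
  have := hS.mono_f
  have := hS.epi_g
  have w : P.complex.d 1 0 ≫ P.π.f 0 = 0 := P.complex_d_comp_π_f_zero
  have hex : (ShortComplex.mk _ _ w).Exact :=
    ShortComplex.exact_of_g_is_cokernel _ P.isColimitCokernelCofork
  let p : P.complex.X 0 ⟶ S.X₁ := P.π.f 0
  have w' : P.complex.d 1 0 ≫ p ≫ S.f = 0 := by
    rw [← Category.assoc, show P.complex.d 1 0 ≫ p = 0 from w, zero_comp]
  refine HasFiniteFGProjectiveResolution.mk' S.X₃ (P.complex.augment (p ≫ S.f) w') ?_ (N + 1) ?_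
    S.g this ?_ ?_ ?_
  · rintro (_ | n)
    · exact h₂
    · exact ⟨hP n, hP' n⟩
  · rintro (_ | n) hn
    · omega
    · exact hN n (by omega)
  · exact (Category.assoc _ _ _).trans ((congrArg (p ≫ ·) S.zero).trans comp_zero)
  · have : Epi p := inferInstanceAs (Epi (P.π.f 0))
    let φ : ShortComplex.mk (p ≫ S.f) S.g (by rw [Category.assoc, S.zero, comp_zero]) ⟶ S :=
      { τ₁ := p, τ₂ := 𝟙 _, τ₃ := 𝟙 _ }
    have : Epi φ.τ₁ := this
    have : IsIso φ.τ₂ := inferInstanceAs (IsIso (𝟙 _))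
    have : Mono φ.τ₃ := inferInstanceAs (Mono (𝟙 _))
    exact (ShortComplex.exact_iff_of_epi_of_isIso_of_mono φ).2 hS.exact
  · rintro (_ | n)
    · let φ : ShortComplex.mk _ _ w ⟶ ShortComplex.mk (P.complex.d 1 0) (p ≫ S.f) w' :=
        { τ₁ := 𝟙 _, τ₂ := 𝟙 _, τ₃ := S.f
          comm₂₃ := Category.id_comp _ }
      have : Epi φ.τ₁ := inferInstanceAs (Epi (𝟙 _))
      have : IsIso φ.τ₂ := inferInstanceAs (IsIso (𝟙 _))
      have : Mono φ.τ₃ := hS.mono_f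
      exact (ShortComplex.exact_iff_of_epi_of_isIso_of_mono φ).1 hex
    · exact P.exact_succ n

lemma hasFiniteFGProjectiveResolution_of_fgProj (M : ModuleCat.{u} R) (hM : fgProj R M) :
    HasFiniteFGProjectiveResolution R M := by
  have : Projective M := (IsProjective.iff_projective.{u} (R := R) M).1 hM.2
  refine ⟨ProjectiveResolution.self M, fun n => ?_, 1, fun n hn => ?_⟩
  · cases n with
    | zero => exact hM.1
    | succ n =>
      exact (fgProj_of_isZero R _ (HomologicalComplex.isZero_single_obj_X _ 0 M (n + 1)
        (by simp))).1
  · exact HomologicalComplex.isZero_single_obj_X _ 0 M n (by omega)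

/-- A finitely presented module is the quotient of a finitely generated free module; over a coherent
ring the kernel is finitely presented. -/
lemma exists_shortExact_of_finPres (hR : IsCoherentRing R) (M : ModuleCat.{u} R)
    (hM : finPres R M) :
    ∃ (S : ShortComplex (ModuleCat.{u} R)), S.X₃ = M ∧ S.ShortExact ∧ fgProj R S.X₂ ∧
      finPres R S.X₁ := by
  have : Module.FinitePresentation R M := hM
  obtain ⟨n, f, hf⟩ := Module.Finite.exists_fin' R M
  exact ⟨f.shortComplexKer, rfl, LinearMap.shortExact_shortComplexKer hf,
    ⟨inferInstanceAs (Module.Finite R (Fin n → R)),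
      inferInstanceAs (Module.Projective R (Fin n → R))⟩,
    finitePresentation_ker_of_surjective hR f hf⟩

lemma hasFiniteFGProjectiveResolution_of_finPres (hR : IsCoherentRing R) (n : ℕ)
    (M : ModuleCat.{u} R) (hM : finPres R M) (hn : HasProjectiveDimensionLE M n) :
    HasFiniteFGProjectiveResolution R M := by
  induction n generalizing M with
  | zero =>
    have : HasProjectiveDimensionLT M 1 := hn
    rw [← projective_iff_hasProjectiveDimensionLT_one] at this
    have hp := (IsProjective.iff_projective.{u} (R := R) M).2 this
    have : Module.FinitePresentation R M := hM
    exact hasFiniteFGProjectiveResolution_of_fgProj M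
      ⟨inferInstance, hp⟩
  | succ n ih =>
    obtain ⟨S, rfl, hS, h₂, h₁⟩ := exists_shortExact_of_finPres hR M hM
    have hP : Projective S.X₂ := (IsProjective.iff_projective.{u} (R := R) _).1 h₂.2
    exact .of_shortExact hS h₂ (ih _ h₁ ((hS.hasProjectiveDimensionLT_X₃_iff n hP).1 hn))

/-- The modules `R/(x₀, …, xₙ₋₁)` have finite resolutions by finitely generated projective modules
and projective dimension at least `n`. -/
lemma finitisticDimension_mvPolynomial (k : Type u) [Field k] :
    finitisticDimension (MvPolynomial ℕ k) = ⊤ := by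
  have key (n : ℕ) : ((n : ℕ∞) : WithBot ℕ∞) ≤ finitisticDimension (MvPolynomial ℕ k) := by
    have hfp := finitePresentation_varsQuotient k n
    have htop := isHomologicallyRegular_mvPolynomial k _ hfp
    obtain ⟨d, hd⟩ := (projectiveDimension_ne_top_iff _).1 htop
    exact (le_projectiveDimension_varsQuotient k n).trans
      (le_iSup₂_of_le (varsQuotient k n) (hasFiniteFGProjectiveResolution_of_finPres
        (isCoherentRing_mvPolynomial k) d _ hfp hd) le_rfl)
  generalize finitisticDimension (MvPolynomial ℕ k) = D at key
  induction D with
  | bot => exact absurd (key 0) (by simp)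
  | coe D =>
    congr 1
    exact ENat.eq_top_iff_forall_ge.2 fun n => WithBot.coe_le_coe.1 (key n)

end

/-! ### Perfect objects of the derived category -/

section

variable {R : Type u} [CommRing R]

/-- Over a coherent ring, finitely generated submodules of finitely presented modules are finitely
presented. -/
lemma finitePresentation_submodule_of_fg (hR : IsCoherentRing R) {M : Type u} [AddCommGroup M]
    [Module R M] [Module.FinitePresentation R M] (N : Submodule R M) (hN : N.FG) :
    Module.FinitePresentation R N := by
  obtain ⟨n, p, hp⟩ := Module.Finite.exists_fin' R M
  have hker : (LinearMap.ker p).FG := Module.FinitePresentation.fg_ker p hp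
  -- the preimage of `N` in a free module is an extension of `N` by the relations of `M`
  have hcomap : (N.comap p).FG := by
    refine Submodule.fg_of_fg_map_of_fg_inf_ker p ?_ ?_
    · rwa [Submodule.map_comap_eq_of_surjective hp]
    · rwa [inf_eq_right.2 (LinearMap.ker_le_comap p)]
  have := finitePresentation_of_fg_submodule hR _ hcomap
  let q : N.comap p →ₗ[R] N := p.restrict fun _ h => h
  have hq : Function.Surjective q := by
    rintro ⟨y, hy⟩
    obtain ⟨x, rfl⟩ := hp y
    exact ⟨⟨x, hy⟩, rfl⟩
  refine Module.finitePresentation_of_surjective q hq ?_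
  rw [show LinearMap.ker q = (LinearMap.ker p).comap (N.comap p).subtype from by
    ext x; exact Subtype.ext_iff]
  refine Submodule.fg_of_fg_map_injective (N.comap p).subtype Subtype.val_injective ?_
  rwa [Submodule.map_comap_subtype, inf_eq_right.2 (LinearMap.ker_le_comap p)]

lemma finitePresentation_ker_of_finitePresentation (hR : IsCoherentRing R) {M N : Type u}
    [AddCommGroup M] [Module R M] [AddCommGroup N] [Module R N] [Module.FinitePresentation R M]
    [Module.FinitePresentation R N] (f : M →ₗ[R] N) :
    Module.FinitePresentation R (LinearMap.ker f) := by
  have : Module.FinitePresentation R (LinearMap.range f) :=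
    finitePresentation_submodule_of_fg hR _ (Module.Finite.iff_fg.1 inferInstance)
  have := Module.FinitePresentation.fg_ker f.rangeRestrict f.surjective_rangeRestrict
  rw [LinearMap.ker_rangeRestrict] at this
  exact finitePresentation_submodule_of_fg hR _ this

lemma finitePresentation_quotient_range (hR : IsCoherentRing R) {L M N : Type u}
    [AddCommGroup L] [Module R L] [AddCommGroup M] [Module R M] [AddCommGroup N] [Module R N]
    (f : M →ₗ[R] N) (g : L →ₗ[R] LinearMap.ker f) (_ : Module.FinitePresentation R L)
    (_ : Module.FinitePresentation R M) (_ : Module.FinitePresentation R N) :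
    Module.FinitePresentation R (LinearMap.ker f ⧸ LinearMap.range g) := by
  have := finitePresentation_ker_of_finitePresentation hR f
  exact Module.finitePresentation_of_surjective (LinearMap.range g).mkQ
    (Submodule.mkQ_surjective _) (by
      rw [Submodule.ker_mkQ]
      exact Module.Finite.iff_fg.1 inferInstance)

/-- Over a coherent ring, the cohomology of a complex of finitely presented modules is finitely
presented. -/
lemma finPres_homology_of_terms (hR : IsCoherentRing R) (K : CochainComplex (ModuleCat.{u} R) ℤ)
    (hK : ∀ i, finPres R (K.X i)) (i : ℤ) : finPres R (K.homology i) := by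
  refine (finPres R).prop_of_iso (K.sc i).moduleCatHomologyIso.symm ?_
  exact finitePresentation_quotient_range hR (K.sc i).g.hom (K.sc i).moduleCatToCycles
    (hK _) (hK _) (hK _)

lemma isKProjective_of_bddComplexes_fgProj (K : CochainComplex (ModuleCat.{u} R) ℤ)
    (hK : bddComplexes (fgProj R) K) : K.IsKProjective := by
  obtain ⟨⟨_, b, _, _⟩, h⟩ := hK
  have (i : ℤ) : Projective (K.X i) :=
    (IsProjective.iff_projective.{u} (R := R) (K.X i)).1 (h i).2
  exact CochainComplex.isKProjective_of_projective K b

/-- Bounded complexes of finitely generated projective modules are K-projective. -/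
lemma leftOrthogonal_of_bddHomotopy_fgProj
    (X : HomotopyCategory (ModuleCat.{u} R) (ComplexShape.up ℤ)) (hX : bddHomotopy (fgProj R) X) :
    (HomotopyCategory.subcategoryAcyclic (ModuleCat.{u} R)).leftOrthogonal X := by
  have := isKProjective_of_bddComplexes_fgProj X.as hX
  exact CochainComplex.IsKProjective.leftOrthogonal X.as

section

variable [HasDerivedCategory.{w} (ModuleCat.{u} R)]

/-- Morphisms in the derived category from a bounded complex of finitely generated projective
modules are homotopy classes of morphisms of complexes. -/
lemma Qh_map_bijective_of_bddHomotopy_fgProj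
    (X : HomotopyCategory (ModuleCat.{u} R) (ComplexShape.up ℤ)) (hX : bddHomotopy (fgProj R) X)
    (Y : HomotopyCategory (ModuleCat.{u} R) (ComplexShape.up ℤ)) :
    Function.Bijective (DerivedCategory.Qh.map : (X ⟶ Y) → _) :=
  (leftOrthogonal_of_bddHomotopy_fgProj X hX).map_bijective_of_isTriangulated _ _

instance : (kbProjToDerived R).Full where
  map_surjective {X Y} f := by
    obtain ⟨g, hg⟩ := (Qh_map_bijective_of_bddHomotopy_fgProj X.obj X.property Y.obj).2 f
    exact ⟨(bddHomotopy (fgProj R)).fullyFaithfulι.preimage g, hg⟩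

instance : (kbProjToDerived R).Faithful where
  map_injective {X Y} _ _ h := (bddHomotopy (fgProj R)).ι.map_injective
    ((Qh_map_bijective_of_bddHomotopy_fgProj X.obj X.property Y.obj).1 h)

variable (R) in
/-- The perfect objects of the derived category: those which are isomorphic to a bounded complex of
finitely generated projective modules. -/
noncomputable def perfect : ObjectProperty (DerivedCategory (ModuleCat.{u} R)) :=
  (kbProjToDerived R).essImage

instance : (perfect R).IsTriangulated := by
  dsimp only [perfect]
  infer_instance

instance : (perfect R).IsClosedUnderIsomorphisms := by
  dsimp only [perfect]
  infer_instance

lemma perfect_Q_obj (K : CochainComplex (ModuleCat.{u} R) ℤ) (hK : bddComplexes (fgProj R) K) :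
    perfect R (DerivedCategory.Q.obj K) :=
  ⟨⟨(HomotopyCategory.quotient _ _).obj K, hK⟩,
    ⟨(DerivedCategory.quotientCompQhIso (ModuleCat.{u} R)).app K⟩⟩

lemma perfect_singleFunctor_of_fgProj (M : ModuleCat.{u} R) (hM : fgProj R M) :
    perfect R ((DerivedCategory.singleFunctor (ModuleCat.{u} R) 0).obj M) := by
  refine perfect_Q_obj ((CochainComplex.singleFunctor (ModuleCat.{u} R) 0).obj M)
    ⟨⟨0, 0, ?_, ?_⟩, fun i => ?_⟩
  · exact inferInstanceAs (CochainComplex.IsStrictlyGE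
      ((CochainComplex.singleFunctor (ModuleCat.{u} R) 0).obj M) 0)
  · exact inferInstanceAs (CochainComplex.IsStrictlyLE
      ((CochainComplex.singleFunctor (ModuleCat.{u} R) 0).obj M) 0)
  · by_cases hi : i = 0
    · subst hi
      exact (fgProj R).prop_of_iso
        (HomologicalComplex.singleObjXSelf (ComplexShape.up ℤ) 0 M).symm hM
    · exact fgProj_of_isZero R _
        (HomologicalComplex.isZero_single_obj_X (ComplexShape.up ℤ) 0 M i hi)

/-- A finitely presented module of finite projective dimension over a coherent ring is perfect:
induct on the projective dimension, along a presentation by a finitely generated free module. -/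
lemma perfect_singleFunctor_zero_of_finPres (hR : IsCoherentRing R) (n : ℕ)
    (M : ModuleCat.{u} R) (hM : finPres R M) (hn : HasProjectiveDimensionLE M n) :
    perfect R ((DerivedCategory.singleFunctor (ModuleCat.{u} R) 0).obj M) := by
  induction n generalizing M with
  | zero =>
    have : HasProjectiveDimensionLT M 1 := hn
    rw [← projective_iff_hasProjectiveDimensionLT_one] at this
    have hp := (IsProjective.iff_projective.{u} (R := R) M).2 this
    have : Module.FinitePresentation R M := hM
    exact perfect_singleFunctor_of_fgProj M ⟨inferInstance, hp⟩
  | succ n ih =>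
    obtain ⟨S, rfl, hS, h₂, h₁⟩ := exists_shortExact_of_finPres hR M hM
    have hP : Projective S.X₂ := (IsProjective.iff_projective.{u} (R := R) _).1 h₂.2
    exact (perfect R).ext_of_isTriangulatedClosed₃ _ hS.singleTriangle_distinguished
      (ih _ h₁ ((hS.hasProjectiveDimensionLT_X₃_iff n hP).1 hn))
      (perfect_singleFunctor_of_fgProj _ h₂)

lemma perfect_singleFunctor_of_finPres (hR : IsCoherentRing R) (hreg : IsHomologicallyRegular R)
    (M : ModuleCat.{u} R) (hM : finPres R M) (i : ℤ) :
    perfect R ((DerivedCategory.singleFunctor (ModuleCat.{u} R) i).obj M) := by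
  obtain ⟨d, hd⟩ := (projectiveDimension_ne_top_iff _).1 (hreg M hM)
  exact (perfect R).prop_of_iso
    (((DerivedCategory.singleFunctors (ModuleCat.{u} R)).shiftIso (-i) i 0 (by lia)).app M)
    ((perfect R).le_shift (-i) _ (perfect_singleFunctor_zero_of_finPres hR d M hM hd))

variable (R) in
/-- Objects of the derived category with finitely presented cohomology modules. -/
def homologyFinPres : ObjectProperty (DerivedCategory (ModuleCat.{u} R)) :=
  fun X => ∀ i : ℤ, finPres R ((DerivedCategory.homologyFunctor (ModuleCat.{u} R) i).obj X)

/-- If the third object of a distinguished triangle lives in degrees `> a`, the first morphism is an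
isomorphism on cohomology in degrees `≤ a`. -/
lemma isIso_homologyMap_mor₁ (T : Triangle (DerivedCategory (ModuleCat.{u} R)))
    (hT : T ∈ distTriang _) (a : ℤ) (h₃ : T.obj₃.IsGE (a + 1)) (i : ℤ) (hi : i ≤ a) :
    IsIso ((DerivedCategory.homologyFunctor (ModuleCat.{u} R) i).map T.mor₁) := by
  have : Mono ((DerivedCategory.homologyFunctor (ModuleCat.{u} R) i).map T.mor₁) :=
    (DerivedCategory.HomologySequence.mono_homologyMap_mor₁_iff T hT (i - 1) i).2
      ((T.obj₃.isZero_of_isGE (a + 1) (i - 1) (by lia)).eq_of_src _ _)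
  have : Epi ((DerivedCategory.homologyFunctor (ModuleCat.{u} R) i).map T.mor₁) :=
    (DerivedCategory.HomologySequence.epi_homologyMap_mor₁_iff T hT i).2
      ((T.obj₃.isZero_of_isGE (a + 1) i (by lia)).eq_of_tgt _ _)
  exact isIso_of_mono_of_epi _

/-- If the first object of a distinguished triangle lives in degrees `≤ a`, the second morphism is
an isomorphism on cohomology in degrees `> a`. -/
lemma isIso_homologyMap_mor₂ (T : Triangle (DerivedCategory (ModuleCat.{u} R)))
    (hT : T ∈ distTriang _) (a : ℤ) (h₁ : T.obj₁.IsLE a) (i : ℤ) (hi : a < i) :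
    IsIso ((DerivedCategory.homologyFunctor (ModuleCat.{u} R) i).map T.mor₂) := by
  have : Mono ((DerivedCategory.homologyFunctor (ModuleCat.{u} R) i).map T.mor₂) :=
    (DerivedCategory.HomologySequence.mono_homologyMap_mor₂_iff T hT i).2
      ((T.obj₁.isZero_of_isLE a i (by lia)).eq_of_src _ _)
  have : Epi ((DerivedCategory.homologyFunctor (ModuleCat.{u} R) i).map T.mor₂) :=
    (DerivedCategory.HomologySequence.epi_homologyMap_mor₂_iff T hT i (i + 1)).2
      ((T.obj₁.isZero_of_isLE a (i + 1) (by lia)).eq_of_tgt _ _)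
  exact isIso_of_mono_of_epi _

/-- Finite presentation of the cohomology passes to the truncations for the canonical
t-structure. -/
lemma homologyFinPres_of_truncation (T : Triangle (DerivedCategory (ModuleCat.{u} R)))
    (hT : T ∈ distTriang _) (a : ℤ) (h₁ : T.obj₁.IsLE a) (h₃ : T.obj₃.IsGE (a + 1))
    (h : homologyFinPres R T.obj₂) : homologyFinPres R T.obj₁ ∧ homologyFinPres R T.obj₃ := by
  refine ⟨fun i => ?_, fun i => ?_⟩
  · by_cases hi : i ≤ a
    · have := isIso_homologyMap_mor₁ T hT a h₃ i hi
      exact (finPres R).prop_of_iso (asIso (DerivedCategory.homologyFunctor _ i |>.map T.mor₁)).symm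
        (h i)
    · exact finPres_of_isZero R _ (T.obj₁.isZero_of_isLE a i (by lia))
  · by_cases hi : a < i
    · have := isIso_homologyMap_mor₂ T hT a h₁ i hi
      exact (finPres R).prop_of_iso (asIso (DerivedCategory.homologyFunctor _ i |>.map T.mor₂))
        (h i)
    · exact finPres_of_isZero R _ (T.obj₃.isZero_of_isGE (a + 1) i (by lia))

/-- Over a regular coherent ring, a bounded object with finitely presented cohomology is perfect: it
is an iterated extension of shifts of its cohomology modules. -/
lemma perfect_of_homologyFinPres (hR : IsCoherentRing R) (hreg : IsHomologicallyRegular R)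
    (X : DerivedCategory (ModuleCat.{u} R)) (hX : homologyFinPres R X) (a b : ℤ)
    (ha : X.IsGE a) (hb : X.IsLE b) : perfect R X := by
  obtain ⟨n, hn⟩ : ∃ n : ℕ, b ≤ a + n - 1 := ⟨(b + 1 - a).toNat, by lia⟩
  induction n generalizing X b with
  | zero =>
    exact (perfect R).prop_of_isZero
      (DerivedCategory.TStructure.t.isZero X b a (by lia))
  | succ n ih =>
    have hT := DerivedCategory.TStructure.t.triangleLEGE_distinguished (b - 1) b (by lia) X
    have hle : (DerivedCategory.TStructure.t.truncLE (b - 1)).obj X |>.IsLE (b - 1) := inferInstance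
    have hge : (DerivedCategory.TStructure.t.truncGE b).obj X |>.IsGE b := inferInstance
    obtain ⟨h₁, h₃⟩ := homologyFinPres_of_truncation _ hT (b - 1) hle
      (by rw [sub_add_cancel]; exact hge) hX
    refine (perfect R).ext_of_isTriangulatedClosed₂ _ hT ?_ ?_
    · have : (DerivedCategory.TStructure.t.truncLE (b - 1)).obj X |>.IsGE a := inferInstance
      exact ih _ h₁ (b - 1) this hle (by lia)
    · have : (DerivedCategory.TStructure.t.truncGE b).obj X |>.IsLE b := inferInstance
      obtain ⟨Y, ⟨e⟩⟩ := DerivedCategory.exists_iso_singleFunctor_obj_of_isGE_of_isLE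
        ((DerivedCategory.TStructure.t.truncGE b).obj X) b
      refine (perfect R).prop_of_iso e.symm (perfect_singleFunctor_of_finPres hR hreg Y ?_ b)
      exact (finPres R).prop_of_iso ((DerivedCategory.homologyFunctor _ b).mapIso e ≪≫
        (DerivedCategory.singleFunctorCompHomologyFunctorIso (ModuleCat.{u} R) b).app Y) (h₃ b)

lemma homologyFinPres_Q_obj (hR : IsCoherentRing R) (K : CochainComplex (ModuleCat.{u} R) ℤ)
    (hK : ∀ i, finPres R (K.X i)) : homologyFinPres R (DerivedCategory.Q.obj K) := fun i =>
  (finPres R).prop_of_iso ((DerivedCategory.homologyFunctorFactors (ModuleCat.{u} R) i).app K).symm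
    (finPres_homology_of_terms hR K hK i)

lemma perfect_Q_obj_of_finPres (hR : IsCoherentRing R) (hreg : IsHomologicallyRegular R)
    (K : CochainComplex (ModuleCat.{u} R) ℤ) (hK : bddComplexes (finPres R) K) :
    perfect R (DerivedCategory.Q.obj K) := by
  obtain ⟨⟨a, b, _, _⟩, h⟩ := hK
  exact perfect_of_homologyFinPres hR hreg _ (homologyFinPres_Q_obj hR K h) a b
    inferInstance inferInstance

end

end

/-! ### The canonical t-structure on `K^b(proj R)` -/

section

variable {C D : Type*} [Category* C] [Category* D] [Preadditive C] [HasZeroObject C] [HasShift C ℤ]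
  [∀ n : ℤ, (shiftFunctor C n).Additive] [Pretriangulated C] [Preadditive D] [HasZeroObject D]
  [HasShift D ℤ] [∀ n : ℤ, (shiftFunctor D n).Additive] [Pretriangulated D]

/-- The restriction of a t-structure along a fully faithful triangulated functor whose essential
image is stable under truncation. -/
def restrictTStructure (F : C ⥤ D) [F.CommShift ℤ] [F.IsTriangulated] [F.Full] [F.Faithful]
    (t : TStructure D)
    (h : ∀ X : C, ∃ (A B : D) (f : A ⟶ F.obj X) (g : F.obj X ⟶ B) (δ : B ⟶ A⟦(1 : ℤ)⟧),
      t.le 0 A ∧ t.ge 1 B ∧ Triangle.mk f g δ ∈ distTriang D ∧ F.essImage A ∧ F.essImage B) :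
    TStructure C where
  le n := (t.le n).inverseImage F
  ge n := (t.ge n).inverseImage F
  le_shift n a n' hn X hX :=
    (t.le n').prop_of_iso ((F.commShiftIso a).symm.app X) (t.le_shift n a n' hn _ hX)
  ge_shift n a n' hn X hX :=
    (t.ge n').prop_of_iso ((F.commShiftIso a).symm.app X) (t.ge_shift n a n' hn _ hX)
  zero' X Y f hX hY := F.map_injective ((t.zero' (F.map f) hX hY).trans (F.map_zero _ _).symm)
  le_zero_le X hX := t.le_zero_le _ hX
  ge_one_le X hX := t.ge_one_le _ hX
  exists_triangle_zero_one X := by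
    obtain ⟨_, _, f, g, δ, hA, hB, hT, ⟨A, ⟨eA⟩⟩, ⟨B, ⟨eB⟩⟩⟩ := h X
    refine ⟨A, B, (t.le 0).prop_of_iso eA.symm hA, (t.ge 1).prop_of_iso eB.symm hB,
      F.preimage (eA.hom ≫ f), F.preimage (g ≫ eB.inv),
      F.preimage (eB.hom ≫ δ ≫ eA.inv⟦(1 : ℤ)⟧' ≫ (F.commShiftIso (1 : ℤ)).inv.app A), ?_⟩
    rw [← F.map_distinguished_iff]
    refine isomorphic_distinguished _ hT _ (Triangle.isoMk _ _ eA (Iso.refl _) eB ?_ ?_ ?_)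
    · exact (Category.comp_id _).trans (F.map_preimage _)
    · change F.map (F.preimage _) ≫ eB.hom = 𝟙 _ ≫ g
      rw [F.map_preimage, Category.assoc, Iso.inv_hom_id, Category.comp_id, Category.id_comp]
    · change (F.map (F.preimage _) ≫ (F.commShiftIso (1 : ℤ)).hom.app A) ≫ eA.hom⟦(1 : ℤ)⟧' =
        eB.hom ≫ δ
      rw [F.map_preimage, Category.assoc, Category.assoc, Category.assoc, Category.assoc,
        Iso.inv_hom_id_app_assoc, ← Functor.map_comp, Iso.inv_hom_id, CategoryTheory.Functor.map_id,
        Category.comp_id]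

end

section

variable {R : Type u} [CommRing R]

lemma le_kbProjToDerived_iff [HasDerivedCategory.{w} (ModuleCat.{u} R)] (n : ℤ) (X : KbProj R) :
    DerivedCategory.TStructure.t.le n ((kbProjToDerived R).obj X) ↔
      ∀ i : ℤ, n < i → IsZero ((HomotopyCategory.homologyFunctor (ModuleCat.{u} R)
        (ComplexShape.up ℤ) i).obj X.obj) := by
  rw [TStructure.le_iff_isLE]
  refine (DerivedCategory.isLE_iff _ _).trans ?_
  exact forall₂_congr fun i _ =>
    ((DerivedCategory.homologyFunctorFactorsh (ModuleCat.{u} R) i).app X.obj).isZero_iff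

lemma ge_kbProjToDerived_iff [HasDerivedCategory.{w} (ModuleCat.{u} R)] (n : ℤ) (X : KbProj R) :
    DerivedCategory.TStructure.t.ge n ((kbProjToDerived R).obj X) ↔
      ∀ i : ℤ, i < n → IsZero ((HomotopyCategory.homologyFunctor (ModuleCat.{u} R)
        (ComplexShape.up ℤ) i).obj X.obj) := by
  rw [TStructure.ge_iff_isGE]
  refine (DerivedCategory.isGE_iff _ _).trans ?_
  exact forall₂_congr fun i _ =>
    ((DerivedCategory.homologyFunctorFactorsh (ModuleCat.{u} R) i).app X.obj).isZero_iff

section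

variable [HasDerivedCategory.{w} (ModuleCat.{u} R)]

lemma exists_Q_obj_iso_kbProjToDerived (X : KbProj R) :
    ∃ K : CochainComplex (ModuleCat.{u} R) ℤ, bddComplexes (fgProj R) K ∧
      Nonempty ((kbProjToDerived R).obj X ≅ DerivedCategory.Q.obj K) :=
  ⟨X.obj.as, X.property, ⟨(DerivedCategory.quotientCompQhIso (ModuleCat.{u} R)).app X.obj.as⟩⟩

lemma bounded_kbProjToDerived (X : KbProj R) :
    ∃ a b : ℤ, ((kbProjToDerived R).obj X).IsGE a ∧ ((kbProjToDerived R).obj X).IsLE b := by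
  obtain ⟨K, ⟨⟨a, b, _, _⟩, -⟩, ⟨e⟩⟩ := exists_Q_obj_iso_kbProjToDerived X
  exact ⟨a, b, DerivedCategory.TStructure.t.isGE_of_iso e.symm a,
    DerivedCategory.TStructure.t.isLE_of_iso e.symm b⟩

/-- The restriction of the canonical t-structure of the derived category to `K^b(proj R)`, for a
regular coherent ring. -/
noncomputable def canonicalTStructure (hR : IsCoherentRing R) (hreg : IsHomologicallyRegular R) :
    TStructure (KbProj R) :=
  restrictTStructure (kbProjToDerived R) DerivedCategory.TStructure.t fun X => by
    obtain ⟨a, b, ha, hb⟩ := bounded_kbProjToDerived X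
    obtain ⟨K, ⟨-, hK⟩, ⟨e⟩⟩ := exists_Q_obj_iso_kbProjToDerived X
    have hX : homologyFinPres R ((kbProjToDerived R).obj X) := fun i =>
      (finPres R).prop_of_iso ((DerivedCategory.homologyFunctor _ i).mapIso e.symm)
        (homologyFinPres_Q_obj hR K (fun i => fgProj_le_finPres R _ (hK i)) i)
    have hT := DerivedCategory.TStructure.t.triangleLEGE_distinguished 0 1 (by lia)
      ((kbProjToDerived R).obj X)
    generalize (kbProjToDerived R).obj X = Y at ha hb hX hT
    have hle : ((DerivedCategory.TStructure.t.truncLE 0).obj Y).IsLE 0 := inferInstance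
    have hge : ((DerivedCategory.TStructure.t.truncGE 1).obj Y).IsGE 1 := inferInstance
    have hle' : ((DerivedCategory.TStructure.t.truncGE 1).obj Y).IsLE b := inferInstance
    have hge' : ((DerivedCategory.TStructure.t.truncLE 0).obj Y).IsGE a := inferInstance
    obtain ⟨h₁, h₃⟩ := homologyFinPres_of_truncation _ hT 0 hle hge hX
    exact ⟨_, _, _, _, _, hle.le, hge.ge, hT, perfect_of_homologyFinPres hR hreg _ h₁ a 0 hge' hle,
      perfect_of_homologyFinPres hR hreg _ h₃ 1 b hge hle'⟩

lemma canonicalTStructure_le_iff (hR : IsCoherentRing R) (hreg : IsHomologicallyRegular R)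
    (n : ℤ) (X : KbProj R) : (canonicalTStructure hR hreg).le n X ↔
      ∀ i : ℤ, n < i → IsZero ((HomotopyCategory.homologyFunctor (ModuleCat.{u} R)
        (ComplexShape.up ℤ) i).obj X.obj) :=
  le_kbProjToDerived_iff n X

lemma canonicalTStructure_ge_iff (hR : IsCoherentRing R) (hreg : IsHomologicallyRegular R)
    (n : ℤ) (X : KbProj R) : (canonicalTStructure hR hreg).ge n X ↔
      ∀ i : ℤ, i < n → IsZero ((HomotopyCategory.homologyFunctor (ModuleCat.{u} R)
        (ComplexShape.up ℤ) i).obj X.obj) :=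
  ge_kbProjToDerived_iff n X

lemma canonicalTStructure_le_zero (hR : IsCoherentRing R) (hreg : IsHomologicallyRegular R) :
    (canonicalTStructure hR hreg).le 0 = cohLE R := by
  ext X
  exact canonicalTStructure_le_iff hR hreg 0 X

lemma canonicalTStructure_ge_zero (hR : IsCoherentRing R) (hreg : IsHomologicallyRegular R) :
    (canonicalTStructure hR hreg).ge 0 = cohGE R := by
  ext X
  exact canonicalTStructure_ge_iff hR hreg 0 X

lemma tBounded_canonicalTStructure (hR : IsCoherentRing R) (hreg : IsHomologicallyRegular R) :
    TBounded (canonicalTStructure hR hreg) := fun X => by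
  obtain ⟨a, b, ha, hb⟩ := bounded_kbProjToDerived X
  exact ⟨⟨a, ⟨ha.ge⟩⟩, ⟨b, ⟨hb.le⟩⟩⟩

end

/-! ### Comparison with the bounded derived category -/

section

lemma leftOrthogonal_kbProjToKbMod (X : KbProj R) :
    (acyclicKbMod R).leftOrthogonal ((kbProjToKbMod R).obj X) := fun _ f hY =>
  (bddHomotopy (finPres R)).ι.map_injective
    (Eq.trans (leftOrthogonal_of_bddHomotopy_fgProj X.obj X.property
      ((bddHomotopy (finPres R)).ι.map f) hY)
      ((bddHomotopy (finPres R)).ι.map_zero ((kbProjToKbMod R).obj X) _).symm)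

/-- Morphisms in `D^b(R-mod)` from a bounded complex of finitely generated projective modules are
homotopy classes of morphisms of complexes. -/
lemma Q_map_bijective_of_kbProj (X : KbProj R) (Y : KbMod R) :
    Function.Bijective ((acyclicKbMod R).trW.Q.map : ((kbProjToKbMod R).obj X ⟶ Y) → _) :=
  (leftOrthogonal_kbProjToKbMod X).map_bijective_of_isTriangulated _ _

instance : (kbProjToDbMod R).Full where
  map_surjective {X Y} f := by
    obtain ⟨g, hg⟩ := (Q_map_bijective_of_kbProj X ((kbProjToKbMod R).obj Y)).2 f
    exact ⟨(bddHomotopy (fgProj R)).fullyFaithfulι.preimage ((bddHomotopy (finPres R)).ι.map g), hg⟩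

instance : (kbProjToDbMod R).Faithful where
  map_injective {X Y} _ _ h := (bddHomotopy (fgProj R)).ι.map_injective
    (congrArg (bddHomotopy (finPres R)).ι.map
      ((Q_map_bijective_of_kbProj X ((kbProjToKbMod R).obj Y)).1 h))

attribute [local instance] HasDerivedCategory.standard in
/-- A bounded complex `M` of finitely presented modules is perfect in the derived category. The
isomorphism from a bounded complex of finitely generated projective modules is induced by a
quasi-isomorphism of complexes since its source is K-projective, so it can be inverted in
`D^b(R-mod)`. -/
lemma kbProjToDbMod_essSurj (hR : IsCoherentRing R) (hreg : IsHomologicallyRegular R) :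
    (kbProjToDbMod R).EssSurj where
  mem_essImage Y := by
    let M : KbMod R := (acyclicKbMod R).trW.Q.objPreimage Y
    obtain ⟨P, ⟨e⟩⟩ := perfect_Q_obj_of_finPres hR hreg M.obj.as M.property
    let e' : (kbProjToDerived R).obj P ≅ DerivedCategory.Qh.obj M.obj :=
      e ≪≫ ((DerivedCategory.quotientCompQhIso (ModuleCat.{u} R)).app M.obj.as).symm
    obtain ⟨g, hg⟩ := (Qh_map_bijective_of_bddHomotopy_fgProj P.obj P.property M.obj).2 e'.hom
    let g' : (kbProjToKbMod R).obj P ⟶ M := (bddHomotopy (finPres R)).fullyFaithfulι.preimage g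
    have hg' : (acyclicKbMod R).trW g' := by
      obtain ⟨Z, a, b, hT⟩ := distinguished_cocone_triangle g'
      refine ⟨Z, a, b, hT, (HomotopyCategory.mem_subcategoryAcyclic_iff _).2 fun n => ?_⟩
      have he : IsIso (DerivedCategory.Qh.map g) := by rw [hg]; infer_instance
      have hT' := DerivedCategory.Qh.map_distinguished _
        ((bddHomotopy (finPres R)).ι.map_distinguished _ hT)
      have hZ : IsZero (DerivedCategory.Qh.obj Z.obj) :=
        (Triangle.isZero₃_iff_isIso₁ _ hT').2 he
      exact ((DerivedCategory.homologyFunctor (ModuleCat.{u} R) n).map_isZero hZ).of_iso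
        (((DerivedCategory.homologyFunctorFactorsh (ModuleCat.{u} R) n).app Z.obj).symm)
    have := Localization.inverts (acyclicKbMod R).trW.Q _ g' hg'
    exact ⟨P, ⟨asIso ((acyclicKbMod R).trW.Q.map g') ≪≫ (acyclicKbMod R).trW.Q.objObjPreimageIso Y⟩⟩

lemma kbProjToDbMod_isEquivalence (hR : IsCoherentRing R) (hreg : IsHomologicallyRegular R) :
    (kbProjToDbMod R).IsEquivalence where
  essSurj := kbProjToDbMod_essSurj hR hreg

/-- In the quotient by the essential image every object of that image becomes zero. -/
lemma isZero_singularityCategory [(kbProjToDbMod R).EssSurj] (X : SingularityCategory R) :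
    IsZero X := by
  have h (Y : DbMod R) : (kbProjToDbMod R).essImage Y :=
    Functor.EssSurj.mem_essImage (kbProjToDbMod R) Y
  let Q := (kbProjToDbMod R).essImage.trW.Q
  have := Localization.essSurj Q (kbProjToDbMod R).essImage.trW
  refine IsZero.of_iso ?_ (Q.objObjPreimageIso X).symm
  have hz : (kbProjToDbMod R).essImage.trW (0 : Q.objPreimage X ⟶ 0) :=
    ObjectProperty.trW.mk _ (contractible_distinguished₂ (Q.objPreimage X)) (h _)
  have := Localization.inverts Q _ _ hz
  exact (Q.map_isZero (isZero_zero _)).of_iso (asIso (Q.map (0 : Q.objPreimage X ⟶ 0)))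

end

end

/-! ### The Koszul complex of the variables -/

section

lemma homologyMap_smul_id {R : Type u} [CommRing R] (K : CochainComplex (ModuleCat.{u} R) ℤ)
    (r : R) (i : ℤ) : HomologicalComplex.homologyMap (r • 𝟙 K) i = r • 𝟙 (K.homology i) := by
  refine (ShortComplex.homologyMap_smul (𝟙 (K.sc i)) r).trans ?_
  rw [ShortComplex.homologyMap_id]
  rfl

variable (k : Type u) [Field k]

attribute [local instance] HasDerivedCategory.standard in
/-- The sequence of the first `n` variables is regular, so its Koszul complex is a resolution of the
quotient by the ideal it generates. The long exact cohomology sequence of a mapping cone of a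
multiplication map gives the induction step. -/
lemma homology_koszulComplex_X (n : ℕ) :
    (∀ i : ℤ, i < 0 → IsZero ((koszulComplex (MvPolynomial.X (R := k)) n).homology i)) ∧
    (∀ i : ℤ, 0 < i → IsZero ((koszulComplex (MvPolynomial.X (R := k)) n).homology i)) ∧
      Nonempty ((koszulComplex (MvPolynomial.X (R := k)) n).homology 0 ≅ varsQuotient k n) := by
  induction n with
  | zero =>
    refine ⟨fun i hi => ?_, fun i hi => ?_, ⟨?_⟩⟩
    · exact (HomologicalComplex.exactAt_single_obj (ComplexShape.up ℤ) 0 _ i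
        hi.ne).isZero_homology
    · exact (HomologicalComplex.exactAt_single_obj (ComplexShape.up ℤ) 0 _ i
        hi.ne').isZero_homology
    · refine (HomologicalComplex.singleObjHomologySelfIso (ComplexShape.up ℤ) 0 _) ≪≫ ?_
      refine LinearEquiv.toModuleIso ?_
      exact (Submodule.quotEquivOfEqBot _ (varsIdeal_zero k)).symm
  | succ n ih =>
    obtain ⟨ih₁, ih₂, ⟨e⟩⟩ := ih
    let K := koszulComplex (MvPolynomial.X (R := k)) n
    let φ : K ⟶ K := (MvPolynomial.X n : MvPolynomial ℕ k) • 𝟙 K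
    have hT := DerivedCategory.mappingCone_triangle_distinguished φ
    have hS := varsShortComplex_shortExact k n
    have hf : Mono (varsShortComplex k n).f := hS.mono_f
    have := hS.epi_g
    have hcomm : HomologicalComplex.homologyMap φ 0 ≫ e.hom = e.hom ≫ (varsShortComplex k n).f := by
      rw [homologyMap_smul_id]
      change _ = e.hom ≫ ((MvPolynomial.X n : MvPolynomial ℕ k) • 𝟙 _)
      rw [Linear.smul_comp, Linear.comp_smul, Category.id_comp, Category.comp_id]
    have hmono : Mono (HomologicalComplex.homologyMap φ 0) := by
      have : Mono (HomologicalComplex.homologyMap φ 0 ≫ e.hom) := by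
        rw [hcomm]
        exact @mono_comp _ _ _ _ _ e.hom inferInstance _ hf
      exact mono_of_mono _ e.hom
    refine ⟨fun i hi => ?_, fun i hi => ?_, ⟨?_⟩⟩
    · have h₃ := CochainComplex.homologyMap_exact₃_of_distTriang _ hT i (i + 1)
      refine h₃.isZero_of_both_zeros ((ih₁ i hi).eq_of_src _ _) ?_
      rcases lt_or_eq_of_le (show i + 1 ≤ 0 by lia) with h | h
      · exact (ih₁ _ h).eq_of_tgt _ _
      · obtain rfl : i = -1 := by lia
        exact hmono.right_cancellation _ _
          ((CochainComplex.homologyδOfTriangle_homologyMap _ hT (-1) 0).trans zero_comp.symm)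
    · exact (CochainComplex.homologyMap_exact₃_of_distTriang _ hT i (i + 1)).isZero_of_both_zeros
        ((ih₂ i hi).eq_of_src _ _) ((ih₂ _ (by lia)).eq_of_tgt _ _)
    · have h₂ := CochainComplex.homologyMap_exact₂_of_distTriang _ hT 0
      have hepi : Epi (HomologicalComplex.homologyMap
          (CochainComplex.mappingCone.triangle φ).mor₂ 0) :=
        (CochainComplex.homologyMap_exact₃_of_distTriang _ hT 0 1).epi_f
          ((ih₂ 1 (by lia)).eq_of_tgt _ _)
      have c₁ := h₂.gIsCokernel
      have c₂ := hS.exact.gIsCokernel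
      exact (c₁.coconePointUniqueUpToIso (colimit.isColimit _)) ≪≫
        cokernel.mapIso _ _ e e hcomm ≪≫ ((colimit.isColimit _).coconePointUniqueUpToIso c₂)

lemma cohGE_koszul_X (n : ℕ) :
    cohGE (MvPolynomial ℕ k) (koszul (MvPolynomial.X (R := k)) n) := fun i hi =>
  ((homology_koszulComplex_X k n).1 i hi).of_iso
    ((HomotopyCategory.homologyFunctorFactors _ _ i).app _)

end

/-! ### The dual of a Koszul complex -/

section

variable {R : Type u} [CommRing R]

/-- All values of the linear form `f` lie in the ideal `I`. -/
def ValuesIn (I : Ideal R) {M : ModuleCat.{u} R} (f : M ⟶ ModuleCat.of R R) : Prop :=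
  ∀ z : M, f.hom z ∈ I

lemma ValuesIn.comp {I : Ideal R} {M N : ModuleCat.{u} R} {f : M ⟶ ModuleCat.of R R}
    (hf : ValuesIn I f) (g : N ⟶ M) : ValuesIn I (g ≫ f) := fun z => hf (g.hom z)

lemma ValuesIn.add {I : Ideal R} {M : ModuleCat.{u} R} {f g : M ⟶ ModuleCat.of R R}
    (hf : ValuesIn I f) (hg : ValuesIn I g) : ValuesIn I (f + g) :=
  fun z => I.add_mem (hf z) (hg z)

lemma ValuesIn.neg {I : Ideal R} {M : ModuleCat.{u} R} {f : M ⟶ ModuleCat.of R R}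
    (hf : ValuesIn I f) : ValuesIn I (-f) := fun z => I.neg_mem (hf z)

lemma ValuesIn.smul {I : Ideal R} {M : ModuleCat.{u} R} {r : R} (hr : r ∈ I)
    (f : M ⟶ ModuleCat.of R R) : ValuesIn I (r • f) := fun z => I.mul_mem_right (f.hom z) hr

lemma ValuesIn.zero (I : Ideal R) (M : ModuleCat.{u} R) :
    ValuesIn I (0 : M ⟶ ModuleCat.of R R) := fun _ => I.zero_mem

lemma isStrictlyGE_koszulComplex (x : ℕ → R) (n : ℕ) :
    (koszulComplex x n).IsStrictlyGE (-(n : ℤ)) := by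
  induction n with
  | zero => exact inferInstanceAs (CochainComplex.IsStrictlyGE
      ((CochainComplex.singleFunctor (ModuleCat.{u} R) 0).obj (ModuleCat.of R R)) 0)
  | succ n ih =>
    rw [CochainComplex.isStrictlyGE_iff]
    intro i hi
    rw [show koszulComplex x (n + 1) = CochainComplex.mappingCone (x n • 𝟙 (koszulComplex x n))
      from rfl, CochainComplex.mappingCone.isZero_X_iff]
    exact ⟨CochainComplex.isZero_of_isStrictlyGE _ (-(n : ℤ)) _ (by lia),
      CochainComplex.isZero_of_isStrictlyGE _ (-(n : ℤ)) _ (by lia)⟩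

open CochainComplex in
/-- If `r` lies in `I` and the differentials of `K` vanish modulo `I`, so do those of the mapping
cone of the multiplication by `r`. The condition is expressed by composition with linear forms. -/
lemma valuesIn_mappingCone_smul_id_d (I : Ideal R) {r : R} (hr : r ∈ I)
    (K : CochainComplex (ModuleCat.{u} R) ℤ)
    (hK : ∀ (i j : ℤ) (χ : K.X j ⟶ ModuleCat.of R R), ValuesIn I (K.d i j ≫ χ)) (i j : ℤ)
    (χ : (mappingCone (r • 𝟙 K)).X j ⟶ ModuleCat.of R R) :
    ValuesIn I ((mappingCone (r • 𝟙 K)).d i j ≫ χ) := by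
  by_cases hij : i + 1 = j
  swap
  · rw [HomologicalComplex.shape _ _ _ hij, zero_comp]
    exact .zero _ _
  · have h₁ : (r • 𝟙 K : K ⟶ K).f j = r • 𝟙 (K.X j) := rfl
    rw [← Category.id_comp χ, ← mappingCone.id_X (r • 𝟙 K) j (j + 1) rfl, Preadditive.add_comp,
      Preadditive.comp_add, Category.assoc, Category.assoc,
      mappingCone.d_fst_v_assoc _ i j (j + 1) hij rfl, mappingCone.d_snd_v_assoc _ i j hij, h₁,
      Preadditive.neg_comp, Preadditive.add_comp]
    refine .add (.neg ?_) (.add ?_ ?_)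
    · rw [Category.assoc]
      exact (hK _ _ _).comp _
    · rw [Linear.comp_smul, Linear.smul_comp]
      exact .smul hr _
    · rw [Category.assoc]
      exact (hK _ _ _).comp _

/-- The differentials of the Koszul complex of elements of `I` vanish modulo `I`. -/
lemma valuesIn_koszulComplex_d (I : Ideal R) (x : ℕ → R) (hx : ∀ n, x n ∈ I) (n : ℕ) (i j : ℤ)
    (χ : (koszulComplex x n).X j ⟶ ModuleCat.of R R) :
    ValuesIn I ((koszulComplex x n).d i j ≫ χ) := by
  induction n generalizing i j with
  | zero =>
    have : (koszulComplex x 0).d i j = 0 := HomologicalComplex.single_obj_d _ _ _ _ _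
    rw [this, zero_comp]
    exact .zero _ _
  | succ n ih => exact valuesIn_mappingCone_smul_id_d I (hx n) _ ih i j χ

lemma exists_section_mappingCone {K L : CochainComplex (ModuleCat.{u} R) ℤ} (φ : K ⟶ L)
    {M : ModuleCat.{u} R} (i j : ℤ) (hij : i + 1 = j) (s : M ⟶ K.X j) (ψ : K.X j ⟶ M)
    (h : s ≫ ψ = 𝟙 M) : ∃ (s' : M ⟶ (CochainComplex.mappingCone φ).X i)
      (ψ' : (CochainComplex.mappingCone φ).X i ⟶ M), s' ≫ ψ' = 𝟙 M := by
  refine ⟨s ≫ (CochainComplex.mappingCone.inl φ).v _ _ (by lia),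
    (CochainComplex.mappingCone.fst φ).1.v _ _ hij ≫ ψ, ?_⟩
  rw [Category.assoc, CochainComplex.mappingCone.inl_v_fst_v_assoc, h]

/-- The term in degree `-n` of the Koszul complex, a top exterior power, has a summand `R`. -/
lemma exists_section_koszulComplex (x : ℕ → R) (n : ℕ) :
    ∃ (s : ModuleCat.of R R ⟶ (koszulComplex x n).X (-(n : ℤ)))
      (ψ : (koszulComplex x n).X (-(n : ℤ)) ⟶ ModuleCat.of R R), s ≫ ψ = 𝟙 _ := by
  induction n with
  | zero => exact ⟨_, _,
      (HomologicalComplex.singleObjXSelf (ComplexShape.up ℤ) 0 (ModuleCat.of R R)).inv_hom_id⟩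
  | succ n ih =>
    obtain ⟨s, ψ, h⟩ := ih
    exact exists_section_mappingCone (x n • 𝟙 (koszulComplex x n)) _ _
      (by push_cast; ring) s ψ h

/-- The dual of the Koszul complex of `n` elements of a proper ideal `I` has nonzero cohomology in
degree `n`: the linear form which is `1` on a generator of the top exterior power is a cocycle,
but the values of coboundaries lie in `I`. -/
lemma not_isZero_homology_dualComplex_koszulComplex (I : Ideal R) (hI : I ≠ ⊤) (x : ℕ → R)
    (hx : ∀ n, x n ∈ I) (n : ℕ) : ¬ IsZero ((dualComplex (koszulComplex x n)).homology n) := by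
  intro h
  rw [← HomologicalComplex.exactAt_iff_isZero_homology,
    HomologicalComplex.exactAt_iff' _ ((n : ℤ) - 1) n (n + 1) (by simp) (by simp),
    ShortComplex.moduleCat_exact_iff] at h
  obtain ⟨s, ψ, hs⟩ := exists_section_koszulComplex x n
  obtain ⟨χ, hχ⟩ := h ψ.hom (by
    have hz : IsZero ((koszulComplex x n).X (-((n : ℤ) + 1))) := by
      have := isStrictlyGE_koszulComplex x n
      exact CochainComplex.isZero_of_isStrictlyGE _ (-(n : ℤ)) _ (by lia)
    have := ModuleCat.subsingleton_of_isZero hz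
    exact LinearMap.ext fun z => by
      rw [Subsingleton.elim z 0]
      exact (map_zero _).trans (map_zero _).symm)
  refine hI ((Ideal.eq_top_iff_one I).2 ?_)
  have h1 : ψ.hom (s.hom 1) = 1 := congrArg (fun f => f.hom (1 : R)) hs
  have h2 := valuesIn_koszulComplex_d I x hx n (-(n : ℤ)) (-((n : ℤ) - 1)) (ModuleCat.ofHom χ)
    (s.hom 1)
  have h3 := congrArg (fun f : Module.Dual R _ => f (s.hom 1)) hχ
  rw [← h1]
  exact Eq.mp (congrArg (· ∈ I) h3) h2

end

/-! ### The double dual -/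

section

variable {R : Type u} [CommRing R]

/-- The evaluation map `M → Hom_R(Hom_R(M, R), R)`. -/
def evalDual (M : ModuleCat.{u} R) :
    M ⟶ ModuleCat.of R (Module.Dual R (ModuleCat.of R (Module.Dual R M))) :=
  ModuleCat.ofHom (Module.Dual.eval R M)

lemma evalDual_naturality {M N : ModuleCat.{u} R} (f : M ⟶ N) :
    f ≫ evalDual N = evalDual M ≫ transpose (transpose f) := rfl

lemma isIso_evalDual (M : ModuleCat.{u} R) (hM : fgProj R M) : IsIso (evalDual M) := by
  obtain ⟨_, _⟩ := hM
  exact (Module.evalEquiv R M).toModuleIso.isIso_hom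

/-- The evaluation morphism from a complex to its double dual. -/
def evalDualComplex (K : CochainComplex (ModuleCat.{u} R) ℤ) :
    K ⟶ dualComplex (dualComplex K) where
  f i := (K.XIsoOfEq (neg_neg i).symm).hom ≫ evalDual (K.X (- -i))
  comm' i j _ := by
    change ((K.XIsoOfEq (neg_neg i).symm).hom ≫ evalDual (K.X (- -i))) ≫
      transpose (transpose (K.d (- -i) (- -j))) =
        K.d i j ≫ (K.XIsoOfEq (neg_neg j).symm).hom ≫ evalDual (K.X (- -j))
    rw [Category.assoc, ← evalDual_naturality, ← Category.assoc, ← Category.assoc,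
      HomologicalComplex.XIsoOfEq_hom_comp_d, HomologicalComplex.d_comp_XIsoOfEq_hom]

lemma evalDualComplex_naturality {K L : CochainComplex (ModuleCat.{u} R) ℤ} (f : K ⟶ L) :
    f ≫ evalDualComplex L = evalDualComplex K ≫ dualComplexMap (dualComplexMap f) := by
  ext1 i
  change f.f i ≫ (L.XIsoOfEq (neg_neg i).symm).hom ≫ evalDual (L.X (- -i)) =
    ((K.XIsoOfEq (neg_neg i).symm).hom ≫ evalDual (K.X (- -i))) ≫
      transpose (transpose (f.f (- -i)))
  rw [Category.assoc, ← evalDual_naturality, ← Category.assoc, ← Category.assoc,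
    HomologicalComplex.XIsoOfEq_hom_naturality]

lemma isIso_evalDualComplex (K : CochainComplex (ModuleCat.{u} R) ℤ)
    (hK : ∀ i, fgProj R (K.X i)) : IsIso (evalDualComplex K) := by
  have (i : ℤ) : IsIso ((evalDualComplex K).f i) := by
    have := isIso_evalDual (K.X (- -i)) (hK _)
    exact inferInstanceAs (IsIso ((K.XIsoOfEq (neg_neg i).symm).hom ≫ evalDual (K.X (- -i))))
  exact HomologicalComplex.Hom.isIso_of_components _

/-- The evaluation isomorphism from an object of `K^b(proj R)` to its double dual. -/
noncomputable def doubleDualIso (X : KbProj R) :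
    X ≅ (dual R).obj (Opposite.op ((dual R).obj (Opposite.op X))) :=
  have := isIso_evalDualComplex X.obj.as X.property.2
  (bddHomotopy (fgProj R)).fullyFaithfulι.preimageIso
    ((HomotopyCategory.quotient _ _).mapIso (@asIso _ _ _ _ _ this))

lemma doubleDualIso_naturality {X Y : KbProj R} (f : X ⟶ Y) :
    f ≫ (doubleDualIso Y).hom =
      (doubleDualIso X).hom ≫ (dual R).map ((dual R).map f.op).op := by
  apply (bddHomotopy (fgProj R)).ι.map_injective
  obtain ⟨g : X.obj.as ⟶ Y.obj.as, hg⟩ :=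
    (HomotopyCategory.quotient _ _).map_surjective ((bddHomotopy (fgProj R)).ι.map f)
  obtain rfl : f = (bddHomotopy (fgProj R)).fullyFaithfulι.preimage
    ((HomotopyCategory.quotient _ _).map g) :=
      (bddHomotopy (fgProj R)).ι.map_injective hg.symm
  exact congrArg (HomotopyCategory.quotient _ _).map (evalDualComplex_naturality g)

/-- The functor `dual` is faithful since the double dual is isomorphic to the identity. -/
lemma dual_map_injective {X Y : KbProj R} {f g : X ⟶ Y}
    (h : (dual R).map f.op = (dual R).map g.op) : f = g := by
  rw [← cancel_mono (doubleDualIso Y).hom, doubleDualIso_naturality, doubleDualIso_naturality, h]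

lemma dual_map_zero (X Y : KbProj R) : (dual R).map (0 : X ⟶ Y).op = 0 := by
  apply (bddHomotopy (fgProj R)).ι.map_injective
  change (dualHomotopyCategory R).map (0 : X.obj ⟶ Y.obj).op = 0
  rw [show (0 : X.obj ⟶ Y.obj) = (HomotopyCategory.quotient _ _).map (0 : X.obj.as ⟶ Y.obj.as) from
    ((HomotopyCategory.quotient _ _).map_zero X.obj.as Y.obj.as).symm]
  refine Eq.trans (congrArg (HomotopyCategory.quotient _ _).map
    (?_ : dualComplexMap (0 : X.obj.as ⟶ Y.obj.as) = 0))
    ((HomotopyCategory.quotient _ _).map_zero _ _)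
  ext1 i
  exact transpose_zero _ _

lemma dualImage_iff (A : ObjectProperty (KbProj R)) [A.IsClosedUnderIsomorphisms] (X : KbProj R) :
    dualImage A X ↔ A ((dual R).obj (Opposite.op X)) := by
  refine ⟨?_, fun h => ⟨_, h, ⟨doubleDualIso X⟩⟩⟩
  rintro ⟨Y, hY, ⟨e⟩⟩
  exact A.prop_of_iso (doubleDualIso Y ≪≫ (dual R).mapIso e.op) hY

/-! ### Duality and the triangulated structure -/

lemma transpose_smul_units {M N : ModuleCat.{u} R} (ε : ℤˣ) (f : M ⟶ N) :
    transpose (ε • f) = ε • transpose f := by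
  obtain rfl | rfl := Int.units_eq_one_or ε
  · rw [one_smul, one_smul]
  · rw [Units.neg_smul, Units.neg_smul, one_smul, one_smul]
    apply ModuleCat.hom_ext
    exact LinearMap.ext fun φ => LinearMap.ext fun x => map_neg φ _

/-- The dual of an isomorphism of modules. -/
def transposeIso {M N : ModuleCat.{u} R} (e : M ≅ N) :
    ModuleCat.of R (Module.Dual R N) ≅ ModuleCat.of R (Module.Dual R M) where
  hom := transpose e.hom
  inv := transpose e.inv
  hom_inv_id := by rw [← transpose_comp, e.inv_hom_id, transpose_id]
  inv_hom_id := by rw [← transpose_comp, e.hom_inv_id, transpose_id]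

/-- The dual of a shifted complex is the complex shifted in the other direction; the signs of the
differentials agree because `a` and `-a` have the same parity. -/
def dualComplexShiftIso (K : CochainComplex (ModuleCat.{u} R) ℤ) (a : ℤ) :
    dualComplex (K⟦a⟧) ≅ (dualComplex K)⟦-a⟧ :=
  HomologicalComplex.Hom.isoOfComponents
    (fun i => transposeIso (K.XIsoOfEq (show -(i + -a) = -i + a by ring))) (fun i j _ => by
      change transpose (K.XIsoOfEq (show -(i + -a) = -i + a by ring)).hom ≫
          ((-a).negOnePow • transpose (K.d (-(j + -a)) (-(i + -a)))) =
        transpose (a.negOnePow • K.d (-j + a) (-i + a)) ≫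
          transpose (K.XIsoOfEq (show -(j + -a) = -j + a by ring)).hom
      have key : transpose (K.XIsoOfEq (show -(i + -a) = -i + a by ring)).hom ≫
          transpose (K.d (-(j + -a)) (-(i + -a))) =
        transpose (K.d (-j + a) (-i + a)) ≫
          transpose (K.XIsoOfEq (show -(j + -a) = -j + a by ring)).hom := by
        rw [← transpose_comp, ← transpose_comp, HomologicalComplex.XIsoOfEq_hom_comp_d,
          HomologicalComplex.d_comp_XIsoOfEq_hom]
      rw [transpose_smul_units, Int.negOnePow_neg]
      obtain h | h := Int.units_eq_one_or a.negOnePow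
      · rw [h, one_smul, one_smul, key]
      · rw [h, Units.neg_smul, Units.neg_smul, one_smul, one_smul, Preadditive.comp_neg,
          Preadditive.neg_comp, key])

/-- The dual of a degreewise splitting. -/
def dualSplitting (S : ShortComplex (CochainComplex (ModuleCat.{u} R) ℤ))
    (σ : ∀ n, (S.map (HomologicalComplex.eval _ _ n)).Splitting)
    (h : dualComplexMap S.g ≫ dualComplexMap S.f = 0) (n : ℤ) :
    ((ShortComplex.mk (dualComplexMap S.g) (dualComplexMap S.f) h).map
      (HomologicalComplex.eval _ _ n)).Splitting where
  r := transpose (σ (-n)).s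
  s := transpose (σ (-n)).r
  f_r := congrArg transpose (σ (-n)).s_g
  s_g := congrArg transpose (σ (-n)).f_r
  id := by
    have := congrArg transpose (σ (-n)).id
    rw [transpose_add, transpose_comp, transpose_comp] at this
    exact (add_comm _ _).trans this

/-- The statement that a contravariant functor turns a triangle into a distinguished triangle, for
some third morphism, is invariant under isomorphisms of triangles. -/
lemma exists_distinguished_op_of_iso {C D : Type*} [Category* C] [Category* D] [HasShift C ℤ]
    [Preadditive D] [HasZeroObject D] [HasShift D ℤ] [∀ n : ℤ, (shiftFunctor D n).Additive]
    [Pretriangulated D] (F : Cᵒᵖ ⥤ D) {T T' : Triangle C} (e : T ≅ T')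
    (h : ∃ δ, Triangle.mk (F.map T'.mor₂.op) (F.map T'.mor₁.op) δ ∈ distTriang D) :
    ∃ δ, Triangle.mk (F.map T.mor₂.op) (F.map T.mor₁.op) δ ∈ distTriang D := by
  obtain ⟨δ, hδ⟩ := h
  let e₁ := F.mapIso (Triangle.π₁.mapIso e).op
  let e₃ := F.mapIso (Triangle.π₃.mapIso e).op
  refine ⟨e₁.inv ≫ δ ≫ e₃.hom⟦(1 : ℤ)⟧', isomorphic_distinguished _ hδ _ (Iso.symm
    (Triangle.isoMk _ _ e₃ (F.mapIso (Triangle.π₂.mapIso e).op) e₁ ?_ ?_ ?_))⟩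
  · change F.map T'.mor₂.op ≫ F.map e.hom.hom₂.op = F.map e.hom.hom₃.op ≫ F.map T.mor₂.op
    rw [← F.map_comp, ← F.map_comp, ← op_comp, ← op_comp, e.hom.comm₂]
  · change F.map T'.mor₁.op ≫ F.map e.hom.hom₁.op = F.map e.hom.hom₂.op ≫ F.map T.mor₁.op
    rw [← F.map_comp, ← F.map_comp, ← op_comp, ← op_comp, e.hom.comm₁]
  · exact (e₁.hom_inv_id_assoc _).symm

/-- Duality turns distinguished triangles into distinguished triangles, since distinguished
triangles come from degreewise split short exact sequences. The third morphism is not specified. -/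
lemma exists_distinguished_dualHomotopyCategory
    (T : Triangle (HomotopyCategory (ModuleCat.{u} R) (ComplexShape.up ℤ)))
    (hT : T ∈ distTriang _) :
    ∃ δ, Triangle.mk ((dualHomotopyCategory R).map T.mor₂.op)
      ((dualHomotopyCategory R).map T.mor₁.op) δ ∈ distTriang _ := by
  obtain ⟨S, σ, ⟨e⟩⟩ := (HomotopyCategory.distinguished_iff_iso_trianglehOfDegreewiseSplit T).1 hT
  refine exists_distinguished_op_of_iso _ e ?_
  have h : dualComplexMap S.g ≫ dualComplexMap S.f = 0 := by
    ext1 i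
    change transpose (S.g.f (-i)) ≫ transpose (S.f.f (-i)) = 0
    rw [← transpose_comp, ← HomologicalComplex.comp_f, S.zero]
    exact transpose_zero _ _
  let S' := ShortComplex.mk (dualComplexMap S.g) (dualComplexMap S.f) h
  let T' := CochainComplex.trianglehOfDegreewiseSplit S' (dualSplitting S σ h)
  have hT' : T' ∈ distTriang _ :=
    (HomotopyCategory.distinguished_iff_iso_trianglehOfDegreewiseSplit _).2
      ⟨S', dualSplitting S σ h, ⟨Iso.refl _⟩⟩
  refine ⟨T'.mor₃, isomorphic_distinguished _ hT' _ (Triangle.isoMk _ _ (Iso.refl _) (Iso.refl _)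
    (Iso.refl _) ?_ ?_ ?_)⟩
  · exact (Category.comp_id _).trans (Category.id_comp _).symm
  · exact (Category.comp_id _).trans (Category.id_comp _).symm
  · exact (congrArg (T'.mor₃ ≫ ·) (CategoryTheory.Functor.map_id _ _)).trans
      ((Category.comp_id _).trans (Category.id_comp _).symm)

lemma exists_distinguished_dual (T : Triangle (KbProj R)) (hT : T ∈ distTriang _) :
    ∃ δ, Triangle.mk ((dual R).map T.mor₂.op) ((dual R).map T.mor₁.op) δ ∈ distTriang _ := by
  obtain ⟨δ, hδ⟩ := exists_distinguished_dualHomotopyCategory _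
    ((bddHomotopy (fgProj R)).ι.map_distinguished T hT)
  let P := bddHomotopy (fgProj R)
  let δ' : (dual R).obj (Opposite.op T.obj₁) ⟶ ((dual R).obj (Opposite.op T.obj₃))⟦(1 : ℤ)⟧ :=
    P.fullyFaithfulι.preimage (δ ≫ (P.ι.commShiftIso (1 : ℤ)).inv.app
      ((dual R).obj (Opposite.op T.obj₃)))
  refine ⟨δ', ?_⟩
  rw [← P.ι.map_distinguished_iff]
  refine isomorphic_distinguished _ hδ _ (Triangle.isoMk _ _ (Iso.refl _) (Iso.refl _)
    (Iso.refl _) ?_ ?_ ?_)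
  · exact (Category.comp_id _).trans (Category.id_comp _).symm
  · exact (Category.comp_id _).trans (Category.id_comp _).symm
  · have h1 (X : HomotopyCategory (ModuleCat.{u} R) (ComplexShape.up ℤ)) :
        (𝟙 X)⟦(1 : ℤ)⟧' = 𝟙 _ := CategoryTheory.Functor.map_id _ _
    refine Eq.trans ?_ (Category.id_comp _).symm
    refine (congrArg (_ ≫ ·) (h1 _)).trans ((Category.comp_id _).trans ?_)
    have h2 : P.ι.map δ' = δ ≫ (P.ι.commShiftIso (1 : ℤ)).inv.app
      ((dual R).obj (Opposite.op T.obj₃)) := P.fullyFaithfulι.map_preimage _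
    refine (congrArg (· ≫ (P.ι.commShiftIso (1 : ℤ)).hom.app _) h2).trans ?_
    exact (Category.assoc _ _ _).trans ((congrArg (δ ≫ ·)
      ((P.ι.commShiftIso (1 : ℤ)).inv_hom_id_app _)).trans (Category.comp_id _))

/-- The dual of a shifted object of `K^b(proj R)`. -/
noncomputable def dualShiftIso (X : KbProj R) (a : ℤ) :
    (dual R).obj (Opposite.op (X⟦a⟧)) ≅ ((dual R).obj (Opposite.op X))⟦-a⟧ :=
  let P := bddHomotopy (fgProj R)
  let Q := HomotopyCategory.quotient (ModuleCat.{u} R) (ComplexShape.up ℤ)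
  let e : P.ι.obj (X⟦a⟧) ≅ Q.obj (X.obj.as⟦a⟧) :=
    (P.ι.commShiftIso a).app X ≪≫ (Q.commShiftIso a).symm.app X.obj.as
  let e' : P.ι.obj (((dual R).obj (Opposite.op X))⟦-a⟧) ≅ Q.obj ((dualComplex X.obj.as)⟦-a⟧) :=
    (P.ι.commShiftIso (-a)).app ((dual R).obj (Opposite.op X)) ≪≫
      (Q.commShiftIso (-a)).symm.app (dualComplex X.obj.as)
  P.fullyFaithfulι.preimageIso (((dualHomotopyCategory R).mapIso e.op).symm ≪≫
    Q.mapIso (dualComplexShiftIso X.obj.as a) ≪≫ e'.symm)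

/-- The t-structure on `K^b(proj R)` which corresponds to a given one under duality. As duality is
contravariant it exchanges aisle and coaisle and changes the sign of the degrees. -/
noncomputable def dualTStructure (t : TStructure (KbProj R)) : TStructure (KbProj R) where
  le n X := t.ge (-n) ((dual R).obj (Opposite.op X))
  ge n X := t.le (-n) ((dual R).obj (Opposite.op X))
  le_isClosedUnderIsomorphisms n :=
    ⟨fun e hX => (t.ge (-n)).prop_of_iso ((dual R).mapIso e.op).symm hX⟩
  ge_isClosedUnderIsomorphisms n :=
    ⟨fun e hX => (t.le (-n)).prop_of_iso ((dual R).mapIso e.op).symm hX⟩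
  le_shift n a n' hn X hX :=
    (t.ge (-n')).prop_of_iso (dualShiftIso X a).symm (t.ge_shift (-n) (-a) (-n') (by lia) _ hX)
  ge_shift n a n' hn X hX :=
    (t.le (-n')).prop_of_iso (dualShiftIso X a).symm (t.le_shift (-n) (-a) (-n') (by lia) _ hX)
  zero' X Y f hX hY := dual_map_injective
    ((t.zero_of_isLE_of_isGE _ (-1) (-0) (by lia) ⟨hY⟩ ⟨hX⟩).trans (dual_map_zero X Y).symm)
  le_zero_le X hX := t.ge_antitone (by lia : (-1 : ℤ) ≤ -0) _ hX
  ge_one_le X hX := t.le_monotone (by lia : (-1 : ℤ) ≤ -0) _ hX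
  exists_triangle_zero_one A := by
    obtain ⟨U, V, hU, hV, f, g, h, hT⟩ :=
      t.exists_triangle ((dual R).obj (Opposite.op A)) (-1) 0 rfl
    obtain ⟨δ, hδ⟩ := exists_distinguished_dual _ hT
    refine ⟨_, _, (t.ge (-0)).prop_of_iso (doubleDualIso V) hV,
      (t.le (-1)).prop_of_iso (doubleDualIso U) hU,
      (dual R).map g.op ≫ (doubleDualIso A).inv, (doubleDualIso A).hom ≫ (dual R).map f.op, δ,
      isomorphic_distinguished _ hδ _
        (Triangle.isoMk _ _ (Iso.refl _) (doubleDualIso A) (Iso.refl _) ?_ ?_ ?_)⟩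
    · exact (Category.assoc _ _ _).trans ((congrArg (_ ≫ ·) (doubleDualIso A).inv_hom_id).trans
        ((Category.comp_id _).trans (Category.id_comp _).symm))
    · exact Category.comp_id _
    · refine Eq.trans (congrArg (_ ≫ ·) (CategoryTheory.Functor.map_id _ _)) ?_
      exact (Category.comp_id _).trans (Category.id_comp _).symm

lemma dualTStructure_le_zero (t : TStructure (KbProj R)) :
    (dualTStructure t).le 0 = dualImage (t.ge 0) := by
  ext X
  rw [dualImage_iff]
  exact iff_of_eq (congrArg (fun n => t.ge n ((dual R).obj (Opposite.op X))) neg_zero)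

lemma dualTStructure_ge_zero (t : TStructure (KbProj R)) :
    (dualTStructure t).ge 0 = dualImage (t.le 0) := by
  ext X
  rw [dualImage_iff]
  exact iff_of_eq (congrArg (fun n => t.le n ((dual R).obj (Opposite.op X))) neg_zero)

lemma tBounded_dualTStructure (t : TStructure (KbProj R)) (ht : TBounded t) :
    TBounded (dualTStructure t) := fun X => by
  obtain ⟨⟨a, ⟨ha⟩⟩, ⟨b, ⟨hb⟩⟩⟩ := ht ((dual R).obj (Opposite.op X))
  refine ⟨⟨-b, ⟨?_⟩⟩, ⟨-a, ⟨?_⟩⟩⟩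
  · change t.le (- -b) _
    rwa [neg_neg]
  · change t.ge (- -a) _
    rwa [neg_neg]

end

/-! ### Generating t-structures by a set of objects -/

section

universe t v' u'

variable {C : Type u'} [Category.{v'} C] [Preadditive C] [HasShift C ℤ]
  [∀ n : ℤ, (shiftFunctor C n).Additive]

lemma rightOrthogonal_shift (P : ObjectProperty C) [P.IsClosedUnderIsomorphisms] (a b : ℤ)
    (hab : a + b = 0) : P.rightOrthogonal.shift a = (P.shift a).rightOrthogonal := by
  ext X
  refine ⟨fun hX Y f hY => (shiftFunctor C a).map_injective ?_, fun hX Z f hZ =>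
    (shiftFunctor C b).map_injective ?_⟩
  · exact (hX (f⟦a⟧') hY).trans ((shiftFunctor C a).map_zero _ _).symm
  · let e := (shiftFunctorCompIsoId C a b hab).app X
    have h := hX (f⟦b⟧' ≫ e.hom)
      (P.prop_of_iso ((shiftFunctorCompIsoId C b a (by lia)).symm.app Z) hZ)
    rw [← cancel_mono e.hom, Functor.map_zero, zero_comp]
    exact h

variable [HasZeroObject C] [Pretriangulated C]


/-- The t-structure with given aisle `P`. -/
def tStructureOfAisle (P : ObjectProperty C) [P.IsClosedUnderIsomorphisms]
    (hP : P ≤ P.shift (1 : ℤ))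
    (h : ∀ X : C, ∃ (U V : C) (f : U ⟶ X) (g : X ⟶ V) (δ : V ⟶ U⟦(1 : ℤ)⟧),
      P U ∧ P.rightOrthogonal V ∧ Triangle.mk f g δ ∈ distTriang C) : TStructure C where
  le n := P.shift n
  ge n := P.rightOrthogonal.shift (n - 1)
  le_shift n a n' hn X hX := by
    change (P.shift n').shift a X
    rwa [P.shift_shift a n' n hn]
  ge_shift n a n' hn X hX := by
    change (P.rightOrthogonal.shift (n' - 1)).shift a X
    rwa [P.rightOrthogonal.shift_shift a (n' - 1) (n - 1) (by lia)]
  zero' X Y f hX hY := by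
    rw [P.shift_zero] at hX
    rw [sub_self, P.rightOrthogonal.shift_zero] at hY
    exact hY f hX
  le_zero_le := by rwa [P.shift_zero]
  ge_one_le X hX := by
    rw [sub_self, P.rightOrthogonal.shift_zero] at hX
    rw [rightOrthogonal_shift P (0 - 1) 1 (by lia)]
    intro Z f hZ
    refine hX f ((P.prop_iff_of_iso ((shiftFunctorCompIsoId C (0 - 1 : ℤ) 1 (by lia)).app Z)).1
      (hP _ hZ))
  exists_triangle_zero_one X := by
    obtain ⟨U, V, f, g, δ, hU, hV, hT⟩ := h X
    refine ⟨U, V, ?_, ?_, f, g, δ, hT⟩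
    · rwa [P.shift_zero]
    · rwa [sub_self, P.rightOrthogonal.shift_zero]

variable {A : ObjectProperty C}

instance : ObjectProperty.IsClosedUnderIsomorphisms (Coprod.{v', u', t} A) where
  of_iso e h := .of_iso e h

lemma Coprod.of_isZero {X : C} (hX : IsZero X) : Coprod.{v', u', t} A X :=
  .coproduct (PEmpty.elim : PEmpty.{t + 1} → C) (Cofan.mk X fun i => i.elim)
    (Cofan.IsColimit.mk _ (fun _ => hX.to_ _) (fun _ i => i.elim) fun _ _ _ => hX.eq_of_src _ _)
    fun i => i.elim

/-- Shifting a coproduct. -/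
noncomputable def isColimitCofanShift {ι : Type t} {X : ι → C} (c : Cofan X) (hc : IsColimit c)
    (n : ℤ) : IsColimit (Cofan.mk (f := fun i => (X i)⟦n⟧) (c.pt⟦n⟧) fun i => (c.inj i)⟦n⟧') :=
  isColimitCofanMkObjOfIsColimit (shiftFunctor C n) X c.inj
    (IsColimit.ofIsoColimit hc (Cofan.ext (Iso.refl _) fun _ => Category.comp_id _))

lemma Coprod.shift_one (hA : A ≤ A.shift (1 : ℤ)) {X : C} (hX : Coprod.{v', u', t} A X) :
    Coprod.{v', u', t} A (X⟦(1 : ℤ)⟧) := by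
  induction hX with
  | of X hX => exact .of _ (hA _ hX)
  | of_iso e _ ih => exact .of_iso ((shiftFunctor C (1 : ℤ)).mapIso e) ih
  | coproduct X c hc _ ih => exact .coproduct _ _ (isColimitCofanShift c hc 1) ih
  | extension T hT _ _ ih₁ ih₃ => exact .extension _ (Triangle.shift_distinguished T hT 1) ih₁ ih₃

/-- An object which is right orthogonal to `A` is right orthogonal to `Coprod A`. -/
lemma rightOrthogonal_coprod {V : C} (hV : A.rightOrthogonal V) :
    ObjectProperty.rightOrthogonal (Coprod.{v', u', t} A) V := by
  intro X f hX
  induction hX with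
  | of X hX => exact hV f hX
  | of_iso e _ ih => rw [← cancel_epi e.hom, ih (e.hom ≫ f), comp_zero]
  | coproduct X c hc _ ih =>
    exact Cofan.IsColimit.hom_ext hc _ _ fun i => by rw [ih i (c.inj i ≫ f), comp_zero]
  | extension T hT _ _ ih₁ ih₃ =>
    obtain ⟨g, hg⟩ := Triangle.yoneda_exact₂ T hT f (ih₁ _)
    rw [hg, ih₃ g, comp_zero]

/-- Every morphism from `s` to a coproduct is a finite sum of morphisms which factor through
one of the summands. -/
def FactorsThroughFiniteSums (s : C) : Prop :=
  ∀ ⦃ι : Type t⦄ ⦃X : ι → C⦄ (c : Cofan X) (_ : IsColimit c) (f : s ⟶ c.pt),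
    ∃ (F : Finset ι) (φ : ∀ i, s ⟶ X i), f = ∑ i ∈ F, φ i ≫ c.inj i

/-- A step in the construction of an approximation of `X` by objects of `Coprod A`: the cofiber of
`B ⟶ B'` is a coproduct of copies of the objects `S j`, one for each morphism from `S j` to the
cone of `f`. -/
lemma exists_approximation_step [HasCoproducts.{t} C] {J : Type t} (S : J → C)
    (hS : ∀ j, A (S j)) (hsmall : ∀ j (X : C), Small.{t} (S j ⟶ X)) {B X : C} (f : B ⟶ X)
    (hB : Coprod.{v', u', t} A B) :
    ∃ (B' : C) (f' : B' ⟶ X) (b : B ⟶ B'), Coprod.{v', u', t} A B' ∧ b ≫ f' = f ∧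
      (∀ j (g : S j ⟶ B⟦(1 : ℤ)⟧), g ≫ f⟦(1 : ℤ)⟧' = 0 → g ≫ b⟦(1 : ℤ)⟧' = 0) ∧
      (∀ j (g : S j ⟶ X), ∃ g' : S j ⟶ B', g' ≫ f' = g) := by
  obtain ⟨W, p, v, hT⟩ := distinguished_cocone_triangle f
  let E : C := ∐ fun i : Σ j, Shrink.{t} (S j ⟶ W) => S i.1
  let e : E ⟶ W := Sigma.desc fun i => (equivShrink _).symm i.2
  have he (j : J) (g : S j ⟶ W) : ∃ i : S j ⟶ E, i ≫ e = g :=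
    ⟨Sigma.ι (fun i : Σ j, Shrink.{t} (S j ⟶ W) => S i.1) ⟨j, equivShrink _ g⟩, by
      simp [e]⟩
  obtain ⟨B', b, q, hT'⟩ := distinguished_cocone_triangle₂ (e ≫ v)
  obtain ⟨f', hf₁, hf₂⟩ : ∃ f' : B' ⟶ X, b ≫ f' = 𝟙 B ≫ f ∧ q ≫ e = f' ≫ p :=
    complete_distinguished_triangle_morphism₂ _ _ hT' hT (𝟙 B) e (by
    refine (congrArg (_ ≫ ·) (CategoryTheory.Functor.map_id _ _)).trans (Category.comp_id _))
  have hbf : b ≫ f' = f := hf₁.trans (Category.id_comp f)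
  refine ⟨B', f', b, ?_, hbf, fun j g hg => ?_, fun j g => ?_⟩
  · exact .extension _ hT' hB (.coproduct _ _ (colimit.isColimit _) fun i => .of _ (hS i.1))
  · obtain ⟨h, rfl⟩ : ∃ h : S j ⟶ W, g = h ≫ v := Triangle.coyoneda_exact₁ _ hT g hg
    obtain ⟨i, rfl⟩ := he j h
    have h0 : (e ≫ v) ≫ b⟦(1 : ℤ)⟧' = 0 := comp_distTriang_mor_zero₃₁ _ hT'
    rw [Category.assoc, Category.assoc, ← Category.assoc e, h0, comp_zero]
  · obtain ⟨i, hi⟩ := he j (g ≫ p)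
    have h0 : p ≫ v = 0 := comp_distTriang_mor_zero₂₃ _ hT
    obtain ⟨k, rfl⟩ : ∃ k : S j ⟶ B', i = k ≫ q := Triangle.coyoneda_exact₃ _ hT' i (by
      change i ≫ e ≫ v = 0
      rw [← Category.assoc, hi, Category.assoc, h0, comp_zero])
    obtain ⟨m, hm⟩ : ∃ m : S j ⟶ B, g - k ≫ f' = m ≫ f :=
      Triangle.coyoneda_exact₂ _ hT (g - k ≫ f') (by
      change (g - k ≫ f') ≫ p = 0
      rw [Preadditive.sub_comp, ← hi, Category.assoc, Category.assoc, hf₂, sub_self])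
    exact ⟨k + m ≫ b, by rw [Preadditive.add_comp, Category.assoc, hbf, ← hm, add_sub_cancel]⟩

/-- Morphisms from `s` to a homotopy colimit `L` of the sequence `D` factor through some stage of
the sequence. Here `L` is the cone of the endomorphism `1 - shift` of the coproduct of the `D n`.
-/
lemma exists_factor_of_homotopyColimit {s : C} (hs : FactorsThroughFiniteSums.{t} s)
    {D : ℕ → C} (d : ∀ n, D n ⟶ D (n + 1)) (c : Cofan fun i : ULift.{t} ℕ => D i.down)
    (hc : IsColimit c) (σ : c.pt ⟶ c.pt)
    (hσ : ∀ n, c.inj ⟨n⟩ ≫ σ = c.inj ⟨n⟩ - d n ≫ c.inj ⟨n + 1⟩) {L : C} (p : c.pt ⟶ L)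
    (r : L ⟶ c.pt⟦(1 : ℤ)⟧) (hT : Triangle.mk σ p r ∈ distTriang C) (g : s ⟶ L) :
    ∃ (N : ℕ) (φ : s ⟶ D N), g = φ ≫ c.inj ⟨N⟩ ≫ p := by
  classical
  have hσp : σ ≫ p = 0 := comp_distTriang_mor_zero₁₂ _ hT
  have hrσ : r ≫ σ⟦(1 : ℤ)⟧' = 0 := comp_distTriang_mor_zero₃₁ _ hT
  have hdp (n : ℕ) : d n ≫ c.inj ⟨n + 1⟩ ≫ p = c.inj ⟨n⟩ ≫ p := by
    have := congrArg (· ≫ p) (hσ n)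
    simp only [Category.assoc, Preadditive.sub_comp, hσp, comp_zero] at this
    exact (sub_eq_zero.1 this.symm).symm
  -- the suspension of `σ` is injective on the morphisms from `s`, which have only finitely many
  -- nonzero components `φ i`: the components are determined one after the other
  have hgr : g ≫ r = 0 := by
    obtain ⟨F, φ, hF⟩ : ∃ (F : Finset (ULift.{t} ℕ))
        (φ : ∀ i : ULift.{t} ℕ, s ⟶ (D i.down)⟦(1 : ℤ)⟧),
        g ≫ r = ∑ i ∈ F, φ i ≫ (c.inj i)⟦(1 : ℤ)⟧' :=
      hs _ (isColimitCofanShift c hc 1) (g ≫ r)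
    let π (j : ℕ) : c.pt ⟶ D j := Cofan.IsColimit.desc hc fun i =>
      if h : i.down = j then eqToHom (by rw [h]) else 0
    have hπ (j : ℕ) : c.inj ⟨j⟩ ≫ π j = 𝟙 _ := by simp [π]
    have hπ' (i j : ℕ) (h : i ≠ j) : c.inj ⟨i⟩ ≫ π j = 0 := by simp [π, h]
    have hσπ₀ : σ ≫ π 0 = π 0 := Cofan.IsColimit.hom_ext hc _ _ fun ⟨i⟩ => by
      rw [← Category.assoc, hσ, Preadditive.sub_comp, Category.assoc, hπ' (i + 1) 0 (by lia),
        comp_zero, sub_zero]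
    have hσπ (j : ℕ) : σ ≫ π (j + 1) = π (j + 1) - π j ≫ d j :=
      Cofan.IsColimit.hom_ext hc _ _ fun ⟨i⟩ => by
        rw [← Category.assoc, hσ, Preadditive.sub_comp, Category.assoc, Preadditive.comp_sub]
        congr 1
        rw [← Category.assoc (c.inj ⟨i⟩)]
        obtain rfl | h := eq_or_ne i j
        · rw [hπ, hπ, Category.comp_id, Category.id_comp]
        · rw [hπ' i j h, hπ' (i + 1) (j + 1) (by lia), comp_zero, zero_comp]
    have h0 : (g ≫ r) ≫ σ⟦(1 : ℤ)⟧' = 0 := by rw [Category.assoc, hrσ, comp_zero]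
    have hz (j : ℕ) : (g ≫ r) ≫ (π j)⟦(1 : ℤ)⟧' = 0 := by
      induction j with
      | zero => rw [← hσπ₀, Functor.map_comp, ← Category.assoc, h0, zero_comp]
      | succ j ih =>
        have h1 : (g ≫ r) ≫ (σ ≫ π (j + 1))⟦(1 : ℤ)⟧' = 0 := by
          rw [Functor.map_comp, ← Category.assoc, h0, zero_comp]
        rw [hσπ, Functor.map_sub, Preadditive.comp_sub, Functor.map_comp, ← Category.assoc, ih,
          zero_comp, sub_zero] at h1
        exact h1
    have hφ (i : ULift.{t} ℕ) (hi : i ∈ F) : φ i = 0 := by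
      have := hz i.down
      rw [hF, Preadditive.sum_comp, Finset.sum_eq_single_of_mem i hi] at this
      · rw [Category.assoc, ← Functor.map_comp, hπ i.down, CategoryTheory.Functor.map_id,
          Category.comp_id] at this
        exact this
      · intro j _ hj
        rw [Category.assoc, ← Functor.map_comp, hπ' j.down i.down fun h => hj (ULift.ext _ _ h),
          Functor.map_zero, comp_zero]
    rw [hF]
    exact Finset.sum_eq_zero fun i hi => by rw [hφ i hi, zero_comp]
  obtain ⟨a, ha⟩ : ∃ a : s ⟶ c.pt, g = a ≫ p := Triangle.coyoneda_exact₃ _ hT g hgr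
  obtain ⟨F, φ, hF⟩ := hs c hc a
  rw [ha, hF]
  -- increasing the stage
  have hmono (M N : ℕ) (hMN : M ≤ N) (ψ : s ⟶ D M) :
      ∃ ψ' : s ⟶ D N, ψ ≫ c.inj ⟨M⟩ ≫ p = ψ' ≫ c.inj ⟨N⟩ ≫ p := by
    induction hMN with
    | refl => exact ⟨ψ, rfl⟩
    | step _ ih =>
      obtain ⟨ψ', h⟩ := ih
      exact ⟨ψ' ≫ d _, by rw [h, Category.assoc, hdp]⟩
  clear hF
  induction F using Finset.induction_on with
  | empty => exact ⟨0, 0, by simp⟩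
  | insert i F hi ih =>
    obtain ⟨N, ψ, hψ⟩ := ih
    obtain ⟨ψ₁, h₁⟩ := hmono _ (max N i.down) (le_max_left _ _) ψ
    obtain ⟨ψ₂, h₂⟩ := hmono _ (max N i.down) (le_max_right _ _) (φ i)
    refine ⟨max N i.down, ψ₂ + ψ₁, ?_⟩
    rw [Finset.sum_insert hi, Preadditive.add_comp, hψ, Preadditive.add_comp, h₁, ← h₂,
      Category.assoc]

/-- The approximation triangle of `X` with respect to `Coprod A`: the successive approximations of
`exists_approximation_step` have a homotopy colimit `L`. Morphisms from the generators (and their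
shifts by `-1`) to `L` factor through a stage of the construction, whence there are none to the
cone of `L ⟶ X`. -/
lemma exists_approximation_triangle [HasCoproducts.{t} C] {J : Type t} (S : J → C)
    (hS : ∀ j, A (S j)) (hSA : ∀ X, A X → ∃ j, Nonempty (S j ≅ X)) (hA : A ≤ A.shift (1 : ℤ))
    (hsmall : ∀ j (X : C), Small.{t} (S j ⟶ X))
    (hfin : ∀ j, FactorsThroughFiniteSums.{t} ((S j)⟦(-1 : ℤ)⟧)) (X : C) :
    ∃ (U V : C) (f : U ⟶ X) (g : X ⟶ V) (δ : V ⟶ U⟦(1 : ℤ)⟧), Coprod.{v', u', t} A U ∧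
      ObjectProperty.rightOrthogonal (Coprod.{v', u', t} A) V ∧
      Triangle.mk f g δ ∈ distTriang C := by
  let Stage := Σ' (B : C) (_ : B ⟶ X), Coprod.{v', u', t} A B
  have hstep (B : Stage) := exists_approximation_step S hS hsmall B.2.1 B.2.2
  choose B' f' b hB' hbf hkill hsurj using hstep
  let stage (n : ℕ) : Stage := Nat.rec ⟨0, 0, .of_isZero (isZero_zero C)⟩
    (fun _ B => ⟨B' B, f' B, hB' B⟩) n
  let B (n : ℕ) : C := (stage n).1
  let f (n : ℕ) : B n ⟶ X := (stage n).2.1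
  let d (n : ℕ) : B n ⟶ B (n + 1) := b (stage n)
  have hdf (n : ℕ) : d n ≫ f (n + 1) = f n := hbf (stage n)
  let c : Cofan fun i : ULift.{t} ℕ => B i.down := colimit.cocone _
  have hc : IsColimit c := colimit.isColimit _
  let σ : c.pt ⟶ c.pt := Cofan.IsColimit.desc hc fun i =>
    c.inj i - d i.down ≫ c.inj ⟨i.down + 1⟩
  have hσ (n : ℕ) : c.inj ⟨n⟩ ≫ σ = c.inj ⟨n⟩ - d n ≫ c.inj ⟨n + 1⟩ :=
    Cofan.IsColimit.fac hc _ _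
  obtain ⟨L, p, r, hT⟩ := distinguished_cocone_triangle σ
  have hP : Coprod.{v', u', t} A c.pt := .coproduct _ c hc fun i => (stage i.down).2.2
  have hL : Coprod.{v', u', t} A L := .extension _ (rot_of_distTriang _ hT) hP (hP.shift_one hA)
  let fP : c.pt ⟶ X := Cofan.IsColimit.desc hc fun i => f i.down
  have hfP (n : ℕ) : c.inj ⟨n⟩ ≫ fP = f n := Cofan.IsColimit.fac hc _ _
  obtain ⟨F, hF⟩ : ∃ F : L ⟶ X, fP = p ≫ F := Triangle.yoneda_exact₂ _ hT fP
    (Cofan.IsColimit.hom_ext hc _ _ fun ⟨i⟩ => by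
      change c.inj ⟨i⟩ ≫ σ ≫ fP = c.inj ⟨i⟩ ≫ 0
      rw [← Category.assoc, hσ, Preadditive.sub_comp, Category.assoc, hfP, hfP, hdf, sub_self,
        comp_zero])
  have hpF (n : ℕ) : c.inj ⟨n⟩ ≫ p ≫ F = f n := by rw [← hF, hfP]
  have hdp (n : ℕ) : d n ≫ c.inj ⟨n + 1⟩ ≫ p = c.inj ⟨n⟩ ≫ p := by
    have h0 : σ ≫ p = 0 := comp_distTriang_mor_zero₁₂ _ hT
    have := congrArg (· ≫ p) (hσ n)
    simp only [Category.assoc, Preadditive.sub_comp, h0, comp_zero] at this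
    exact (sub_eq_zero.1 this.symm).symm
  obtain ⟨V, y, z, hT'⟩ := distinguished_cocone_triangle F
  refine ⟨L, V, F, y, z, hL, rightOrthogonal_coprod ?_, hT'⟩
  -- there are no morphisms from the generators to the cone of `F`
  suffices key : ∀ j (h : S j ⟶ V), h = 0 by
    intro Y h hY
    obtain ⟨j, ⟨e⟩⟩ := hSA Y hY
    rw [← cancel_epi e.hom, key j (e.hom ≫ h), comp_zero]
  intro j h
  have hFy : F ≫ y = 0 := comp_distTriang_mor_zero₁₂ _ hT'
  have hzF : z ≫ F⟦(1 : ℤ)⟧' = 0 := comp_distTriang_mor_zero₃₁ _ hT'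
  let θ := (shiftFunctorCompIsoId C (-1 : ℤ) 1 (by simp)).app (S j)
  have hhz : h ≫ z = 0 := by
    obtain ⟨k, hk⟩ := (shiftFunctor C (1 : ℤ)).map_surjective (θ.hom ≫ h ≫ z)
    have hkF : k ≫ F = 0 := (shiftFunctor C (1 : ℤ)).map_injective (by
      rw [Functor.map_comp, hk, Category.assoc, Category.assoc, hzF, comp_zero, comp_zero,
        Functor.map_zero])
    obtain ⟨N, φ, hφ⟩ := exists_factor_of_homotopyColimit (hfin j) d c hc σ hσ p r hT k
    have h1 : φ ≫ f N = 0 := by rw [← hpF, ← hkF, hφ, Category.assoc, Category.assoc]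
    have h2 : φ ≫ d N = 0 := (shiftFunctor C (1 : ℤ)).map_injective (by
      rw [Functor.map_comp, Functor.map_zero, ← cancel_epi θ.inv, comp_zero, ← Category.assoc]
      refine hkill (stage N) j _ ?_
      rw [Category.assoc, ← Functor.map_comp]
      change θ.inv ≫ (φ ≫ f N)⟦(1 : ℤ)⟧' = 0
      rw [h1, Functor.map_zero, comp_zero])
    have h3 : k = 0 := by rw [hφ, ← hdp, ← Category.assoc, h2, zero_comp]
    rw [← cancel_epi θ.hom, comp_zero, ← hk, h3, Functor.map_zero]
  obtain ⟨m, rfl⟩ : ∃ m : S j ⟶ X, h = m ≫ y := Triangle.coyoneda_exact₃ _ hT' h hhz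
  obtain ⟨m', rfl⟩ : ∃ m' : S j ⟶ B 1, m' ≫ f 1 = m := hsurj (stage 0) j m
  rw [← hpF, Category.assoc, Category.assoc, Category.assoc, hFy, comp_zero, comp_zero, comp_zero]

/-- A class `A` of objects which is closed under `[1]` and essentially small generates a
t-structure, provided that morphisms from `Y[-1]`, `Y` in `A`, to coproducts factor through finite
sums. -/
lemma exists_isGeneratedBy [HasCoproducts.{t} C] {J : Type t} (S : J → C)
    (hS : ∀ j, A (S j)) (hSA : ∀ X, A X → ∃ j, Nonempty (S j ≅ X)) (hA : A ≤ A.shift (1 : ℤ))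
    (hsmall : ∀ j (X : C), Small.{t} (S j ⟶ X))
    (hfin : ∀ j, FactorsThroughFiniteSums.{t} ((S j)⟦(-1 : ℤ)⟧)) :
    ∃ t : TStructure C, IsGeneratedBy.{v', u', t} t A := by
  refine ⟨tStructureOfAisle (Coprod.{v', u', t} A) (fun X hX => hX.shift_one hA)
    (exists_approximation_triangle S hS hSA hA hsmall hfin), ObjectProperty.shift_zero _ _,
    ?_⟩
  change (ObjectProperty.rightOrthogonal (Coprod.{v', u', t} A)).shift (0 - 1 : ℤ) = _
  rw [zero_sub]
  exact rightOrthogonal_shift _ (-1) 1 (by lia)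

end

/-! ### Direct sums of complexes and coproducts in the derived category -/

section

variable {R : Type u} [CommRing R] {ι : Type u}

instance : (colim : (Discrete ι ⥤ ModuleCat.{u} R) ⥤ ModuleCat.{u} R).Additive where
  map_add {F G} f g := by
    refine colimit.hom_ext fun j => ?_
    simp [Preadditive.comp_add, Preadditive.add_comp]

/-- A family of complexes of modules, as a complex of families of modules. -/
def familyComplex (K : ι → CochainComplex (ModuleCat.{u} R) ℤ) :
    CochainComplex (Discrete ι ⥤ ModuleCat.{u} R) ℤ where
  X n := Discrete.functor fun i => (K i).X n
  d n m := Discrete.natTrans fun i => (K i.as).d n m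
  shape n m h := by
    ext i : 2
    exact (K i.as).shape n m h
  d_comp_d' n m l _ _ := by
    ext i : 2
    exact (K i.as).d_comp_d n m l

/-- A family of morphisms of complexes of modules, as a morphism of complexes of families. -/
def familyComplexMap {K L : ι → CochainComplex (ModuleCat.{u} R) ℤ} (f : ∀ i, K i ⟶ L i) :
    familyComplex K ⟶ familyComplex L where
  f n := Discrete.natTrans fun i => (f i.as).f n
  comm' n m _ := by
    ext i : 2
    exact (f i.as).comm n m

lemma quasiIso_familyComplexMap {K L : ι → CochainComplex (ModuleCat.{u} R) ℤ}
    (f : ∀ i, K i ⟶ L i) [∀ i, QuasiIso (f i)] : QuasiIso (familyComplexMap f) := by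
  rw [quasiIso_iff]
  intro n
  rw [quasiIsoAt_iff, ShortComplex.quasiIso_iff, NatTrans.isIso_iff_isIso_app]
  intro i
  let F := (evaluation (Discrete ι) (ModuleCat.{u} R)).obj i
  let φ := (HomologicalComplex.shortComplexFunctor _ _ n).map (familyComplexMap f)
  have h : IsIso (ShortComplex.homologyMap (F.mapShortComplex.map φ)) := by
    have : QuasiIsoAt (f i.as) n := inferInstance
    rw [quasiIsoAt_iff, ShortComplex.quasiIso_iff] at this
    exact this
  have h' := ShortComplex.mapHomologyIso_hom_naturality φ F
  exact ((MorphismProperty.isomorphisms _).arrow_mk_iso_iff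
    (Arrow.isoMk _ _ h'.symm)).1 h

/-- The direct sum of a family of complexes of modules. -/
noncomputable def sumComplex (K : ι → CochainComplex (ModuleCat.{u} R) ℤ) :
    CochainComplex (ModuleCat.{u} R) ℤ :=
  (colim.mapHomologicalComplex _).obj (familyComplex K)

/-- The direct sum of a family of morphisms of complexes. -/
noncomputable def sumComplexMap {K L : ι → CochainComplex (ModuleCat.{u} R) ℤ}
    (f : ∀ i, K i ⟶ L i) : sumComplex K ⟶ sumComplex L :=
  (colim.mapHomologicalComplex _).map (familyComplexMap f)

/-- Direct sums of modules are exact, so direct sums of quasi-isomorphisms are quasi-isomorphisms.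
-/
lemma quasiIso_sumComplexMap {K L : ι → CochainComplex (ModuleCat.{u} R) ℤ}
    (f : ∀ i, K i ⟶ L i) [∀ i, QuasiIso (f i)] : QuasiIso (sumComplexMap f) := by
  have := quasiIso_familyComplexMap f
  rw [quasiIso_iff]
  intro n
  rw [quasiIsoAt_iff, ShortComplex.quasiIso_iff]
  let F := (colim : (Discrete ι ⥤ ModuleCat.{u} R) ⥤ ModuleCat.{u} R)
  have hF : F.PreservesHomology := inferInstance
  let φ := (HomologicalComplex.shortComplexFunctor _ _ n).map (familyComplexMap f)
  have h : IsIso (ShortComplex.homologyMap φ) := by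
    have : QuasiIsoAt (familyComplexMap f) n := inferInstance
    rwa [quasiIsoAt_iff, ShortComplex.quasiIso_iff] at this
  have h' := ShortComplex.mapHomologyIso_hom_naturality φ F
  exact ((MorphismProperty.isomorphisms _).arrow_mk_iso_iff
    (Arrow.isoMk _ _ h'.symm)).2 (inferInstanceAs (IsIso (F.map (ShortComplex.homologyMap φ))))

/-- The inclusion of a summand in a direct sum of complexes. -/
noncomputable def sumι (K : ι → CochainComplex (ModuleCat.{u} R) ℤ) (i : ι) :
    K i ⟶ sumComplex K where
  f n := Sigma.ι (fun i => (K i).X n) i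
  comm' n m _ := Sigma.ι_map (fun i => (K i).d n m) i

variable {K : ι → CochainComplex (ModuleCat.{u} R) ℤ}

/-- The linear map from a term of a direct sum of complexes with given components. -/
noncomputable def sumDescX {n : ℤ} {M : ModuleCat.{u} R} (f : ∀ i, (K i).X n ⟶ M) :
    (sumComplex K).X n ⟶ M :=
  Sigma.desc f

lemma sumι_descX {n : ℤ} {M : ModuleCat.{u} R} (f : ∀ i, (K i).X n ⟶ M) (i : ι) :
    (sumι K i).f n ≫ sumDescX f = f i :=
  Sigma.ι_desc _ _

lemma sumComplex_X_hom_ext {n : ℤ} {M : ModuleCat.{u} R} {f g : (sumComplex K).X n ⟶ M}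
    (h : ∀ i, (sumι K i).f n ≫ f = (sumι K i).f n ≫ g) : f = g :=
  Sigma.hom_ext _ _ h

lemma sumι_map {L : ι → CochainComplex (ModuleCat.{u} R) ℤ} (f : ∀ i, K i ⟶ L i) (i : ι) :
    sumι K i ≫ sumComplexMap f = f i ≫ sumι L i := by
  ext n : 1
  exact Sigma.ι_map (fun i => (f i).f n) i

variable {L : CochainComplex (ModuleCat.{u} R) ℤ}

/-- The morphism from a direct sum of complexes with given components. -/
noncomputable def sumDesc (f : ∀ i, K i ⟶ L) : sumComplex K ⟶ L where
  f n := sumDescX fun i => (f i).f n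
  comm' n m _ := sumComplex_X_hom_ext fun i => by
    rw [← Category.assoc, sumι_descX, (sumι K i).comm_assoc, sumι_descX, (f i).comm]

lemma sumι_desc (f : ∀ i, K i ⟶ L) (i : ι) : sumι K i ≫ sumDesc f = f i := by
  ext n : 1
  exact sumι_descX _ _

/-- Null-homotopies of the components of a morphism from a direct sum of complexes add up to a
null-homotopy. -/
noncomputable def sumDescHomotopy (f : sumComplex K ⟶ L)
    (h : ∀ i, Homotopy (sumι K i ≫ f) 0) : Homotopy f 0 where
  hom n m := sumDescX fun i => (h i).hom n m
  zero n m hnm := sumComplex_X_hom_ext fun i => by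
    rw [sumι_descX, (h i).zero n m hnm, comp_zero]
  comm n := sumComplex_X_hom_ext fun i => by
    have := (h i).comm n
    rw [dNext_eq _ (show (ComplexShape.up ℤ).Rel n (n + 1) from rfl),
      prevD_eq _ (show (ComplexShape.up ℤ).Rel (n - 1) n by simp)] at this ⊢
    rw [Preadditive.comp_add, Preadditive.comp_add, (sumι K i).comm_assoc, sumι_descX,
      ← Category.assoc ((sumι K i).f n) (sumDescX _), sumι_descX, HomologicalComplex.zero_f,
      comp_zero]
    exact this

section

variable [HasDerivedCategory.{w} (ModuleCat.{u} R)]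

/-- Each component becomes null-homotopic after composition with a quasi-isomorphism to the
summand, so the morphism does after composition with the direct sum of these quasi-isomorphisms.
-/
lemma Q_map_eq_zero_of_sumι {f : sumComplex K ⟶ L}
    (h : ∀ i, DerivedCategory.Q.map (sumι K i ≫ f) = 0) : DerivedCategory.Q.map f = 0 := by
  have (i : ι) : ∃ (P : CochainComplex (ModuleCat.{u} R) ℤ) (s : P ⟶ K i) (_ : QuasiIso s),
      Nonempty (Homotopy (s ≫ sumι K i ≫ f) 0) := by
    have h0 : DerivedCategory.Qh.map ((HomotopyCategory.quotient _ _).map (sumι K i ≫ f)) =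
        DerivedCategory.Qh.map 0 := by
      rw [Functor.map_zero]
      exact h i
    obtain ⟨P, s, hs, hs'⟩ := (MorphismProperty.map_eq_iff_precomp DerivedCategory.Qh
      (HomotopyCategory.quasiIso (ModuleCat.{u} R) (ComplexShape.up ℤ)) _ _).1 h0
    obtain ⟨P, rfl⟩ := HomotopyCategory.quotient_obj_surjective P
    obtain ⟨s, rfl⟩ := (HomotopyCategory.quotient _ _).map_surjective s
    rw [HomotopyCategory.quotient_map_mem_quasiIso_iff] at hs
    refine ⟨P, s, hs, ⟨HomotopyCategory.homotopyOfEq _ _ ?_⟩⟩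
    rw [Functor.map_comp, Functor.map_zero, hs', comp_zero]
  choose P s hs hh using this
  have := quasiIso_sumComplexMap s
  rw [← cancel_epi (DerivedCategory.Q.map (sumComplexMap s)), ← Functor.map_comp, comp_zero,
    ← DerivedCategory.Q.map_zero (sumComplex P) L]
  refine DerivedCategory.Q_map_eq_of_homotopy _ (sumDescHomotopy _ fun i => ?_)
  rw [← Category.assoc, sumι_map, Category.assoc]
  exact (hh i).some

lemma Q_sum_hom_ext {Y : DerivedCategory (ModuleCat.{u} R)}
    {f g : DerivedCategory.Q.obj (sumComplex K) ⟶ Y}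
    (h : ∀ i, DerivedCategory.Q.map (sumι K i) ≫ f = DerivedCategory.Q.map (sumι K i) ≫ g) :
    f = g := by
  suffices H : ∀ f : DerivedCategory.Q.obj (sumComplex K) ⟶ Y,
      (∀ i, DerivedCategory.Q.map (sumι K i) ≫ f = 0) → f = 0 from
    sub_eq_zero.1 (H _ fun i => by rw [Preadditive.comp_sub, h, sub_self])
  intro f hf
  let e := DerivedCategory.Q.objObjPreimageIso Y
  obtain ⟨L, g, s, _, hg⟩ := DerivedCategory.left_fac (f ≫ e.inv)
  have : DerivedCategory.Q.map g = 0 := Q_map_eq_zero_of_sumι fun i => by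
    rw [Functor.map_comp, ← cancel_mono (inv (DerivedCategory.Q.map s)), Category.assoc, ← hg,
      ← Category.assoc, hf, zero_comp, zero_comp]
  rw [← cancel_mono e.inv, hg, this, zero_comp, zero_comp]

/-- Write the components as fractions and take the direct sum of the numerators and denominators. -/
lemma exists_Q_sum_desc {Y : DerivedCategory (ModuleCat.{u} R)}
    (f : ∀ i, DerivedCategory.Q.obj (K i) ⟶ Y) :
    ∃ g : DerivedCategory.Q.obj (sumComplex K) ⟶ Y,
      ∀ i, DerivedCategory.Q.map (sumι K i) ≫ g = f i := by
  let e := DerivedCategory.Q.objObjPreimageIso Y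
  choose P s hs g hg using fun i => DerivedCategory.right_fac (f i ≫ e.inv)
  have (i : ι) : QuasiIso (s i) := (DerivedCategory.isIso_Q_map_iff_quasiIso _ _).1 (hs i)
  have := quasiIso_sumComplexMap s
  refine ⟨inv (DerivedCategory.Q.map (sumComplexMap s)) ≫ DerivedCategory.Q.map (sumDesc g) ≫ e.hom,
    fun i => ?_⟩
  rw [← cancel_epi (DerivedCategory.Q.map (s i)), ← Functor.map_comp_assoc, ← sumι_map,
    Functor.map_comp_assoc, IsIso.hom_inv_id_assoc, ← Functor.map_comp_assoc, sumι_desc,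
    ← cancel_mono e.inv, Category.assoc, Category.assoc, Iso.hom_inv_id, Category.comp_id, hg,
    IsIso.hom_inv_id_assoc]

variable (K) in
/-- The cofan in the derived category given by a direct sum of complexes. -/
noncomputable abbrev sumCofan : Cofan fun i => DerivedCategory.Q.obj (K i) :=
  Cofan.mk (DerivedCategory.Q.obj (sumComplex K)) fun i => DerivedCategory.Q.map (sumι K i)

variable (K) in
/-- Direct sums of complexes are coproducts in the derived category. -/
noncomputable def isColimitSumCofan : IsColimit (sumCofan K) :=
  Cofan.IsColimit.mk _ (fun s => (exists_Q_sum_desc s.inj).choose)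
    (fun s => (exists_Q_sum_desc s.inj).choose_spec)
    (fun s _ hm => Q_sum_hom_ext fun i =>
      (hm i).trans ((exists_Q_sum_desc s.inj).choose_spec i).symm)

instance hasCoproducts_derivedCategory :
    HasCoproducts.{u} (DerivedCategory (ModuleCat.{u} R)) := fun ι => by
  have (X : ι → DerivedCategory (ModuleCat.{u} R)) : HasCoproduct X := by
    have : HasCoproduct fun i => DerivedCategory.Q.obj (DerivedCategory.Q.objPreimage (X i)) :=
      ⟨_, isColimitSumCofan fun i => DerivedCategory.Q.objPreimage (X i)⟩
    exact hasColimit_of_iso (F := Discrete.functor fun i =>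
      DerivedCategory.Q.obj (DerivedCategory.Q.objPreimage (X i)))
      (Discrete.natIso fun i => (DerivedCategory.Q.objObjPreimageIso (X i.as)).symm)
  refine ⟨fun F => hasColimit_of_iso Discrete.natIsoFunctor⟩

end

end

/-! ### The t-structure generated by perfect objects -/

section

variable {R : Type u} [CommRing R] {ι : Type u} (K : ι → CochainComplex (ModuleCat.{u} R) ℤ)

open Classical in
/-- The projection of a direct sum of complexes to a summand. -/
noncomputable def sumπ (i : ι) : sumComplex K ⟶ K i :=
  sumDesc fun j => if h : j = i then eqToHom (by rw [h]) else 0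

lemma sumι_π_self (i : ι) : sumι K i ≫ sumπ K i = 𝟙 _ := by
  rw [sumπ, sumι_desc, dif_pos rfl, eqToHom_refl]

lemma sumι_π_of_ne {i j : ι} (h : j ≠ i) : sumι K j ≫ sumπ K i = 0 := by
  rw [sumπ, sumι_desc, dif_neg h]

/-- The projection of a direct sum of complexes to the sum of finitely many of the summands, as an
endomorphism. -/
noncomputable def finiteProj (F : Finset ι) : sumComplex K ⟶ sumComplex K :=
  ∑ i ∈ F, sumπ K i ≫ sumι K i

lemma sumι_finiteProj (F : Finset ι) (i : ι) (hi : i ∈ F) :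
    sumι K i ≫ finiteProj K F = sumι K i := by
  rw [finiteProj, Preadditive.comp_sum, Finset.sum_eq_single_of_mem i hi, ← Category.assoc,
    sumι_π_self, Category.id_comp]
  intro j _ hj
  rw [← Category.assoc, sumι_π_of_ne K hj.symm, zero_comp]

/-- An element of a direct sum has only finitely many nonzero components. -/
lemma exists_finiteProj_apply (n : ℤ) (x : (sumComplex K).X n) :
    ∃ F : Finset ι, ∀ F', F ⊆ F' → (finiteProj K F').f n x = x := by
  classical
  let S : Submodule R ((sumComplex K).X n) :=
    { carrier := {x | ∃ F : Finset ι, ∀ F', F ⊆ F' → (finiteProj K F').f n x = x}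
      zero_mem' := ⟨∅, fun F' _ => map_zero _⟩
      add_mem' := by
        rintro x y ⟨F, hF⟩ ⟨G, hG⟩
        refine ⟨F ∪ G, fun F' h => ?_⟩
        rw [map_add, hF F' (Finset.union_subset_left h), hG F' (Finset.union_subset_right h)]
      smul_mem' := by
        rintro r x ⟨F, hF⟩
        exact ⟨F, fun F' h => by rw [map_smul, hF F' h]⟩ }
  -- the submodule `S` contains all summands, which generate the direct sum
  have hS : ModuleCat.ofHom S.mkQ = 0 := by
    refine sumComplex_X_hom_ext fun i => ?_
    rw [comp_zero]
    ext x
    refine (Submodule.Quotient.mk_eq_zero S).2 ⟨{i}, fun F' h => ?_⟩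
    have := congrArg (fun f => f.f n x) (sumι_finiteProj K F' i (h (Finset.mem_singleton_self i)))
    exact this
  have : S.mkQ x = 0 := congrArg (fun f => f.hom x) hS
  exact (Submodule.Quotient.mk_eq_zero S).1 this

lemma exists_comp_finiteProj_X (n : ℤ) (M : ModuleCat.{u} R) [Module.Finite R M]
    (g : M ⟶ (sumComplex K).X n) :
    ∃ F : Finset ι, ∀ F', F ⊆ F' → g ≫ (finiteProj K F').f n = g := by
  classical
  obtain ⟨s, hs⟩ := Module.Finite.fg_top (R := R) (M := M)
  choose F hF using fun m => exists_finiteProj_apply K n (g m)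
  refine ⟨s.biUnion F, fun F' h => ModuleCat.hom_ext (LinearMap.ext_on hs fun m hm => ?_)⟩
  exact hF m F' ((Finset.subset_biUnion_of_mem F hm).trans h)

lemma exists_comp_finiteProj (P : CochainComplex (ModuleCat.{u} R) ℤ)
    (hP : bddComplexes (fgProj R) P) (g : P ⟶ sumComplex K) :
    ∃ F : Finset ι, g ≫ finiteProj K F = g := by
  classical
  obtain ⟨⟨a, b, _, _⟩, h⟩ := hP
  have (n : ℤ) : Module.Finite R (P.X n) := (h n).1
  choose F hF using fun n => exists_comp_finiteProj_X K n (P.X n) (g.f n)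
  refine ⟨(Finset.Icc a b).biUnion F, HomologicalComplex.hom_ext _ _ fun n => ?_⟩
  by_cases hn : n ∈ Finset.Icc a b
  · exact hF n _ (Finset.subset_biUnion_of_mem F hn)
  · rw [Finset.mem_Icc, not_and_or, not_le, not_le] at hn
    obtain hn | hn := hn
    · exact (P.isZero_of_isStrictlyGE a n hn).eq_of_src _ _
    · exact (P.isZero_of_isStrictlyLE b n hn).eq_of_src _ _

lemma FactorsThroughFiniteSums.of_iso {C : Type*} [Category* C] [Preadditive C] {X Y : C}
    (hX : FactorsThroughFiniteSums.{u} X) (e : X ≅ Y) : FactorsThroughFiniteSums.{u} Y := by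
  intro ι Z c hc f
  obtain ⟨F, φ, h⟩ := hX c hc (e.hom ≫ f)
  refine ⟨F, fun i => e.inv ≫ φ i, ?_⟩
  simp_rw [Category.assoc]
  rw [← Preadditive.comp_sum, ← h, Iso.inv_hom_id_assoc]

section

variable [HasDerivedCategory.{w} (ModuleCat.{u} R)]

lemma Q_map_surjective_of_fgProj (P L : CochainComplex (ModuleCat.{u} R) ℤ)
    (hP : bddComplexes (fgProj R) P) :
    Function.Surjective (DerivedCategory.Q.map : (P ⟶ L) → _) := by
  intro f
  obtain ⟨g, hg⟩ := (Qh_map_bijective_of_bddHomotopy_fgProj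
    ((HomotopyCategory.quotient _ _).obj P) hP ((HomotopyCategory.quotient _ _).obj L)).2 f
  obtain ⟨g, rfl⟩ := (HomotopyCategory.quotient _ _).map_surjective g
  exact ⟨g, hg⟩

/-- Perfect complexes are compact: a morphism to a direct sum of complexes is represented by a
morphism of complexes, whose image lies in a finite sum. -/
lemma factorsThroughFiniteSums_Q_obj (P : CochainComplex (ModuleCat.{u} R) ℤ)
    (hP : bddComplexes (fgProj R) P) :
    FactorsThroughFiniteSums.{u} (DerivedCategory.Q.obj P) := by
  intro ι X c hc f
  let K (i : ι) := DerivedCategory.Q.objPreimage (X i)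
  let e (i : ι) : DerivedCategory.Q.obj (K i) ≅ X i := DerivedCategory.Q.objObjPreimageIso (X i)
  obtain ⟨φ, hφ⟩ := exists_Q_sum_desc (K := K) fun i => (e i).hom ≫ c.inj i
  let ψ : c.pt ⟶ DerivedCategory.Q.obj (sumComplex K) :=
    Cofan.IsColimit.desc hc fun i => (e i).inv ≫ DerivedCategory.Q.map (sumι K i)
  have hψφ : ψ ≫ φ = 𝟙 _ := Cofan.IsColimit.hom_ext hc _ _ fun i => by
    rw [Cofan.IsColimit.fac_assoc, Category.assoc, hφ, Iso.inv_hom_id_assoc, Category.comp_id]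
  obtain ⟨g, hg⟩ := Q_map_surjective_of_fgProj P _ hP (f ≫ ψ)
  obtain ⟨F, hF⟩ := exists_comp_finiteProj K P hP g
  refine ⟨F, fun i => DerivedCategory.Q.map (g ≫ sumπ K i) ≫ (e i).hom, ?_⟩
  have hQ : DerivedCategory.Q.map g =
      ∑ i ∈ F, DerivedCategory.Q.map (g ≫ sumπ K i) ≫ DerivedCategory.Q.map (sumι K i) := by
    conv_lhs => rw [← hF, finiteProj, Preadditive.comp_sum, Functor.map_sum]
    exact Finset.sum_congr rfl fun i _ => by rw [← Functor.map_comp, Category.assoc]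
  rw [← Category.comp_id f, ← hψφ, ← Category.assoc, ← hg, hQ, Preadditive.sum_comp]
  exact Finset.sum_congr rfl fun i _ => by rw [Category.assoc, Category.assoc, hφ]

lemma exists_Q_obj_iso_of_perfect (X : DerivedCategory (ModuleCat.{u} R)) (hX : perfect R X) :
    ∃ P : CochainComplex (ModuleCat.{u} R) ℤ, bddComplexes (fgProj R) P ∧
      Nonempty (DerivedCategory.Q.obj P ≅ X) := by
  obtain ⟨Y, ⟨e⟩⟩ := hX
  obtain ⟨P, hP, ⟨e'⟩⟩ := exists_Q_obj_iso_kbProjToDerived Y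
  exact ⟨P, hP, ⟨e'.symm ≪≫ e⟩⟩

lemma small_hom_Q_obj (P : CochainComplex (ModuleCat.{u} R) ℤ)
    (hP : bddComplexes (fgProj R) P) (Y : DerivedCategory (ModuleCat.{u} R)) :
    Small.{u} (DerivedCategory.Q.obj P ⟶ Y) := by
  have : Small.{u} (DerivedCategory.Q.obj P ⟶
      DerivedCategory.Q.obj (DerivedCategory.Q.objPreimage Y)) :=
    small_of_surjective (Q_map_surjective_of_fgProj P (DerivedCategory.Q.objPreimage Y) hP)
  exact small_of_injective (β := DerivedCategory.Q.obj P ⟶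
      DerivedCategory.Q.obj (DerivedCategory.Q.objPreimage Y))
    (f := fun g => g ≫ (DerivedCategory.Q.objObjPreimageIso Y).inv)
    fun _ _ h => (cancel_mono _).1 h

end

/-- The complexes whose terms are quotients of the modules `Rⁿ`. They form a type in the universe of
`R`, and every complex of finitely generated modules is isomorphic to one of them. -/
structure PresentedComplex (R : Type u) [CommRing R] : Type u where
  /-- The number of generators. -/
  gens (i : ℤ) : ℕ
  /-- The relations. -/
  rels (i : ℤ) : Submodule R (Fin (gens i) → R)
  /-- The differentials. -/
  d (i j : ℤ) : ModuleCat.of R ((Fin (gens i) → R) ⧸ rels i) ⟶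
    ModuleCat.of R ((Fin (gens j) → R) ⧸ rels j)
  shape (i j : ℤ) : ¬ (ComplexShape.up ℤ).Rel i j → d i j = 0
  d_comp_d (i j k : ℤ) : d i j ≫ d j k = 0

/-- The underlying complex of modules. -/
def PresentedComplex.complex (D : PresentedComplex R) : CochainComplex (ModuleCat.{u} R) ℤ where
  X i := ModuleCat.of R ((Fin (D.gens i) → R) ⧸ D.rels i)
  d := D.d
  shape := D.shape
  d_comp_d' i j k _ _ := D.d_comp_d i j k

lemma exists_presentedComplex_iso (K : CochainComplex (ModuleCat.{u} R) ℤ)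
    (hK : ∀ i, Module.Finite R (K.X i)) :
    ∃ D : PresentedComplex R, Nonempty (D.complex ≅ K) := by
  choose n p hp using fun i => Module.Finite.exists_fin' R (K.X i)
  let e (i : ℤ) : ModuleCat.of R ((Fin (n i) → R) ⧸ LinearMap.ker (p i)) ≅ K.X i :=
    ((p i).quotKerEquivOfSurjective (hp i)).toModuleIso
  refine ⟨⟨n, fun i => LinearMap.ker (p i), fun i j => (e i).hom ≫ K.d i j ≫ (e j).inv,
    fun i j h => ?_, fun i j k => ?_⟩, ⟨HomologicalComplex.Hom.isoOfComponents e fun i j _ => ?_⟩⟩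
  · rw [K.shape i j h, zero_comp, comp_zero]
  · rw [Category.assoc, Category.assoc, Iso.inv_hom_id_assoc, K.d_comp_d_assoc, zero_comp,
      comp_zero]
  · change (e i).hom ≫ K.d i j = ((e i).hom ≫ K.d i j ≫ (e j).inv) ≫ (e j).hom
    rw [Category.assoc, Category.assoc, Iso.inv_hom_id, Category.comp_id]

/-- A full subcategory of the perfect objects which is closed under `[1]` generates a t-structure on
the derived category. -/
lemma exists_isGeneratedBy_of_le_perfect [HasDerivedCategory.{w} (ModuleCat.{u} R)]
    (A : ObjectProperty (DerivedCategory (ModuleCat.{u} R))) [A.IsClosedUnderIsomorphisms]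
    (hA : A ≤ A.shift (1 : ℤ)) (hA' : A ≤ perfect R) :
    ∃ t : TStructure (DerivedCategory (ModuleCat.{u} R)), IsGeneratedBy.{_, _, u} t A := by
  let J := {D : PresentedComplex R //
    bddComplexes (fgProj R) D.complex ∧ A (DerivedCategory.Q.obj D.complex)}
  refine exists_isGeneratedBy (J := J) (fun D => DerivedCategory.Q.obj D.1.complex)
    (fun D => D.2.2) (fun X hX => ?_) hA (fun D => small_hom_Q_obj _ D.2.1) (fun D => ?_)
  · obtain ⟨P, ⟨hP, hP'⟩, ⟨e⟩⟩ := exists_Q_obj_iso_of_perfect X (hA' _ hX)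
    obtain ⟨D, ⟨e'⟩⟩ := exists_presentedComplex_iso P fun i => (hP' i).1
    refine ⟨⟨D, ⟨?_, fun i => ?_⟩, ?_⟩, ⟨DerivedCategory.Q.mapIso e' ≪≫ e⟩⟩
    · obtain ⟨a, b, _, _⟩ := hP
      exact ⟨a, b, CochainComplex.isStrictlyGE_of_iso e'.symm a,
        CochainComplex.isStrictlyLE_of_iso e'.symm b⟩
    · exact (fgProj R).prop_of_iso
        ((HomologicalComplex.eval _ _ i).mapIso e'.symm) (hP' i)
    · exact A.prop_of_iso (e.symm ≪≫ DerivedCategory.Q.mapIso e'.symm) hX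
  · have h : perfect R ((DerivedCategory.Q.obj D.1.complex)⟦(-1 : ℤ)⟧) :=
      (perfect R).le_shift (-1 : ℤ) _ (perfect_Q_obj _ D.2.1)
    obtain ⟨P, hP, ⟨e⟩⟩ := exists_Q_obj_iso_of_perfect _ h
    exact (factorsThroughFiniteSums_Q_obj P hP).of_iso e

end

/-! ### The preferred equivalence class -/

section

universe t v' u'

variable {C : Type u'} [Category.{v'} C] [Preadditive C]

/-- The morphisms which are finite sums of morphisms through summands form a subgroup `S` of
`Hom(G, ∐ Xᵢ)`, and the projection to the quotient by `S` vanishes on the images of the groups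
`Hom(G, Xᵢ)`, whose coproduct is `Hom(G, ∐ Xᵢ)`. -/
lemma IsCompactObj.factorsThroughFiniteSums {G : C} (hG : IsCompactObj.{v', u', t} G) :
    FactorsThroughFiniteSums.{t} G := by
  classical
  intro ι X c hc f
  have := hG ι
  let S : AddSubgroup (G ⟶ c.pt) :=
    { carrier := {f | ∃ (F : Finset ι) (φ : ∀ i, G ⟶ X i), f = ∑ i ∈ F, φ i ≫ c.inj i}
      zero_mem' := ⟨∅, 0, rfl⟩
      add_mem' := by
        rintro f g ⟨F, φ, rfl⟩ ⟨F', φ', rfl⟩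
        refine ⟨F ∪ F', fun i => (if i ∈ F then φ i else 0) + if i ∈ F' then φ' i else 0, ?_⟩
        simp only [Preadditive.add_comp, Finset.sum_add_distrib, ite_comp, zero_comp,
          Finset.sum_ite_mem]
        rw [Finset.union_inter_cancel_left, Finset.union_inter_cancel_right]
      neg_mem' := by
        rintro f ⟨F, φ, rfl⟩
        exact ⟨F, fun i => - φ i, by simp⟩ }
  have h : AddCommGrpCat.ofHom (QuotientAddGroup.mk' S) = 0 := by
    refine (isColimitOfPreserves (preadditiveCoyoneda.obj (Opposite.op G)) hc).hom_ext fun ⟨i⟩ =>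
      AddCommGrpCat.hom_ext (AddMonoidHom.ext fun (φ : G ⟶ X i) => ?_)
    refine (QuotientAddGroup.eq_zero_iff (N := S) (φ ≫ c.inj i)).2 ⟨{i}, fun j => if h : i = j then
      φ ≫ eqToHom (by rw [h]) else 0, ?_⟩
    rw [Finset.sum_singleton]
    exact (congrArg (· ≫ c.inj i) ((dif_pos rfl).trans (Category.comp_id φ))).symm
  exact (QuotientAddGroup.eq_zero_iff (N := S) f).1 (congrArg (fun q => q.hom f) h)

end

section

variable {R : Type u} [CommRing R]

/-- The morphism from a complex to the direct sum of its truncations `τ^{≥ n}`, `n ≥ 0`, whose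
components are the canonical morphisms. It is defined since in degree `m` only the truncations
with `n ≤ m` are nonzero. -/
noncomputable def toSumTruncGE (K : CochainComplex (ModuleCat.{u} R) ℤ) :
    K ⟶ sumComplex fun n : ULift.{u} ℕ => K.truncGE n.down where
  f m := ∑ n ∈ Finset.range (m + 1).toNat, (K.πTruncGE n).f m ≫
    (sumι (fun n : ULift.{u} ℕ => K.truncGE n.down) ⟨n⟩).f m
  comm' m m' hm := by
    obtain rfl : m + 1 = m' := hm
    rw [Preadditive.comp_sum, Preadditive.sum_comp]
    simp only [Category.assoc, HomologicalComplex.Hom.comm, HomologicalComplex.Hom.comm_assoc]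
    refine Finset.sum_subset (Finset.range_mono (by lia)) fun n _ hn => ?_
    have : IsZero ((K.truncGE n).X m) := (K.truncGE n).isZero_of_isStrictlyGE n m (by
      rw [Finset.mem_range] at hn; lia)
    rw [← (K.πTruncGE n).comm_assoc, this.eq_of_tgt ((K.πTruncGE n).f m) 0, zero_comp]

lemma toSumTruncGE_π (K : CochainComplex (ModuleCat.{u} R) ℤ) (n : ULift.{u} ℕ) :
    toSumTruncGE K ≫ sumπ _ n = K.πTruncGE n.down := by
  ext m : 1
  change (∑ i ∈ Finset.range (m + 1).toNat, (K.πTruncGE i).f m ≫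
    (sumι (fun n : ULift.{u} ℕ => K.truncGE n.down) ⟨i⟩).f m) ≫ (sumπ _ n).f m = _
  rw [Preadditive.sum_comp]
  simp only [Category.assoc, ← HomologicalComplex.comp_f]
  by_cases hn : n.down ∈ Finset.range (m + 1).toNat
  · rw [Finset.sum_eq_single_of_mem n.down hn]
    · exact (congrArg (fun f => (K.πTruncGE n.down).f m ≫ f.f m)
        (sumι_π_self (fun n : ULift.{u} ℕ => K.truncGE n.down) n)).trans (Category.comp_id _)
    · intro j _ hj
      rw [sumι_π_of_ne _ (fun h => hj (congrArg ULift.down h))]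
      exact comp_zero
  · have : IsZero ((K.truncGE n.down).X m) :=
      (K.truncGE n.down).isZero_of_isStrictlyGE n.down m (by rw [Finset.mem_range] at hn; lia)
    exact this.eq_of_tgt _ _

variable [HasDerivedCategory.{w} (ModuleCat.{u} R)]

/-- Compact objects are bounded above: the morphism to the direct sum of the truncations `τ^{≥ n}`
factors through finitely many of them, so some component `K ⟶ τ^{≥ N} K` is zero in the derived
category. -/
lemma exists_isLE_of_factorsThroughFiniteSums (G : DerivedCategory (ModuleCat.{u} R))
    (hG : FactorsThroughFiniteSums.{u} G) : ∃ a : ℤ, G.IsLE a := by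
  let K := DerivedCategory.Q.objPreimage G
  let e : DerivedCategory.Q.obj K ≅ G := DerivedCategory.Q.objObjPreimageIso G
  obtain ⟨F, φ, h⟩ := (hG.of_iso e.symm) _
    (isColimitSumCofan fun n : ULift.{u} ℕ => K.truncGE n.down)
    (DerivedCategory.Q.map (toSumTruncGE K))
  obtain ⟨N, hN⟩ := Infinite.exists_notMem_finset F
  have h0 : DerivedCategory.Q.map (K.πTruncGE N.down) = 0 := by
    rw [← toSumTruncGE_π, Functor.map_comp, h, Preadditive.sum_comp]
    refine Finset.sum_eq_zero fun i hi => ?_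
    have : i ≠ N := fun hi' => hN (hi' ▸ hi)
    rw [Category.assoc]
    change φ i ≫ DerivedCategory.Q.map _ ≫ DerivedCategory.Q.map _ = 0
    rw [← Functor.map_comp, sumι_π_of_ne _ this, Functor.map_zero, comp_zero]
  have hK : (DerivedCategory.Q.obj K).IsLE N.down := by
    rw [DerivedCategory.isLE_Q_obj_iff, CochainComplex.isLE_iff]
    intro i hi
    have hq : QuasiIsoAt (K.πTruncGE N.down) i := K.quasiIsoAt_πTruncGE _ _ hi.le
    rw [quasiIsoAt_iff_isIso_homologyMap] at hq
    have hnat := (DerivedCategory.homologyFunctorFactors (ModuleCat.{u} R) i).hom.naturality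
      (K.πTruncGE N.down)
    have hz : HomologicalComplex.homologyMap (K.πTruncGE N.down) i = 0 := by
      refine zero_of_epi_comp
        ((DerivedCategory.homologyFunctorFactors (ModuleCat.{u} R) i).hom.app K)
        (hnat.symm.trans ?_)
      rw [Functor.comp_map, h0, Functor.map_zero, zero_comp]
      rfl
    rw [HomologicalComplex.exactAt_iff_isZero_homology, IsZero.iff_id_eq_zero,
      ← cancel_mono (HomologicalComplex.homologyMap (K.πTruncGE N.down) i), hz, comp_zero,
      comp_zero]
  exact ⟨N.down, DerivedCategory.TStructure.t.isLE_of_iso e _⟩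

/-- A t-structure in the preferred equivalence class has an aisle which is bounded above for the
canonical t-structure. -/
lemma IsInPreferredClass.exists_le (t : TStructure (DerivedCategory (ModuleCat.{u} R)))
    (ht : IsInPreferredClass.{_, _, u} t) :
    ∃ a : ℤ, t.le 0 ≤ DerivedCategory.TStructure.t.le a := by
  obtain ⟨G, ⟨hG, -⟩, tG, ⟨hle, -⟩, n, -, hn⟩ := ht
  obtain ⟨a, ha⟩ := exists_isLE_of_factorsThroughFiniteSums G hG.factorsThroughFiniteSums
  -- the objects which live in degrees `≤ a` are closed under coproducts and extensions
  have key (X : DerivedCategory (ModuleCat.{u} R)) (hX : Coprod.{_, _, u} (nonnegShifts G) X) :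
      X.IsLE a := by
    refine (DerivedCategory.TStructure.t.isLE_iff_orthogonal a (a + 1) rfl X).2 fun Y f hY => ?_
    induction hX with
    | of X hX =>
      obtain ⟨j, ⟨e⟩⟩ := hX
      have h₁ : DerivedCategory.TStructure.t.IsLE (G⟦(j : ℤ)⟧) (a - j) :=
        DerivedCategory.TStructure.t.isLE_shift G a j (a - j)
      have h₂ : DerivedCategory.TStructure.t.IsLE X (a - j) :=
        DerivedCategory.TStructure.t.isLE_of_iso e.symm _
      exact DerivedCategory.TStructure.t.zero f (a - j) (a + 1) (by lia)
    | of_iso e _ ih => rw [← cancel_epi e.hom, ih (e.hom ≫ f), comp_zero]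
    | coproduct X c hc _ ih =>
      exact Cofan.IsColimit.hom_ext hc _ _ fun i => by rw [ih i (c.inj i ≫ f), comp_zero]
    | extension T hT _ _ ih₁ ih₃ =>
      obtain ⟨g, hg⟩ := Triangle.yoneda_exact₂ T hT f (ih₁ _)
      rw [hg, ih₃ g, comp_zero]
  refine ⟨a + n, fun X hX => ?_⟩
  have h1 : tG.le 0 (X⟦(n : ℤ)⟧) := tG.le_shift n n 0 (by lia) X (hn _ hX)
  rw [hle] at h1
  have h2 : DerivedCategory.TStructure.t.IsLE (X⟦(n : ℤ)⟧) a := key _ h1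
  exact (DerivedCategory.TStructure.t.isLE_of_shift X (a + n) n a).le

/-- The essential image in the derived category of the aisle of a t-structure on `K^b(proj R)`
generates a t-structure. -/
lemma exists_isGeneratedBy_map_le (t : TStructure (KbProj R)) :
    ∃ t' : TStructure (DerivedCategory (ModuleCat.{u} R)),
      IsGeneratedBy.{_, _, u} t' ((t.le 0).map (kbProjToDerived R)) := by
  refine exists_isGeneratedBy_of_le_perfect _ ?_ ?_
  · rintro X ⟨Y, hY, ⟨e⟩⟩
    exact ⟨Y⟦(1 : ℤ)⟧,
      t.le_monotone (show (-1 : ℤ) ≤ 0 by lia) _ (t.le_shift 0 1 (-1) (by lia) _ hY),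
      ⟨((kbProjToDerived R).commShiftIso (1 : ℤ)).app Y ≪≫ (shiftFunctor _ (1 : ℤ)).mapIso e⟩⟩
  · rintro X ⟨Y, -, ⟨e⟩⟩
    exact ⟨Y, ⟨e⟩⟩

end

/-! ### The dual Koszul complexes of the variables -/

lemma mem_allVarsIdeal_X (k : Type u) [Field k] (n : ℕ) :
    (MvPolynomial.X n : MvPolynomial ℕ k) ∈ allVarsIdeal k := by
  exact Ideal.subset_span ⟨n, rfl⟩

lemma allVarsIdeal_ne_top (k : Type u) [Field k] : allVarsIdeal k ≠ ⊤ := fun h =>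
  one_notMem_allVarsIdeal k (h ▸ Submodule.mem_top)

lemma not_isZero_homology_dual_koszul_X (k : Type u) [Field k] (n : ℕ) :
    ¬ IsZero ((HomotopyCategory.homologyFunctor (ModuleCat.{u} (MvPolynomial ℕ k))
      (ComplexShape.up ℤ) n).obj
        ((dual _).obj (Opposite.op (koszul (MvPolynomial.X (R := k)) n))).obj) := fun h =>
  not_isZero_homology_dualComplex_koszulComplex (allVarsIdeal k) (allVarsIdeal_ne_top k) _
    (mem_allVarsIdeal_X k) n
    (h.of_iso ((HomotopyCategory.homologyFunctorFactors _ _ (n : ℤ)).symm.app _))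

end PerfTStr

open PerfTStr
theorem proposition4p18 (k : Type u) [Field k]
    [HasDerivedCategory.{w} (ModuleCat.{u} (MvPolynomial ℕ k))] :
    (IsCoherentRing (MvPolynomial ℕ k) ∧
      IsHomologicallyRegular (MvPolynomial ℕ k) ∧
      finitisticDimension (MvPolynomial ℕ k) = ⊤ ∧
      (kbProjToDbMod (MvPolynomial ℕ k)).IsEquivalence ∧
      ∀ X : SingularityCategory (MvPolynomial ℕ k), IsZero X) ∧
    ∃ t₁ t₂ : TStructure (KbProj (MvPolynomial ℕ k)),
      (t₁.le 0 = cohLE (MvPolynomial ℕ k) ∧ t₁.ge 0 = cohGE (MvPolynomial ℕ k)) ∧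
      (t₂.le 0 = dualImage (cohGE (MvPolynomial ℕ k)) ∧
        t₂.ge 0 = dualImage (cohLE (MvPolynomial ℕ k))) ∧
      TBounded t₁ ∧ TBounded t₂ ∧ ¬ TEquivalent t₁ t₂ ∧
      (∀ n : ℕ, t₁.ge 0 (koszul (MvPolynomial.X (R := k)) n) ∧
        t₂.le 0 ((dual _).obj (Opposite.op (koszul (MvPolynomial.X (R := k)) n))) ∧
        ¬ t₁.le ((n : ℤ) - 1)
          ((dual _).obj (Opposite.op (koszul (MvPolynomial.X (R := k)) n)))) ∧
      ∃ t : TStructure (DerivedCategory (ModuleCat.{u} (MvPolynomial ℕ k))),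
        IsGeneratedBy.{_, _, u} t ((t₂.le 0).map (kbProjToDerived (MvPolynomial ℕ k))) ∧
        ¬ IsInPreferredClass.{_, _, u} t := by
  have hR := isCoherentRing_mvPolynomial k
  have hreg := isHomologicallyRegular_mvPolynomial k
  have hess := kbProjToDbMod_essSurj hR hreg
  let t₁ := canonicalTStructure hR hreg
  have hle : t₁.le 0 = cohLE _ := canonicalTStructure_le_zero hR hreg
  have hge : t₁.ge 0 = cohGE _ := canonicalTStructure_ge_zero hR hreg
  have hle₂ : (dualTStructure t₁).le 0 = dualImage (cohGE _) := by
    rw [dualTStructure_le_zero, hge]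
  have hge₂ : (dualTStructure t₁).ge 0 = dualImage (cohLE _) := by
    rw [dualTStructure_ge_zero, hle]
  have hK (n : ℕ) : (dualTStructure t₁).le 0
      ((dual _).obj (Opposite.op (koszul (MvPolynomial.X (R := k)) n))) := by
    rw [hle₂]
    exact ⟨_, cohGE_koszul_X k n, ⟨Iso.refl _⟩⟩
  have hK' (n : ℕ) (m : ℤ) (hm : m < n) :
      ¬ t₁.le m ((dual _).obj (Opposite.op (koszul (MvPolynomial.X (R := k)) n))) := fun h =>
    not_isZero_homology_dual_koszul_X k n ((canonicalTStructure_le_iff hR hreg _ _).1 h n hm)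
  refine ⟨⟨hR, hreg, finitisticDimension_mvPolynomial k, kbProjToDbMod_isEquivalence hR hreg,
    isZero_singularityCategory⟩, t₁, dualTStructure t₁, ⟨hle, hge⟩, ⟨hle₂, hge₂⟩,
    tBounded_canonicalTStructure hR hreg, tBounded_dualTStructure _
      (tBounded_canonicalTStructure hR hreg), ?_, fun n => ⟨?_, hK n, hK' n _ (by lia)⟩, ?_⟩
  -- the dual of the Koszul complex of `n + 1` variables is not in `t₁.le n`
  · rintro ⟨n, -, h⟩
    exact hK' (n + 1) n (by lia) (h _ (hK (n + 1)))
  · rw [hge]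
    exact cohGE_koszul_X k n
  · obtain ⟨t, ht⟩ := exists_isGeneratedBy_map_le (dualTStructure t₁)
    refine ⟨t, ht, fun hpref => ?_⟩
    -- the aisle of `t` contains objects with cohomology in arbitrarily high degrees
    obtain ⟨a, ha⟩ := hpref.exists_le
    rw [ht.1] at ha
    have h := ha _ (.of _ ⟨_, hK (a.toNat + 1), ⟨Iso.refl _⟩⟩)
    exact not_isZero_homology_dual_koszul_X k (a.toNat + 1)
      ((le_kbProjToDerived_iff _ _).1 h _ (by lia))
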